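/- Let $M$ be a closed smooth manifold of positive dimension $m$, let $g:M\to M$ be a diffeomorphism preserving a Riemannian metric on $M$, and let $S^*M$ be the bundle of unit covectors. Let $\partial g=({}^t dg)^{-1}$ act on $S^*M$, $\partial g(x,\xi)=(g(x),\xi\circ (dg_x)^{-1})$, and orient $S^*M$ canonically (a local orientation of $M$ followed by the orientation of the fibre as the boundary of the unit ball of $T^*_xM$ with the dual orientation). Let $\mathcal S$ be the Fréchet algebra of matrices $(a_{ij})_{i,j\in\mathbb Z}$ of complex numbers such that $\|a\|_N=\sup_{i,j}|a_{ij}|(1+|i-j|)^N<\infty$ for all $N$. Let $\Omega=\Omega(S^*M,\mathcal S)^{\mathbb Z}$ be the space of smooth complex differential forms $\omega=(\omega_{ij})$ on $S^*M$ with values in $\mathcal S$ that are invariant, i.e. $(\partial g)^*\omega_{ij}=\omega_{i+1,j+1}$ for all $i,j$, with the product $(\omega_1\omega_2)_{ij}=\sum_k(\omega_1)_{ik}\wedge(\omega_2)_{kj}$, the differential $d(\omega_{ij})=(d\omega_{ij})$ and the grading by the degree of forms; let $\mathcal A=C^\infty(S^*M,\mathcal S)^{\mathbb Z}$ be the algebra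 of invariant $\mathcal S$-valued smooth functions $f$, $f_{ij}(\partial g(p))=f_{i+1,j+1}(p)$. Let $\mathrm{Td}$ be a $g$-invariant closed smooth (inhomogeneous, complex) differential form on $M$ that represents the Todd class of $T^*M\otimes\mathbb C$, i.e. it differs by an exact form from the Chern–Weil form $\det\frac{F}{1-e^{-F}}$, $F=\frac{i}{2\pi}\cdot$(curvature of the Levi-Civita connection on $T^*M\otimes\mathbb C$), and put $$\tau(\omega)=\int_{S^*M}\omega_{00}\wedge \mathrm{Td},\qquad \omega\in\Omega,$$ where $\mathrm{Td}$ is pulled back to $S^*M$ and the component of degree $2m-1$ is integrated. Then $\tau$ is a closed graded trace on $\Omega$: for all $\omega\in\Omega$ and all homogeneous $\omega_1,\omega_2\in\Omega$, $$\tau(d\omega)=0,\qquad \tau(\omega_1\omega_2)=(-1)^{\deg\omega_1\deg\omega_2}\,\tau(\omega_2\omega_1).$$ Moreover $(\Omega,d,\tau)$ is a cycle over $\mathcal A$ in the sense of Connes (where $\tau$ is not required to be concentrated in a single degree): $\mathcal A$ is a unital algebra; $\Omega=\bigoplus_{k=0}^{2m-1}\Omega^k$ is an associative unital graded algebra; $d:\Omega^k\to\Omega^{k+1}$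 is linear with $d^2=0$ and $d(\omega_1\omega_2)=(d\omega_1)\omega_2+(-1)^{\deg\omega_1}\omega_1\,d\omega_2$; $\tau$ is linear, closed and a graded trace; and regarding functions as $0$-forms is an isomorphism of unital algebras $\mathcal A\to\Omega^0$. -/

import Mathlib

open scoped Manifold ContDiff Topology Pointwise
open Bundle Set

noncomputable section
namespace ClosedTrace

/-- The Euclidean space `ℝ^m`. -/
abbrev Coord (m : ℕ) : Type := EuclideanSpace ℝ (Fin m)

/-- Smooth Riemannian metrics on the `m`-dimensional manifold `M`. -/
abbrev Metric (m : ℕ) (M : Type*) [TopologicalSpace M] [ChartedSpace (Coord m) M]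
    [IsManifold (𝓡 m) ∞ M] : Type _ :=
  ContMDiffRiemannianMetric (𝓡 m) ∞ (Coord m) (fun x : M => TangentSpace (𝓡 m) x)

section Forms

variable {E : Type*} [NormedAddCommGroup E] [NormedSpace ℝ E]

/-- `Λ^• E* ⊗ ℂ`: families of complex-valued alternating forms, one in each degree. -/
abbrev GForm (E : Type*) [NormedAddCommGroup E] [NormedSpace ℝ E] : Type _ :=
  ∀ k : ℕ, E [⋀^Fin k]→L[ℝ] ℂ

/-- The multilinear map underlying `tensor`. -/
def tensorAux {k l m : ℕ} (hm : k + l = m) (α : E [⋀^Fin k]→L[ℝ] ℂ) (β : E [⋀^Fin l]→L[ℝ] ℂ) :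
    MultilinearMap ℝ (fun _ : Fin m => E) ℂ :=
  ((LinearMap.mul' ℝ ℂ).compMultilinearMap
    (α.toMultilinearMap.domCoprod β.toMultilinearMap)).domDomCongr
      (finSumFinEquiv.trans (finCongr hm))

/-- The multilinear map `(v₁, …, v_m) ↦ α (v₁, …, v_k) * β (v_{k+1}, …, v_m)`, `k + l = m`. -/
def tensor {k l m : ℕ} (hm : k + l = m) (α : E [⋀^Fin k]→L[ℝ] ℂ) (β : E [⋀^Fin l]→L[ℝ] ℂ) :
    ContinuousMultilinearMap ℝ (fun _ : Fin m => E) ℂ where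
  toFun v := α (fun i => v (Fin.cast hm (Fin.castAdd l i))) *
    β (fun j => v (Fin.cast hm (Fin.natAdd k j)))
  map_update_add' := by
    intro _ v i x y
    exact (tensorAux hm α β).map_update_add v i x y
  map_update_smul' := by
    intro _ v i c x
    exact (tensorAux hm α β).map_update_smul v i c x
  cont := by
    refine Continuous.mul ?_ ?_
    · exact α.cont.comp (by fun_prop)
    · exact β.cont.comp (by fun_prop)

theorem tensor_apply {k l m : ℕ} (hm : k + l = m) (α : E [⋀^Fin k]→L[ℝ] ℂ)
    (β : E [⋀^Fin l]→L[ℝ] ℂ) (v : Fin m → E) :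
    tensor hm α β v = α (fun i => v (Fin.cast hm (Fin.castAdd l i))) *
      β (fun j => v (Fin.cast hm (Fin.natAdd k j))) := rfl

/-- The exterior product of a `k`-form and an `l`-form. -/
def wedge {k l m : ℕ} (hm : k + l = m) (α : E [⋀^Fin k]→L[ℝ] ℂ) (β : E [⋀^Fin l]→L[ℝ] ℂ) :
    E [⋀^Fin m]→L[ℝ] ℂ :=
  ((k.factorial * l.factorial : ℝ)⁻¹) •
    ContinuousMultilinearMap.alternatization (tensor hm α β)

/-- The exterior product of inhomogeneous forms. -/
def gwedge (α β : GForm E) : GForm E := fun m =>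
  ∑ p : Finset.HasAntidiagonal.antidiagonal m,
    wedge (Finset.HasAntidiagonal.mem_antidiagonal.1 p.2) (α p.1.1) (β p.1.2)

/-- A scalar, as an inhomogeneous form concentrated in degree `0`. -/
def gscalar (z : ℂ) : GForm E
  | 0 => ContinuousAlternatingMap.constOfIsEmpty ℝ E (Fin 0) z
  | _ + 1 => 0

/-- The exterior derivative on the vector space `E`. -/
def flatD (α : E → GForm E) : E → GForm E := fun y k =>
  match k with
  | 0 => 0
  | k + 1 => extDeriv (fun z => α z k) y

variable {X : Type*} [TopologicalSpace X] [ChartedSpace E X]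
  {E' : Type*} [NormedAddCommGroup E'] [NormedSpace ℝ E']
  {Y : Type*} [TopologicalSpace Y] [ChartedSpace E' Y]

/-- Pullback of a form along `f : X → Y`. Forms on `X` are maps `X → GForm E`, since the tangent
space `TangentSpace 𝓘(ℝ, E) p` is by definition the model space `E`. -/
def pullback (f : X → Y) (α : Y → GForm E') : X → GForm E := fun p k =>
  (α (f p) k).compContinuousLinearMap (mfderiv 𝓘(ℝ, E) 𝓘(ℝ, E') f p)

theorem pullback_zero (f : X → Y) : pullback (E := E) f (0 : Y → GForm E') = 0 := by
  funext p k; ext v; rfl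

theorem pullback_add (f : X → Y) (α β : Y → GForm E') :
    pullback (E := E) f (α + β) = pullback f α + pullback f β := by
  funext p k; ext v; rfl

theorem pullback_smul (f : X → Y) (z : ℂ) (α : Y → GForm E') :
    pullback (E := E) f (z • α) = z • pullback f α := by
  funext p k; ext v; rfl

/-- The expression of a form on `X` in the chart at `c`. -/
def inChart (α : X → GForm E) (c : X) : E → GForm E := pullback (chartAt E c).symm α

/-- Smooth differential forms. -/
def IsSmoothForm (α : X → GForm E) : Prop :=
  ∀ (c : X) (k : ℕ), ContDiffOn ℝ ∞ (fun y => inChart α c y k) (chartAt E c).target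

/-- The exterior derivative. At `p` it is computed in the chart at `p`, which is the chart that
identifies `TangentSpace 𝓘(ℝ, E) p` with `E`. -/
def extD (α : X → GForm E) : X → GForm E := fun p => flatD (inChart α p) (chartAt E p p)

/-- A smooth partition of unity subordinate to the preferred charts. -/
def chartPartition (E X : Type*) [NormedAddCommGroup E] [NormedSpace ℝ E]
    [FiniteDimensional ℝ E] [TopologicalSpace X] [ChartedSpace E X] [IsManifold 𝓘(ℝ, E) ∞ X]
    [T2Space X] [SigmaCompactSpace X] : SmoothPartitionOfUnity X 𝓘(ℝ, E) X univ :=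
  (SmoothPartitionOfUnity.exists_isSubordinate_chartAt_source 𝓘(ℝ, E) X).choose

/-- The integral over `X` of (the degree `N` component of) a form, `N` being the dimension of `X`
and `b` a basis of `E` of volume `1`. The orientation is given by the signs `o c = ± 1` telling
whether the chart at `c` (with `E` oriented by `b`) is positively oriented. -/
def formIntegral [FiniteDimensional ℝ E] [MeasureTheory.MeasureSpace E]
    [IsManifold 𝓘(ℝ, E) ∞ X] [T2Space X] [SigmaCompactSpace X]
    (o : X → ℤˣ) {N : ℕ} (b : Fin N → E) (α : X → GForm E) : ℂ :=
  ∑ᶠ c : X, ((o c : ℤ) : ℂ) * ∫ y in (chartAt E c).target,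
    (chartPartition E X c ((chartAt E c).symm y) : ℂ) * inChart α c y N b

/-- Matrices `(α_ij)`, `i, j ∈ ℤ`, of forms on `X`. -/
abbrev MForm (E X : Type*) [NormedAddCommGroup E] [NormedSpace ℝ E] : Type _ :=
  ℤ → ℤ → X → GForm E

/-- `α` is a smooth form with values in the Fréchet algebra `𝒮` of matrices with rapidly decreasing
off-diagonal entries. Its topology is given by the norms `sup |a_ij| (1 + |i - j|) ^ N`, so that
smoothness means: for each `N` the matrix `((1 + |i - j|) ^ N α_ij)` is, in every chart, a smooth
map into the Banach space `ℓ^∞(ℤ × ℤ)`. -/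
def IsSmoothMForm (α : MForm E X) : Prop :=
  ∀ (c : X) (k N : ℕ), ∃ F : E → lp (fun _ : ℤ × ℤ => E [⋀^Fin k]→L[ℝ] ℂ) ⊤,
    ContDiffOn ℝ ∞ F (chartAt E c).target ∧
    ∀ y ∈ (chartAt E c).target, ∀ i j : ℤ,
      F y (i, j) = ((1 + |((i - j : ℤ) : ℝ)|) ^ N) • inChart (α i j) c y k

/-- Smooth functions on `X` with values in `𝒮`. -/
def IsSmoothMFun (f : X → ℤ → ℤ → ℂ) : Prop :=
  ∀ (c : X) (N : ℕ), ∃ F : E → lp (fun _ : ℤ × ℤ => ℂ) ⊤,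
    ContDiffOn ℝ ∞ F (chartAt E c).target ∧
    ∀ y ∈ (chartAt E c).target, ∀ i j : ℤ,
      F y (i, j) = ((1 + |((i - j : ℤ) : ℝ)|) ^ N) • f ((chartAt E c).symm y) i j

/-- The product of matrix-valued forms, `(α β)_ij = ∑_k α_ik ∧ β_kj`. -/
def mulM (α β : MForm E X) : MForm E X := fun i j p m =>
  ∑' k : ℤ, gwedge (α i k p) (β k j p) m

/-- The differential of matrix-valued forms, `d (α_ij) = (d α_ij)`. -/
def dM (α : MForm E X) : MForm E X := fun i j => extD (α i j)

/-- A matrix-valued function, as a matrix-valued form of degree `0`. -/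
def ofFun (f : X → ℤ → ℤ → ℂ) : MForm E X := fun i j p => gscalar (f p i j)

/-- The pointwise matrix product. -/
def mulF (f f' : X → ℤ → ℤ → ℂ) : X → ℤ → ℤ → ℂ := fun p i j => ∑' k : ℤ, f p i k * f' p k j

/-- The unit matrix. -/
def oneF : X → ℤ → ℤ → ℂ := fun _ i j => if i = j then 1 else 0

end Forms

section Cosphere

variable {n : ℕ} {M : Type*} [TopologicalSpace M] [ChartedSpace (Coord (n + 1)) M]
  [IsManifold (𝓡 (n + 1)) ∞ M]

/-- The norm on the cotangent space `T*_x M` dual to the metric on `T_x M`. -/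
def conorm (h : Metric (n + 1) M) (x : M) (ξ : TangentSpace (𝓡 (n + 1)) x →L[ℝ] ℝ) : ℝ :=
  sSup (ξ '' {v | h.inner x v v ≤ 1})

theorem conorm_bddAbove (h : Metric (n + 1) M) (x : M)
    (ξ : TangentSpace (𝓡 (n + 1)) x →L[ℝ] ℝ) : BddAbove (ξ '' {v | h.inner x v v ≤ 1}) := by
  have hb := (h.isVonNBounded x).image ξ
  rw [NormedSpace.isVonNBounded_iff, isBounded_iff_forall_norm_le] at hb
  obtain ⟨C, hC⟩ := hb
  refine ⟨2 * C, ?_⟩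
  rintro _ ⟨v, hv, rfl⟩
  have hv' : h.inner x v v ≤ 1 := hv
  have := hC (ξ ((2 : ℝ)⁻¹ • v)) ⟨(2 : ℝ)⁻¹ • v, by simp; linarith, rfl⟩
  rw [map_smul, smul_eq_mul, Real.norm_eq_abs] at this
  have := (le_abs_self _).trans this
  linarith

theorem conorm_pos (h : Metric (n + 1) M) (x : M)
    {ξ : TangentSpace (𝓡 (n + 1)) x →L[ℝ] ℝ} (hξ : ξ ≠ 0) : 0 < conorm h x ξ := by
  obtain ⟨v, hv⟩ : ∃ v, 0 < ξ v := by
    by_contra! H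
    apply hξ
    ext v
    have h1 := H v
    have h2 := H (-v)
    rw [map_neg] at h2
    exact le_antisymm h1 (neg_nonpos.1 h2)
  have hv0 : v ≠ 0 := by rintro rfl; simp at hv
  have hp := h.pos x v hv0
  set q := h.inner x v v with hq
  have hs : 0 < Real.sqrt q := Real.sqrt_pos.2 hp
  refine lt_of_lt_of_le ?_ (le_csSup (conorm_bddAbove h x ξ)
    ⟨(Real.sqrt q)⁻¹ • v, ?_, rfl⟩)
  · rw [map_smul, smul_eq_mul]; positivity
  · simp only [mem_ofPred_eq, map_smul, smul_apply, smul_eq_mul]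
    rw [← hq, ← mul_assoc, ← mul_inv, Real.mul_self_sqrt hp.le, inv_mul_cancel₀ hp.ne']

theorem conorm_smul (h : Metric (n + 1) M) (x : M)
    (ξ : TangentSpace (𝓡 (n + 1)) x →L[ℝ] ℝ) {t : ℝ} (ht : 0 ≤ t) :
    conorm h x (t • ξ) = t * conorm h x ξ := by
  have : ((t • ξ : TangentSpace (𝓡 (n + 1)) x →L[ℝ] ℝ) : TangentSpace (𝓡 (n + 1)) x → ℝ) ''
      {v | h.inner x v v ≤ 1} = t • (ξ '' {v | h.inner x v v ≤ 1}) := by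
    rw [← image_smul, image_image]; rfl
  rw [conorm, this, Real.sSup_smul_of_nonneg ht, smul_eq_mul, conorm]

/-- The cosphere bundle `S*M`: pairs `(x, ξ)` with `ξ` a unit covector at `x`. -/
@[ext] structure Cosphere (h : Metric (n + 1) M) where
  base : M
  covec : TangentSpace (𝓡 (n + 1)) base →L[ℝ] ℝ
  unit : conorm h base covec = 1


variable {h : Metric (n + 1) M}

/-- The covector of a point of `S*M`, read in the model space (of which `T_x M` is a copy). -/
def Cosphere.cov (p : Cosphere h) : Coord (n + 1) →L[ℝ] ℝ := p.covec

/-- The components of the covector in the coordinate frame of the chart of `M` at `c`. -/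
def Cosphere.coord (c : M) (p : Cosphere h) (b : Fin (n + 1)) : ℝ :=
  p.cov (tangentCoordChange (𝓡 (n + 1)) c p.base p.base (EuclideanSpace.single b (1 : ℝ)))

/-- The covector `∑ η_b dy_b` at `x`, where `y` are the coordinates of the chart at `c`. -/
def covecOf (c x : M) (η : Fin (n + 1) → ℝ) : Coord (n + 1) →L[ℝ] ℝ :=
  ∑ b, η b • (EuclideanSpace.proj b : Coord (n + 1) →L[ℝ] ℝ).comp
    (tangentCoordChange (𝓡 (n + 1)) x c x)

theorem covecOf_apply (c x : M) (η : Fin (n + 1) → ℝ) (v : Coord (n + 1)) :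
    covecOf c x η v = ∑ b, η b * (tangentCoordChange (𝓡 (n + 1)) x c x v) b := by
  simp [covecOf, -tangentBundleCore_coordChange]

theorem covecOf_smul (c x : M) (η : Fin (n + 1) → ℝ) (t : ℝ) :
    covecOf c x (t • η) = t • covecOf c x η := by
  simp only [covecOf, Finset.smul_sum, smul_smul, Pi.smul_apply, smul_eq_mul]

theorem covecOf_coord (c : M) (p : Cosphere h) (hp : p.base ∈ (chartAt (Coord (n + 1)) c).source) :
    covecOf c p.base (p.coord c) = p.cov := by
  refine ContinuousLinearMap.ext fun v => ?_
  rw [covecOf_apply]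
  set u := tangentCoordChange (𝓡 (n + 1)) p.base c p.base v with hu
  have key : tangentCoordChange (𝓡 (n + 1)) c p.base p.base u = v := by
    rw [hu, tangentCoordChange_comp, tangentCoordChange_self] <;> simp [hp]
  have hsum : (u : Coord (n + 1)) = ∑ b, u b • EuclideanSpace.single b (1 : ℝ) := by
    ext i; simp [Finset.sum_apply, Pi.single_apply]
  have h2 : p.cov v =
      (p.cov.comp (tangentCoordChange (𝓡 (n + 1)) c p.base p.base))
        (∑ b, u b • EuclideanSpace.single b (1 : ℝ)) := by
    rw [← hsum]; exact congrArg (⇑p.cov) key.symm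
  rw [h2, map_sum]
  refine Finset.sum_congr rfl fun b _ => ?_
  rw [map_smul, smul_eq_mul, mul_comm]
  rfl

theorem covecOf_tangentCoordChange (c c' x : M) (hc : x ∈ (chartAt (Coord (n + 1)) c).source)
    (hc' : x ∈ (chartAt (Coord (n + 1)) c').source) (η : Fin (n + 1) → ℝ) (v : Coord (n + 1)) :
    covecOf c x η (tangentCoordChange (𝓡 (n + 1)) c' x x v) =
      ∑ d, η d * (tangentCoordChange (𝓡 (n + 1)) c' c x v) d := by
  rw [covecOf_apply]
  refine Finset.sum_congr rfl fun d _ => ?_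
  rw [tangentCoordChange_comp] <;> simp [hc, hc']

theorem covecOf_single (c x : M) (hc : x ∈ (chartAt (Coord (n + 1)) c).source)
    (η : Fin (n + 1) → ℝ) (b : Fin (n + 1)) :
    covecOf c x η (tangentCoordChange (𝓡 (n + 1)) c x x (EuclideanSpace.single b (1 : ℝ))) =
      η b := by
  rw [covecOf_tangentCoordChange c c x hc hc]
  have : tangentCoordChange (𝓡 (n + 1)) c c x (EuclideanSpace.single b (1 : ℝ)) =
      EuclideanSpace.single b (1 : ℝ) := tangentCoordChange_self (by simpa using hc)
  rw [this]
  simp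

theorem covecOf_ne_zero (c x : M) (hc : x ∈ (chartAt (Coord (n + 1)) c).source)
    {η : Fin (n + 1) → ℝ} {b : Fin (n + 1)} (hb : η b ≠ 0) : covecOf c x η ≠ 0 := by
  intro H
  apply hb
  rw [← covecOf_single c x hc η b, H]
  rfl

/-- The unit covector on the ray of a non-zero covector. -/
def Cosphere.ofNeZero (h : Metric (n + 1) M) (x : M) (ξ : TangentSpace (𝓡 (n + 1)) x →L[ℝ] ℝ)
    (hξ : ξ ≠ 0) : Cosphere h where
  base := x
  covec := (conorm h x ξ)⁻¹ • ξ
  unit := by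
    have := conorm_pos h x hξ
    rw [conorm_smul h x ξ (by positivity), inv_mul_cancel₀ this.ne']

theorem Cosphere.covec_ne_zero (p : Cosphere h) : p.cov ≠ 0 := by
  intro H
  replace H : p.covec = 0 := H
  have h1 := p.unit
  have h2 := conorm_smul h p.base p.covec (t := 0) le_rfl
  rw [zero_smul, zero_mul, ← H, h1] at h2
  exact one_ne_zero h2

theorem Cosphere.exists_coord_ne_zero (c : M) (p : Cosphere h)
    (hp : p.base ∈ (chartAt (Coord (n + 1)) c).source) : ∃ b, p.coord c b ≠ 0 := by
  by_contra! H
  apply p.covec_ne_zero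
  rw [← covecOf_coord c p hp]
  refine ContinuousLinearMap.ext fun v => ?_
  rw [covecOf_apply]
  simp only [H, zero_mul, Finset.sum_const_zero]
  rfl


theorem sgn_mul_self (ε : ℤˣ) : ((ε : ℤ) : ℝ) * ((ε : ℤ) : ℝ) = 1 := by
  rw [← Int.cast_mul, ← Units.val_mul, Int.units_mul_self]; simp

theorem sgn_ne_zero (ε : ℤˣ) : ((ε : ℤ) : ℝ) ≠ 0 := by
  intro H; simpa [H] using sgn_mul_self ε

open Classical in
/-- The unit covector over the point with coordinates `y` in the chart at `c`, whose components
are positively proportional to `η` (and `p₀` if there is none). -/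
def Cosphere.mkCoord (p₀ : Cosphere h) (c : M) (y : Coord (n + 1)) (η : Fin (n + 1) → ℝ) :
    Cosphere h :=
  if hξ : covecOf c ((chartAt (Coord (n + 1)) c).symm y) η = 0 then p₀
  else Cosphere.ofNeZero h ((chartAt (Coord (n + 1)) c).symm y) (covecOf c _ η) hξ

theorem Cosphere.mkCoord_spec (p₀ : Cosphere h) (c : M) {y : Coord (n + 1)}
    (hy : y ∈ (chartAt (Coord (n + 1)) c).target) {η : Fin (n + 1) → ℝ} (hη : η ≠ 0) :
    (mkCoord p₀ c y η).base = (chartAt (Coord (n + 1)) c).symm y ∧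
    ∃ t : ℝ, 0 < t ∧ ∀ c' : M,
      (chartAt (Coord (n + 1)) c).symm y ∈ (chartAt (Coord (n + 1)) c').source →
      ∀ b, (mkCoord p₀ c y η).coord c' b = t * ∑ d, η d * (tangentCoordChange (𝓡 (n + 1)) c' c
        ((chartAt (Coord (n + 1)) c).symm y) (EuclideanSpace.single b (1 : ℝ))) d := by
  have hx := (chartAt (Coord (n + 1)) c).map_target hy
  obtain ⟨b, hb⟩ := Function.ne_iff.1 hη
  have hne : covecOf c ((chartAt (Coord (n + 1)) c).symm y) η ≠ 0 := covecOf_ne_zero c _ hx hb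
  rw [mkCoord, dif_neg hne]
  refine ⟨rfl, (conorm h ((chartAt (Coord (n + 1)) c).symm y) (covecOf c _ η))⁻¹,
    inv_pos.2 (conorm_pos h _ hne), fun c' hc' b => ?_⟩
  rw [← covecOf_tangentCoordChange c c' _ hx hc']
  rfl

theorem Cosphere.ext_of_coord (c : M) {p q : Cosphere h} (hb : p.base = q.base)
    (hp : p.base ∈ (chartAt (Coord (n + 1)) c).source) {t : ℝ} (ht : 0 ≤ t)
    (hc : ∀ b, p.coord c b = t * q.coord c b) : p = q := by
  have e1 := covecOf_coord c p hp
  have e2 := covecOf_coord c q (hb ▸ hp)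
  obtain ⟨x, ξ, hξ⟩ := p
  obtain ⟨x', ξ', hξ'⟩ := q
  obtain rfl : x = x' := hb
  have h1 : (⟨x, ξ, hξ⟩ : Cosphere h).cov = t • (⟨x, ξ', hξ'⟩ : Cosphere h).cov := by
    rw [← e1, ← e2, ← covecOf_smul]
    congr 1
    funext b
    exact hc b
  replace h1 : ξ = t • ξ' := h1
  have h2 := conorm_smul h x ξ' ht
  rw [← h1, hξ, hξ', mul_one] at h2
  subst h1
  congr 1
  rw [← h2, one_smul]

theorem insertNth_spec (p₀ : Cosphere h) (c : M) (a : Fin (n + 1)) (ε : ℤˣ) {y : Coord (n + 1)}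
    (hy : y ∈ (chartAt (Coord (n + 1)) c).target) (w : Fin n → ℝ) :
    (Cosphere.mkCoord p₀ c y (a.insertNth ((ε : ℤ) : ℝ) w)).base =
      (chartAt (Coord (n + 1)) c).symm y ∧
    ∃ t : ℝ, 0 < t ∧ ∀ b, (Cosphere.mkCoord p₀ c y (a.insertNth ((ε : ℤ) : ℝ) w)).coord c b =
      t * (a.insertNth ((ε : ℤ) : ℝ) w : Fin (n + 1) → ℝ) b := by
  have hx := (chartAt (Coord (n + 1)) c).map_target hy
  have hne : (a.insertNth ((ε : ℤ) : ℝ) w : Fin (n + 1) → ℝ) ≠ 0 := fun H => by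
    have := congrFun H a
    rw [Fin.insertNth_apply_same] at this
    exact sgn_ne_zero ε this
  obtain ⟨h1, t, ht, h2⟩ := Cosphere.mkCoord_spec p₀ c hy hne
  refine ⟨h1, t, ht, fun b => ?_⟩
  rw [h2 c hx b, ← covecOf_tangentCoordChange c c _ hx hx, covecOf_single c _ hx]

/-- The affine chart of `S*M` over the chart of `M` at `c`: on the set of unit covectors with
`ε * ξ_a > 0` the coordinates are those of `x` and the ratios `ξ_b / |ξ_a|`, `b ≠ a`.
(The point `p₀` only serves as a value outside the target.) -/
def affineChart (p₀ : Cosphere h) (c : M) (a : Fin (n + 1)) (ε : ℤˣ) :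
    PartialEquiv (Cosphere h) (Coord (n + 1) × (Fin n → ℝ)) where
  toFun p := (chartAt (Coord (n + 1)) c p.base,
    fun b => p.coord c (a.succAbove b) / (((ε : ℤ) : ℝ) * p.coord c a))
  invFun q := Cosphere.mkCoord p₀ c q.1 (a.insertNth ((ε : ℤ) : ℝ) q.2)
  source := {p | p.base ∈ (chartAt (Coord (n + 1)) c).source ∧ 0 < ((ε : ℤ) : ℝ) * p.coord c a}
  target := (chartAt (Coord (n + 1)) c).target ×ˢ univ
  map_source' p hp := ⟨(chartAt (Coord (n + 1)) c).map_source hp.1, mem_univ _⟩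
  map_target' q hq := by
    obtain ⟨h1, t, ht, h2⟩ := insertNth_spec p₀ c a ε hq.1 q.2
    refine ⟨h1 ▸ (chartAt (Coord (n + 1)) c).map_target hq.1, ?_⟩
    rw [h2 a, Fin.insertNth_apply_same, mul_left_comm, sgn_mul_self, mul_one]
    exact ht
  left_inv' p hp := by
    have hy := (chartAt (Coord (n + 1)) c).map_source hp.1
    have hp' := hp.1
    obtain ⟨h1, t, ht, h2⟩ := insertNth_spec p₀ c a ε hy
      (fun b => p.coord c (a.succAbove b) / (((ε : ℤ) : ℝ) * p.coord c a))
    rw [(chartAt (Coord (n + 1)) c).left_inv hp.1] at h1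
    refine Cosphere.ext_of_coord c h1 (by rw [← h1] at hp'; exact hp')
      (t := t / (((ε : ℤ) : ℝ) * p.coord c a)) (div_nonneg ht.le hp.2.le) fun b => ?_
    rw [h2 b]
    have h3 := hp.2.ne'
    have h4 : p.coord c a ≠ 0 := fun H => h3 (by rw [H, mul_zero])
    refine Fin.succAboveCases a ?_ (fun b => ?_) b
    · rw [Fin.insertNth_apply_same]
      have := sgn_ne_zero ε
      have h5 := sgn_mul_self ε
      field_simp
      linear_combination h5
    · rw [Fin.insertNth_apply_succAbove]
      ring
  right_inv' q hq := by
    obtain ⟨h1, t, ht, h2⟩ := insertNth_spec p₀ c a ε hq.1 q.2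
    refine Prod.ext ?_ (funext fun b => ?_)
    · change chartAt (Coord (n + 1)) c (Cosphere.mkCoord p₀ c q.1 _).base = _
      rw [h1, (chartAt (Coord (n + 1)) c).right_inv hq.1]
    · change Cosphere.coord c (Cosphere.mkCoord p₀ c q.1 _) _ / (_ * Cosphere.coord c (Cosphere.mkCoord p₀ c q.1 _) _) = _
      rw [h2, h2, Fin.insertNth_apply_same, Fin.insertNth_apply_succAbove, mul_left_comm,
        sgn_mul_self, mul_one, mul_div_cancel_left₀ _ ht.ne']


/-- The components, in the chart at `c'`, of the covector with components `(ε, w)` in the chart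
at `c`. -/
def transCoord (c : M) (a : Fin (n + 1)) (ε : ℤˣ) (c' : M) (b : Fin (n + 1))
    (q : Coord (n + 1) × (Fin n → ℝ)) : ℝ :=
  ∑ d, (a.insertNth ((ε : ℤ) : ℝ) q.2 : Fin (n + 1) → ℝ) d *
    (tangentCoordChange (𝓡 (n + 1)) c' c ((chartAt (Coord (n + 1)) c).symm q.1)
      (EuclideanSpace.single b (1 : ℝ))) d

/-- The domain over which the charts of `M` at `c` and `c'` are both defined. -/
def transDomain (c c' : M) : Set (Coord (n + 1) × (Fin n → ℝ)) :=
  ((chartAt (Coord (n + 1)) c).symm ≫ₕ chartAt (Coord (n + 1)) c').source ×ˢ univ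

theorem isOpen_transDomain (c c' : M) : IsOpen (transDomain (n := n) c c') :=
  (OpenPartialHomeomorph.open_source _).prod isOpen_univ

theorem contDiffOn_chart_trans (c c' : M) :
    ContDiffOn ℝ ∞ (fun y => chartAt (Coord (n + 1)) c' ((chartAt (Coord (n + 1)) c).symm y))
      ((chartAt (Coord (n + 1)) c).symm ≫ₕ chartAt (Coord (n + 1)) c').source := by
  have := contDiffOn_ext_coord_change (I := 𝓡 (n + 1)) (n := ∞) (M := M) c' c
  simpa [Function.comp_def, mfld_simps] using this

theorem contDiffOn_transCoord (c : M) (a : Fin (n + 1)) (ε : ℤˣ) (c' : M) (b : Fin (n + 1)) :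
    ContDiffOn ℝ ∞ (transCoord c a ε c' b) (transDomain (n := n) c c') := by
  have h1 : ContDiffOn ℝ ∞ (fun y => tangentCoordChange (𝓡 (n + 1)) c' c
      ((chartAt (Coord (n + 1)) c).symm y))
      ((chartAt (Coord (n + 1)) c).symm ≫ₕ chartAt (Coord (n + 1)) c').source := by
    have : IsManifold (𝓡 (n + 1)) (∞ + 1) M := by simpa
    have h2 := contDiffOn_fderiv_coord_change (I := 𝓡 (n + 1)) (n := ∞) (M := M)
      (achart (Coord (n + 1)) c') (achart (Coord (n + 1)) c)
    refine (h2.comp (contDiffOn_chart_trans c c') ?_).congr ?_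
    · intro y hy
      simp only [mfld_simps] at hy ⊢
      simp [hy.1, hy.2]
    · intro y hy
      rfl
  have h3 : ContDiffOn ℝ ∞ (fun q : Coord (n + 1) × (Fin n → ℝ) =>
      tangentCoordChange (𝓡 (n + 1)) c' c ((chartAt (Coord (n + 1)) c).symm q.1))
      (transDomain (n := n) c c') := h1.comp contDiff_fst.contDiffOn fun q hq => hq.1
  unfold transCoord
  refine ContDiffOn.sum fun d _ => ContDiffOn.mul ?_ ?_
  · refine ContDiff.contDiffOn ?_
    refine Fin.succAboveCases a ?_ (fun b => ?_) d
    · simp only [Fin.insertNth_apply_same]; exact contDiff_const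
    · simp only [Fin.insertNth_apply_succAbove]
      exact (contDiff_apply ℝ ℝ b).comp contDiff_snd
  · exact (EuclideanSpace.proj d : Coord (n + 1) →L[ℝ] ℝ).contDiff.comp_contDiffOn
      (h3.clm_apply contDiffOn_const)

theorem affineChart_symm_coord (p₀ : Cosphere h) (c : M) (a : Fin (n + 1)) (ε : ℤˣ) (c' : M)
    {q : Coord (n + 1) × (Fin n → ℝ)} (hq : q ∈ transDomain (n := n) c c') :
    ∃ t : ℝ, 0 < t ∧ ∀ b,
      ((affineChart p₀ c a ε).symm q).coord c' b = t * transCoord c a ε c' b q := by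
  have hq1 := hq.1
  simp only [mfld_simps] at hq1
  have hne : (a.insertNth ((ε : ℤ) : ℝ) q.2 : Fin (n + 1) → ℝ) ≠ 0 := fun H => by
    have := congrFun H a
    rw [Fin.insertNth_apply_same] at this
    exact sgn_ne_zero ε this
  obtain ⟨-, t, ht, h2⟩ := Cosphere.mkCoord_spec p₀ c hq1.1 hne
  exact ⟨t, ht, h2 c' hq1.2⟩

theorem affineChart_symm_base (p₀ : Cosphere h) (c : M) (a : Fin (n + 1)) (ε : ℤˣ)
    {q : Coord (n + 1) × (Fin n → ℝ)} (hq : q.1 ∈ (chartAt (Coord (n + 1)) c).target) :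
    ((affineChart p₀ c a ε).symm q).base = (chartAt (Coord (n + 1)) c).symm q.1 :=
  (insertNth_spec p₀ c a ε hq q.2).1

theorem affineChart_trans_source (p₀ : Cosphere h) (c : M) (a : Fin (n + 1)) (ε : ℤˣ)
    (p₀' : Cosphere h) (c' : M) (a' : Fin (n + 1)) (ε' : ℤˣ) :
    ((affineChart p₀ c a ε).symm.trans (affineChart p₀' c' a' ε')).source =
      transDomain c c' ∩
        (fun q => ((ε' : ℤ) : ℝ) * transCoord c a ε c' a' q) ⁻¹' Ioi 0 := by
  ext q
  have key : q ∈ transDomain (n := n) c c' →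
      (0 < ((ε' : ℤ) : ℝ) * ((affineChart p₀ c a ε).symm q).coord c' a' ↔
        0 < ((ε' : ℤ) : ℝ) * transCoord c a ε c' a' q) := by
    intro hq
    obtain ⟨t, ht, h2⟩ := affineChart_symm_coord p₀ c a ε c' hq
    rw [h2, mul_left_comm, mul_pos_iff_of_pos_left ht]
  constructor
  · rintro ⟨h1, h2⟩
    have h1' : q.1 ∈ (chartAt (Coord (n + 1)) c).target := h1.1
    have h2' := h2.1
    change ((affineChart p₀ c a ε).symm q).base ∈ _ at h2'
    rw [affineChart_symm_base p₀ c a ε h1'] at h2'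
    have hq : q ∈ transDomain (n := n) c c' := ⟨⟨h1', h2'⟩, mem_univ _⟩
    exact ⟨hq, (key hq).1 h2.2⟩
  · rintro ⟨hq, h3⟩
    have h1' : q.1 ∈ (chartAt (Coord (n + 1)) c).target := hq.1.1
    refine ⟨⟨h1', mem_univ _⟩, ?_, (key hq).2 h3⟩
    change ((affineChart p₀ c a ε).symm q).base ∈ _
    rw [affineChart_symm_base p₀ c a ε h1']
    exact hq.1.2

theorem isOpen_affineChart_trans_source (p₀ : Cosphere h) (c : M) (a : Fin (n + 1)) (ε : ℤˣ)
    (p₀' : Cosphere h) (c' : M) (a' : Fin (n + 1)) (ε' : ℤˣ) :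
    IsOpen ((affineChart p₀ c a ε).symm.trans (affineChart p₀' c' a' ε')).source := by
  rw [affineChart_trans_source]
  exact (continuousOn_const.mul
    (contDiffOn_transCoord c a ε c' a').continuousOn).isOpen_inter_preimage
    (isOpen_transDomain c c') isOpen_Ioi

theorem contDiffOn_affineChart_trans (p₀ : Cosphere h) (c : M) (a : Fin (n + 1)) (ε : ℤˣ)
    (p₀' : Cosphere h) (c' : M) (a' : Fin (n + 1)) (ε' : ℤˣ) :
    ContDiffOn ℝ ∞ ((affineChart p₀ c a ε).symm.trans (affineChart p₀' c' a' ε'))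
      ((affineChart p₀ c a ε).symm.trans (affineChart p₀' c' a' ε')).source := by
  rw [affineChart_trans_source]
  have h1 : ContDiffOn ℝ ∞ (fun q : Coord (n + 1) × (Fin n → ℝ) =>
      (chartAt (Coord (n + 1)) c' ((chartAt (Coord (n + 1)) c).symm q.1),
        fun b => transCoord c a ε c' (a'.succAbove b) q /
          (((ε' : ℤ) : ℝ) * transCoord c a ε c' a' q)))
      (transDomain c c' ∩
        (fun q => ((ε' : ℤ) : ℝ) * transCoord c a ε c' a' q) ⁻¹' Ioi 0) := by
    refine ContDiffOn.prodMk ?_ (contDiffOn_pi.2 fun b => ContDiffOn.div ?_ ?_ ?_)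
    · exact (contDiffOn_chart_trans c c').comp contDiff_fst.contDiffOn fun q hq => hq.1.1
    · exact (contDiffOn_transCoord c a ε c' _).mono inter_subset_left
    · exact contDiffOn_const.mul ((contDiffOn_transCoord c a ε c' _).mono inter_subset_left)
    · intro q hq
      exact (mem_Ioi.1 hq.2).ne'
  refine h1.congr fun q hq => ?_
  obtain ⟨t, ht, h2⟩ := affineChart_symm_coord p₀ c a ε c' hq.1
  have hb := affineChart_symm_base p₀ c a ε (q := q) hq.1.1.1
  refine Prod.ext ?_ (funext fun b => ?_)
  · change chartAt (Coord (n + 1)) c' ((affineChart p₀ c a ε).symm q).base = _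
    rw [hb]
  · change ((affineChart p₀ c a ε).symm q).coord c' _ /
      (_ * ((affineChart p₀ c a ε).symm q).coord c' _) = _
    rw [h2, h2, mul_left_comm, mul_div_mul_left _ _ ht.ne']

theorem Cosphere.exists_dir (c : M) (p : Cosphere h)
    (hp : p.base ∈ (chartAt (Coord (n + 1)) c).source) :
    ∃ d : Fin (n + 1) × ℤˣ, 0 < ((d.2 : ℤ) : ℝ) * p.coord c d.1 ∧
      ∀ b, |p.coord c b| ≤ ((d.2 : ℤ) : ℝ) * p.coord c d.1 := by
  obtain ⟨b₀, hb₀⟩ := p.exists_coord_ne_zero c hp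
  obtain ⟨a, -, ha⟩ := Finset.exists_max_image Finset.univ (fun b => |p.coord c b|)
    ⟨b₀, Finset.mem_univ _⟩
  have hpos : 0 < |p.coord c a| := (abs_pos.2 hb₀).trans_le (ha b₀ (Finset.mem_univ _))
  rcases le_total 0 (p.coord c a) with h0 | h0
  · refine ⟨(a, 1), ?_, fun b => ?_⟩
    · simpa [abs_of_nonneg h0] using hpos
    · simpa [abs_of_nonneg h0] using ha b (Finset.mem_univ _)
  · refine ⟨(a, -1), ?_, fun b => ?_⟩
    · simpa [abs_of_nonpos h0] using hpos
    · simpa [abs_of_nonpos h0] using ha b (Finset.mem_univ _)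

/-- The index `a` and the sign `ε` of the preferred affine chart at a point of `S*M`. -/
def Cosphere.dir (p : Cosphere h) : Fin (n + 1) × ℤˣ :=
  (p.exists_dir p.base (mem_chart_source _ _)).choose

/-- The preferred affine chart at a point of `S*M`. -/
def Cosphere.preChart (p : Cosphere h) : PartialEquiv (Cosphere h) (Coord (n + 1) × (Fin n → ℝ)) :=
  affineChart p p.base p.dir.1 p.dir.2

/-- The smooth atlas of `S*M`. -/
def cosphereCore (h : Metric (n + 1) M) :
    ChartedSpaceCore (Coord (n + 1) × (Fin n → ℝ)) (Cosphere h) where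
  atlas := range Cosphere.preChart
  chartAt := Cosphere.preChart
  mem_chart_source p := ⟨mem_chart_source _ _,
    (p.exists_dir p.base (mem_chart_source _ _)).choose_spec.1⟩
  chart_mem_atlas p := mem_range_self p
  open_source := by
    rintro _ _ ⟨p, rfl⟩ ⟨p', rfl⟩
    exact isOpen_affineChart_trans_source _ _ _ _ _ _ _ _
  continuousOn_toFun := by
    rintro _ _ ⟨p, rfl⟩ ⟨p', rfl⟩
    exact (contDiffOn_affineChart_trans _ _ _ _ _ _ _ _).continuousOn

instance : TopologicalSpace (Cosphere h) := (cosphereCore h).toTopologicalSpace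

instance : ChartedSpace (Coord (n + 1) × (Fin n → ℝ)) (Cosphere h) :=
  (cosphereCore h).toChartedSpace

theorem chartAt_toPartialEquiv (p : Cosphere h) :
    (chartAt (Coord (n + 1) × (Fin n → ℝ)) p).toPartialEquiv = p.preChart := rfl

instance : IsManifold 𝓘(ℝ, Coord (n + 1) × (Fin n → ℝ)) ∞ (Cosphere h) := by
  refine isManifold_of_contDiffOn _ _ _ ?_
  intro e e' he he'
  obtain ⟨_, ⟨p, rfl⟩, he⟩ := mem_iUnion₂.1 he
  obtain ⟨_, ⟨p', rfl⟩, he'⟩ := mem_iUnion₂.1 he'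
  obtain rfl := mem_singleton_iff.1 he
  obtain rfl := mem_singleton_iff.1 he'
  have := contDiffOn_affineChart_trans p p.base p.dir.1 p.dir.2 p' p'.base p'.dir.1 p'.dir.2
  simp only [modelWithCornersSelf_coe, modelWithCornersSelf_coe_symm, Function.comp_id,
    Function.id_comp, preimage_id, range_id, inter_univ]
  exact this


theorem Cosphere.continuousAt_of_chart {Y : Type*} [TopologicalSpace Y] {f : Cosphere h → Y}
    {p : Cosphere h} (hf : ContinuousAt (fun q => f (p.preChart.symm q)) (p.preChart p)) :
    ContinuousAt f p :=
  ((chartAt (Coord (n + 1) × (Fin n → ℝ)) p).symm.continuousAt_iff_continuousAt_comp_right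
    (mem_chart_source _ p)).2 hf

theorem Cosphere.preChart_target_mem_nhds (p : Cosphere h) :
    ((chartAt (Coord (n + 1)) p.base).target ×ˢ univ : Set (Coord (n + 1) × (Fin n → ℝ))) ∈
      𝓝 (p.preChart p) :=
  ((chartAt (Coord (n + 1)) p.base).open_target.prod isOpen_univ).mem_nhds
    ⟨(chartAt (Coord (n + 1)) p.base).map_source (mem_chart_source _ _), mem_univ _⟩

theorem Cosphere.continuous_base : Continuous (Cosphere.base : Cosphere h → M) := by
  refine continuous_iff_continuousAt.2 fun p => Cosphere.continuousAt_of_chart ?_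
  have h1 : ContinuousAt (fun q : Coord (n + 1) × (Fin n → ℝ) =>
      (chartAt (Coord (n + 1)) p.base).symm q.1) (p.preChart p) :=
    ContinuousAt.comp (g := (chartAt (Coord (n + 1)) p.base).symm)
      ((chartAt (Coord (n + 1)) p.base).continuousAt_symm
        ((chartAt (Coord (n + 1)) p.base).map_source (mem_chart_source _ _))) continuousAt_fst
  refine h1.congr ?_
  filter_upwards [p.preChart_target_mem_nhds] with q hq
  exact (affineChart_symm_base p p.base p.dir.1 p.dir.2 hq.1).symm

/-- The components of the covector, scaled so that their absolute values add up to `1`. -/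
def Cosphere.ratio (c : M) (b : Fin (n + 1)) (p : Cosphere h) : ℝ :=
  p.coord c b / ∑ d, |p.coord c d|

theorem Cosphere.sum_abs_pos (c : M) (p : Cosphere h)
    (hp : p.base ∈ (chartAt (Coord (n + 1)) c).source) : 0 < ∑ d, |p.coord c d| := by
  obtain ⟨b, hb⟩ := p.exists_coord_ne_zero c hp
  exact Finset.sum_pos' (fun _ _ => abs_nonneg _) ⟨b, Finset.mem_univ _, abs_pos.2 hb⟩

theorem Cosphere.continuousAt_ratio (c : M) (b : Fin (n + 1)) (p : Cosphere h)
    (hp : p.base ∈ (chartAt (Coord (n + 1)) c).source) : ContinuousAt (ratio (h := h) c b) p := by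
  refine Cosphere.continuousAt_of_chart ?_
  have hmem : p.preChart p ∈ transDomain (n := n) p.base c := by
    refine ⟨?_, mem_univ _⟩
    rw [OpenPartialHomeomorph.trans_source]
    refine ⟨(chartAt (Coord (n + 1)) p.base).map_source (mem_chart_source _ _), ?_⟩
    change (chartAt (Coord (n + 1)) p.base).symm (chartAt (Coord (n + 1)) p.base p.base) ∈
      (chartAt (Coord (n + 1)) c).source
    rwa [(chartAt (Coord (n + 1)) p.base).left_inv (mem_chart_source _ _)]
  have hopen := (isOpen_transDomain p.base c).mem_nhds hmem
  have hcont : ∀ d, ContinuousAt (transCoord p.base p.dir.1 p.dir.2 c d) (p.preChart p) :=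
    fun d => (contDiffOn_transCoord p.base p.dir.1 p.dir.2 c d).continuousOn.continuousAt hopen
  have hsc : ∀ q ∈ transDomain (n := n) p.base c, ∃ t : ℝ, 0 < t ∧ ∀ d,
      (p.preChart.symm q).coord c d = t * transCoord p.base p.dir.1 p.dir.2 c d q :=
    fun q hq => affineChart_symm_coord p p.base p.dir.1 p.dir.2 c hq
  have hpos : 0 < ∑ d, |transCoord p.base p.dir.1 p.dir.2 c d (p.preChart p)| := by
    obtain ⟨t, ht, h2⟩ := hsc _ hmem
    have h3 : p.preChart.symm (p.preChart p) = p :=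
      p.preChart.left_inv ((cosphereCore h).mem_chart_source p)
    rw [h3] at h2
    have h4 := p.sum_abs_pos c hp
    simp only [h2, abs_mul, ← Finset.mul_sum] at h4
    exact (pos_iff_pos_of_mul_pos h4).1 (abs_pos.2 ht.ne')
  have h1 : ContinuousAt (fun q => transCoord p.base p.dir.1 p.dir.2 c b q /
      ∑ d, |transCoord p.base p.dir.1 p.dir.2 c d q|) (p.preChart p) :=
    (hcont b).div (tendsto_finsetSum _ fun d _ => (hcont d).abs) hpos.ne'
  refine h1.congr ?_
  filter_upwards [hopen] with q hq
  obtain ⟨t, ht, h2⟩ := hsc q hq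
  simp only [ratio, h2, abs_mul, ← Finset.mul_sum, abs_of_pos ht]
  rw [mul_div_mul_left _ _ ht.ne']

instance [T2Space M] : T2Space (Cosphere h) := by
  refine ⟨fun p q hpq => ?_⟩
  by_cases hb : p.base = q.base
  · have hp := mem_chart_source (Coord (n + 1)) p.base
    have hq : q.base ∈ (chartAt (Coord (n + 1)) p.base).source := hb ▸ hp
    obtain ⟨b, hne⟩ : ∃ b, p.ratio p.base b ≠ q.ratio p.base b := by
      by_contra! H
      have h1 := p.sum_abs_pos _ hp
      have h2 := q.sum_abs_pos _ hq
      refine hpq (Cosphere.ext_of_coord p.base hb hp (div_nonneg h1.le h2.le) fun b => ?_)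
      have := H b
      rw [Cosphere.ratio, Cosphere.ratio, div_eq_div_iff h1.ne' h2.ne'] at this
      rw [div_mul_eq_mul_div, eq_div_iff h2.ne', this, mul_comm]
    obtain ⟨U, V, hU, hV, hpU, hqV, hUV⟩ := t2_separation hne
    obtain ⟨U', hU'1, hU'2, hU'3⟩ :=
      mem_nhds_iff.1 ((p.continuousAt_ratio p.base b hp).preimage_mem_nhds (hU.mem_nhds hpU))
    obtain ⟨V', hV'1, hV'2, hV'3⟩ :=
      mem_nhds_iff.1 ((q.continuousAt_ratio p.base b hq).preimage_mem_nhds (hV.mem_nhds hqV))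
    refine ⟨U', V', hU'2, hV'2, hU'3, hV'3, disjoint_left.2 fun r hr hr' => ?_⟩
    exact disjoint_left.1 hUV (hU'1 hr) (hV'1 hr')
  · obtain ⟨U, V, hU, hV, hpU, hqV, hUV⟩ := t2_separation hb
    exact ⟨_, _, hU.preimage Cosphere.continuous_base, hV.preimage Cosphere.continuous_base,
      hpU, hqV, hUV.preimage _⟩

theorem continuousOn_affineChart_symm (p₀ : Cosphere h) (c : M) (a : Fin (n + 1)) (ε : ℤˣ) :
    ContinuousOn (affineChart p₀ c a ε).symm (affineChart p₀ c a ε).target := by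
  intro q hq
  set r := (affineChart p₀ c a ε).symm q with hr
  set e := chartAt (Coord (n + 1) × (Fin n → ℝ)) r with he
  have hS := isOpen_affineChart_trans_source p₀ c a ε r r.base r.dir.1 r.dir.2
  have hqS : q ∈ ((affineChart p₀ c a ε).symm.trans
      (affineChart r r.base r.dir.1 r.dir.2)).source :=
    ⟨hq, (cosphereCore h).mem_chart_source r⟩
  have h1 : ContinuousAt (fun q => e ((affineChart p₀ c a ε).symm q)) q :=
    (contDiffOn_affineChart_trans p₀ c a ε r r.base r.dir.1 r.dir.2).continuousOn.continuousAt
      (hS.mem_nhds hqS)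
  have h2 : ContinuousAt (fun q => e.symm (e ((affineChart p₀ c a ε).symm q))) q :=
    ContinuousAt.comp (g := e.symm)
      (e.continuousAt_symm (e.map_source (mem_chart_source _ r))) h1
  refine (h2.congr ?_).continuousWithinAt
  filter_upwards [hS.mem_nhds hqS] with q' hq'
  exact e.left_inv hq'.2

instance [CompactSpace M] : CompactSpace (Cosphere h) := by
  rcases isEmpty_or_nonempty (Cosphere h) with hE | ⟨⟨p₀⟩⟩
  · infer_instance
  have : LocallyCompactSpace M := ChartedSpace.locallyCompactSpace (Coord (n + 1)) M
  choose K hK using fun x : M => exists_compact_subset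
    (chartAt (Coord (n + 1)) x).open_source (mem_chart_source (Coord (n + 1)) x)
  obtain ⟨t, ht⟩ := CompactSpace.elim_nhds_subcover (fun x => interior (K x))
    fun x => isOpen_interior.mem_nhds (hK x).2.1
  have hcomp : IsCompact (⋃ x ∈ t, ⋃ d : Fin (n + 1) × ℤˣ,
      (affineChart p₀ x d.1 d.2).symm ''
        ((chartAt (Coord (n + 1)) x '' K x) ×ˢ Icc (fun _ => -1) (fun _ => 1))) := by
    refine t.isCompact_biUnion fun x _ => isCompact_iUnion fun d => ?_
    refine IsCompact.image_of_continuousOn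
      (((hK x).1.image_of_continuousOn
        ((chartAt (Coord (n + 1)) x).continuousOn.mono (hK x).2.2)).prod isCompact_Icc) ?_
    refine (continuousOn_affineChart_symm p₀ x d.1 d.2).mono ?_
    rintro ⟨y, w⟩ ⟨⟨z, hz, rfl⟩, -⟩
    exact ⟨(chartAt (Coord (n + 1)) x).map_source ((hK x).2.2 hz), mem_univ _⟩
  refine ⟨hcomp.of_isClosed_subset isClosed_univ fun p _ => ?_⟩
  have hp : p.base ∈ ⋃ x ∈ t, interior (K x) := by rw [ht]; trivial
  obtain ⟨x, hxt, hx⟩ := mem_iUnion₂.1 hp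
  have hxs := (hK x).2.2 (interior_subset hx)
  obtain ⟨d, hd1, hd2⟩ := p.exists_dir x hxs
  refine mem_iUnion₂.2 ⟨x, hxt, mem_iUnion.2 ⟨d, affineChart p₀ x d.1 d.2 p,
    ⟨⟨p.base, interior_subset hx, rfl⟩, ?_⟩,
    (affineChart p₀ x d.1 d.2).left_inv ⟨hxs, hd1⟩⟩⟩
  have h3 : ∀ b, |p.coord x (d.1.succAbove b) / (((d.2 : ℤ) : ℝ) * p.coord x d.1)| ≤ 1 := by
    intro b
    rw [abs_div, abs_of_pos hd1, div_le_one hd1]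
    exact hd2 _
  exact ⟨fun b => (abs_le.1 (h3 b)).1, fun b => (abs_le.1 (h3 b)).2⟩


/-- A diffeomorphism of `M` is an isometry if its differential preserves the metric. -/
def IsIsometric (h : Metric (n + 1) M) (g : M ≃ₘ^∞⟮𝓡 (n + 1), 𝓡 (n + 1)⟯ M) : Prop :=
  ∀ (x : M) (v w : TangentSpace (𝓡 (n + 1)) x),
    h.inner (g x) (mfderiv (𝓡 (n + 1)) (𝓡 (n + 1)) g x v)
      (mfderiv (𝓡 (n + 1)) (𝓡 (n + 1)) g x w) = h.inner x v w

/-- The differential `dg_x : T_x M ≃ T_{g x} M`. -/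
def diffEquiv (g : M ≃ₘ^∞⟮𝓡 (n + 1), 𝓡 (n + 1)⟯ M) (x : M) :
    TangentSpace (𝓡 (n + 1)) x ≃L[ℝ] TangentSpace (𝓡 (n + 1)) (g x) :=
  g.mfderivToContinuousLinearEquiv (by simp) x

theorem diffEquiv_apply (g : M ≃ₘ^∞⟮𝓡 (n + 1), 𝓡 (n + 1)⟯ M) (x : M)
    (v : TangentSpace (𝓡 (n + 1)) x) :
    diffEquiv g x v = mfderiv (𝓡 (n + 1)) (𝓡 (n + 1)) g x v := rfl

/-- The codifferential `∂g = (ᵗdg)⁻¹` acting on `S*M`: `(x, ξ) ↦ (g x, ξ ∘ (dg_x)⁻¹)`. -/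
def codiff {g : M ≃ₘ^∞⟮𝓡 (n + 1), 𝓡 (n + 1)⟯ M} (hg : IsIsometric h g) (p : Cosphere h) :
    Cosphere h where
  base := g p.base
  covec := p.covec.comp
    ((diffEquiv g p.base).symm : TangentSpace (𝓡 (n + 1)) (g p.base) →L[ℝ] _)
  unit := by
    rw [← p.unit, conorm, conorm]
    congr 1
    ext t
    constructor
    · rintro ⟨v, hv, rfl⟩
      refine ⟨(diffEquiv g p.base).symm v, ?_, rfl⟩
      have := hg p.base ((diffEquiv g p.base).symm v) ((diffEquiv g p.base).symm v)
      rw [← diffEquiv_apply, ContinuousLinearEquiv.apply_symm_apply] at this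
      exact this.symm.le.trans hv
    · rintro ⟨v, hv, rfl⟩
      refine ⟨diffEquiv g p.base v, ?_, ?_⟩
      · have := hg p.base v v
        rw [← diffEquiv_apply] at this
        exact this.le.trans hv
      · simp

end Cosphere
section Todd

variable {m : ℕ} {M : Type*} [TopologicalSpace M] [ChartedSpace (Coord m) M]
  [IsManifold (𝓡 m) ∞ M]

/-- The matrix `(h_ij)` of the metric in the chart at `c`, at the point with coordinates `y`. -/
def gram (h : Metric m M) (c : M) (y : Coord m) : Matrix (Fin m) (Fin m) ℝ :=
  Matrix.of fun i j => h.inner ((chartAt (Coord m) c).symm y)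
    (mfderiv (𝓡 m) (𝓡 m) (chartAt (Coord m) c).symm y (EuclideanSpace.single i (1 : ℝ)))
    (mfderiv (𝓡 m) (𝓡 m) (chartAt (Coord m) c).symm y (EuclideanSpace.single j (1 : ℝ)))

/-- The partial derivative `∂_i`. -/
def partialD (i : Fin m) (f : Coord m → ℝ) (y : Coord m) : ℝ :=
  fderiv ℝ f y (EuclideanSpace.single i (1 : ℝ))

/-- The Christoffel symbols `Γ^k_ij` of the Levi-Civita connection. -/
def christoffel (h : Metric m M) (c : M) (k i j : Fin m) (y : Coord m) : ℝ :=
  (1 / 2) * ∑ l, (gram h c y)⁻¹ k l *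
    (partialD i (fun z => gram h c z j l) y + partialD j (fun z => gram h c z i l) y -
      partialD l (fun z => gram h c z i j) y)

/-- The `1`-form `∑ f_i dy_i`, as an inhomogeneous form. -/
def oneForm (f : Fin m → ℝ) : GForm (Coord m)
  | 1 => ContinuousAlternatingMap.ofSubsingleton ℝ (Coord m) ℂ (0 : Fin 1)
      (∑ i, f i • Complex.ofRealCLM.comp (EuclideanSpace.proj i : Coord m →L[ℝ] ℝ))
  | _ => 0

/-- The connection matrix `A` of the Levi-Civita connection on `T*M` in the frame `dy_1, …, dy_m`:
`∇ dy_k = ∑_j A_jk ⊗ dy_j` with `A_jk = - ∑_i Γ^k_ij dy_i`. -/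
def connection (h : Metric m M) (c : M) (j k : Fin m) (y : Coord m) : GForm (Coord m) :=
  oneForm fun i => - christoffel h c k i j y

/-- The product of square matrices of inhomogeneous forms. -/
def matMul (P Q : Fin m → Fin m → GForm (Coord m)) : Fin m → Fin m → GForm (Coord m) :=
  fun i j => ∑ l, gwedge (P i l) (Q l j)

/-- The powers of a square matrix of inhomogeneous forms. -/
def matPow (P : Fin m → Fin m → GForm (Coord m)) : ℕ → Fin m → Fin m → GForm (Coord m)
  | 0 => fun i j => gscalar (if i = j then 1 else 0)
  | s + 1 => matMul (matPow P s) P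

/-- The curvature `dA + A ∧ A` of the complexified cotangent bundle, in the chart at `c`. -/
def curvature (h : Metric m M) (c : M) (y : Coord m) : Fin m → Fin m → GForm (Coord m) :=
  fun j k => flatD (connection h c j k) y +
    matMul (fun j k => connection h c j k y) (fun j k => connection h c j k y) j k

/-- The power series `x / (1 - e^{-x}) = ∑_s B_s^+ x ^ s / s!` evaluated at a matrix `P` of
`2`-forms. (The entries of `P ^ s` have degree `2 s`, so only `s ≤ d` matters in degree `d`.) -/
def toddSeries (P : Fin m → Fin m → GForm (Coord m)) : Fin m → Fin m → GForm (Coord m) :=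
  fun i j d => ∑ s ∈ Finset.range (d + 1),
    ((bernoulli' s / s.factorial : ℚ) : ℂ) • matPow P s i j d

/-- The determinant of a matrix of forms of even degree (which commute). -/
def formDet (P : Fin m → Fin m → GForm (Coord m)) : GForm (Coord m) :=
  ∑ σ : Equiv.Perm (Fin m), ((Equiv.Perm.sign σ : ℤ) : ℂ) •
    ((List.finRange m).map fun i => P (σ i) i).foldr gwedge (gscalar 1)

/-- The Chern–Weil form `det (F / (1 - e^{-F}))`, with `F` the curvature of `T*M ⊗ ℂ` multiplied by
`i / 2π`, of the Levi-Civita connection. -/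
def toddForm (h : Metric m M) : M → GForm (Coord m) := fun x =>
  formDet (toddSeries fun i j =>
    (Complex.I / (2 * Real.pi)) • curvature h x (chartAt (Coord m) x x) i j)

/-- The form `Td` represents the Todd class of `T*M ⊗ ℂ` in de Rham cohomology: it is smooth,
closed, and differs from the Chern–Weil form by an exact form. -/
def RepresentsTodd (h : Metric m M) (Td : M → GForm (Coord m)) : Prop :=
  IsSmoothForm Td ∧ extD Td = 0 ∧
    ∃ β : M → GForm (Coord m), IsSmoothForm β ∧ Td - toddForm h = extD β

end Todd

section Cycle

variable {W B : Type*} [AddCommGroup W] [Module ℂ W] [AddCommGroup B] [Module ℂ B]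

/-- The subspace `A`, with the product `mul` and the unit `one`, is an associative unital
`ℂ`-algebra. -/
structure IsAlgebraOn (A : Submodule ℂ W) (mul : W → W → W) (one : W) : Prop where
  mul_mem : ∀ a ∈ A, ∀ b ∈ A, mul a b ∈ A
  one_mem : one ∈ A
  one_mul : ∀ a ∈ A, mul one a = a
  mul_one : ∀ a ∈ A, mul a one = a
  assoc : ∀ a ∈ A, ∀ b ∈ A, ∀ c ∈ A, mul (mul a b) c = mul a (mul b c)
  add_mul : ∀ a ∈ A, ∀ b ∈ A, ∀ c ∈ A, mul (a + b) c = mul a c + mul b c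
  mul_add : ∀ a ∈ A, ∀ b ∈ A, ∀ c ∈ A, mul a (b + c) = mul a b + mul a c
  smul_mul : ∀ (z : ℂ), ∀ a ∈ A, ∀ b ∈ A, mul (z • a) b = z • mul a b
  mul_smul : ∀ (z : ℂ), ∀ a ∈ A, ∀ b ∈ A, mul a (z • b) = z • mul a b

/-- `(⨁_k Ω_k, d, τ)` with `ρ : A → Ω_0` is a cycle over the algebra `A`: a differential graded
algebra, concentrated in degrees at most `N`, with a closed graded trace `τ` and a homomorphism of
algebras `ρ`. (The functional `τ` is not required to vanish outside degree `N`.) -/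
structure IsCycleOver (N : ℕ) (A : Submodule ℂ B) (mulA : B → B → B) (oneA : B)
    (Ω : ℕ → Submodule ℂ W) (mul : W → W → W) (d : W → W) (τ : W → ℂ) (ρ : B → W) : Prop where
  algebra_A : IsAlgebraOn A mulA oneA
  direct_sum : iSupIndep Ω
  bounded : ∀ k, N < k → Ω k = ⊥
  algebra : IsAlgebraOn (⨆ k, Ω k) mul (ρ oneA)
  mul_mem : ∀ k l, ∀ α ∈ Ω k, ∀ β ∈ Ω l, mul α β ∈ Ω (k + l)
  d_mem : ∀ k, ∀ α ∈ Ω k, d α ∈ Ω (k + 1)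
  d_add : ∀ α ∈ ⨆ k, Ω k, ∀ β ∈ ⨆ k, Ω k, d (α + β) = d α + d β
  d_smul : ∀ (z : ℂ), ∀ α ∈ ⨆ k, Ω k, d (z • α) = z • d α
  d_d : ∀ α ∈ ⨆ k, Ω k, d (d α) = 0
  leibniz : ∀ k, ∀ α ∈ Ω k, ∀ β ∈ ⨆ k, Ω k,
    d (mul α β) = mul (d α) β + (-1 : ℂ) ^ k • mul α (d β)
  trace_add : ∀ α ∈ ⨆ k, Ω k, ∀ β ∈ ⨆ k, Ω k, τ (α + β) = τ α + τ β
  trace_smul : ∀ (z : ℂ), ∀ α ∈ ⨆ k, Ω k, τ (z • α) = z * τ α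
  closed : ∀ α ∈ ⨆ k, Ω k, τ (d α) = 0
  graded_trace : ∀ k l, ∀ α ∈ Ω k, ∀ β ∈ Ω l, τ (mul α β) = (-1 : ℂ) ^ (k * l) * τ (mul β α)
  hom_mem : ∀ a ∈ A, ρ a ∈ Ω 0
  hom_add : ∀ a ∈ A, ∀ b ∈ A, ρ (a + b) = ρ a + ρ b
  hom_smul : ∀ (z : ℂ), ∀ a ∈ A, ρ (z • a) = z • ρ a
  hom_mul : ∀ a ∈ A, ∀ b ∈ A, ρ (mulA a b) = mul (ρ a) (ρ b)

end Cycle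

section Trace

variable {n : ℕ} {M : Type*} [TopologicalSpace M] [ChartedSpace (Coord (n + 1)) M]
  [IsManifold (𝓡 (n + 1)) ∞ M] {h : Metric (n + 1) M}
  {g : M ≃ₘ^∞⟮𝓡 (n + 1), 𝓡 (n + 1)⟯ M}

/-- The model space of `S*M`. -/
abbrev SCoord (n : ℕ) : Type := Coord (n + 1) × (Fin n → ℝ)

/-- The standard basis of the model space of `S*M`. -/
def sBasis (n : ℕ) : Fin ((n + 1) + n) → SCoord n :=
  Fin.addCases (fun i => (EuclideanSpace.single i (1 : ℝ), 0)) (fun j => (0, Pi.single j (1 : ℝ)))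

/-- The canonical orientation of `S*M`: a local orientation of `M` followed by the orientation of
the fibre as the boundary (outward normal first) of the unit codisc in `T*_x M`, where `T*_x M`
carries the dual orientation. It is independent of the local orientation of `M`. On the affine
chart with coordinates `(y, w)`, the covector being a positive multiple of `ε dy_a + ∑ w_b dy_b`,
the sign is the one computed in `orientation_eq_det`. -/
def orientation (p : Cosphere h) : ℤˣ := p.dir.2 * (-1) ^ (p.dir.1 : ℕ)

/-- The frame of `ℝ^(n+1)` consisting of the radial vector at the point with affine coordinates `w`
and of the coordinate vectors `∂/∂w_b` has determinant `ε (-1)^a`. -/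
theorem orientation_eq_det (a : Fin (n + 1)) (ε : ℤˣ) (w : Fin n → ℝ) :
    Matrix.det (Matrix.of (Fin.cons (a.insertNth ((ε : ℤ) : ℝ) w)
      fun b => Pi.single (a.succAbove b) 1 : Fin (n + 1) → Fin (n + 1) → ℝ)) =
      ((ε * (-1) ^ (a : ℕ) : ℤˣ) : ℤ) := by
  rw [Matrix.det_succ_row_zero, Finset.sum_eq_single a]
  · have h1 : Matrix.submatrix (Matrix.of (Fin.cons (a.insertNth ((ε : ℤ) : ℝ) w)
        fun b => Pi.single (a.succAbove b) 1 : Fin (n + 1) → Fin (n + 1) → ℝ))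
        Fin.succ a.succAbove = 1 := by
      ext b b'
      simp [Matrix.one_apply, Pi.single_apply, eq_comm]
    rw [h1]
    simp
    ring
  · intro j _ hj
    obtain ⟨j', hj'⟩ := Fin.exists_succAbove_eq hj.symm
    rw [Matrix.det_eq_zero_of_column_eq_zero j', mul_zero]
    intro b
    simp [hj']
  · simp

/-- The integral over `S*M`, of dimension `2n + 1`. -/
def cosphereIntegral [T2Space M] [CompactSpace M] (α : Cosphere h → GForm (SCoord n)) : ℂ :=
  formIntegral orientation (sBasis n) α

/-- The functional `τ(α) = ∫_{S*M} α_00 ∧ Td`, where `Td` is pulled back to `S*M`. -/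
def tau [T2Space M] [CompactSpace M] (Td : M → GForm (Coord (n + 1)))
    (α : MForm (SCoord n) (Cosphere h)) : ℂ :=
  cosphereIntegral fun p => gwedge (α 0 0 p) (pullback Cosphere.base Td p)

/-- The space `Ω(S*M, 𝒮)^ℤ` of smooth `𝒮`-valued forms `α` that are invariant under the action
`α ↦ 𝒯⁻¹ ((∂g)* α) 𝒯` of the generator of `ℤ`, that is, `(∂g)* α_ij = α_{i+1, j+1}`. -/
def Omega (hg : IsIsometric h g) : Submodule ℂ (MForm (SCoord n) (Cosphere h)) where
  carrier := {α | IsSmoothMForm α ∧ ∀ i j : ℤ, pullback (codiff hg) (α i j) = α (i + 1) (j + 1)}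
  zero_mem' := by
    refine ⟨fun c k N => ⟨fun _ => 0, contDiffOn_const, fun y _ i j => ?_⟩, fun i j => ?_⟩
    · change 0 = _ • pullback (chartAt (SCoord n) c).symm 0 y k
      rw [pullback_zero]
      ext v
      exact (mul_zero _).symm
    · exact pullback_zero _
  add_mem' := by
    rintro α β ⟨hα, hα'⟩ ⟨hβ, hβ'⟩
    refine ⟨fun c k N => ?_, fun i j => ?_⟩
    · obtain ⟨F, hF, hF'⟩ := hα c k N
      obtain ⟨G, hG, hG'⟩ := hβ c k N
      refine ⟨fun y => F y + G y, hF.add hG, fun y hy i j => ?_⟩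
      have := pullback_add (E := SCoord n) (chartAt (SCoord n) c).symm (α i j) (β i j)
      change (F y + G y : _) (i, j) = _ • pullback (chartAt (SCoord n) c).symm (α i j + β i j) y k
      rw [this]
      change F y (i, j) + G y (i, j) = _
      rw [hF' y hy, hG' y hy]
      ext v
      exact (smul_add ((1 + |((i - j : ℤ) : ℝ)|) ^ N) (_ : ℂ) _).symm
    · change pullback (codiff hg) (α i j + β i j) = _
      rw [pullback_add, hα', hβ']
      rfl
  smul_mem' := by
    rintro z α ⟨hα, hα'⟩
    refine ⟨fun c k N => ?_, fun i j => ?_⟩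
    · obtain ⟨F, hF, hF'⟩ := hα c k N
      refine ⟨fun y => z • F y, hF.const_smul z, fun y hy i j => ?_⟩
      change z • F y (i, j) = _ • pullback (chartAt (SCoord n) c).symm (z • α i j) y k
      rw [pullback_smul, hF' y hy, smul_comm]
      rfl
    · change pullback (codiff hg) (z • α i j) = _
      rw [pullback_smul, hα']
      rfl

/-- The homogeneous invariant forms of degree `k`. -/
def OmegaDeg (hg : IsIsometric h g) (k : ℕ) : Submodule ℂ (MForm (SCoord n) (Cosphere h)) :=
  Omega hg ⊓
    { carrier := {α | ∀ (i j : ℤ) (p : Cosphere h) (m : ℕ), m ≠ k → α i j p m = 0}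
      zero_mem' := fun _ _ _ _ _ => rfl
      add_mem' := fun {α β} hα hβ i j p m hm => by
        change α i j p m + β i j p m = 0
        rw [hα i j p m hm, hβ i j p m hm, add_zero]
      smul_mem' := fun z α hα i j p m hm => by
        change z • α i j p m = 0
        rw [hα i j p m hm]
        ext v
        exact mul_zero z }

/-- The algebra `C^∞(S*M, 𝒮)^ℤ` of invariant symbols, `f_ij (∂g p) = f_{i+1, j+1} (p)`. -/
def Symbols (hg : IsIsometric h g) : Submodule ℂ (Cosphere h → ℤ → ℤ → ℂ) where
  carrier := {f | IsSmoothMFun (E := SCoord n) f ∧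
    ∀ (p : Cosphere h) (i j : ℤ), f (codiff hg p) i j = f p (i + 1) (j + 1)}
  zero_mem' := by
    refine ⟨fun c N => ⟨fun _ => 0, contDiffOn_const, fun y _ i j => ?_⟩, fun p i j => rfl⟩
    simp
  add_mem' := by
    rintro f f' ⟨hf, hf'⟩ ⟨hk, hk'⟩
    refine ⟨fun c N => ?_, fun p i j => ?_⟩
    · obtain ⟨F, hF, hF'⟩ := hf c N
      obtain ⟨G, hG, hG'⟩ := hk c N
      refine ⟨fun y => F y + G y, hF.add hG, fun y hy i j => ?_⟩
      change F y (i, j) + G y (i, j) = _ • (f _ i j + f' _ i j)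
      rw [hF' y hy, hG' y hy, ← smul_add]
    · change f _ i j + f' _ i j = f _ _ _ + f' _ _ _
      rw [hf', hk']
  smul_mem' := by
    rintro z f ⟨hf, hf'⟩
    refine ⟨fun c N => ?_, fun p i j => ?_⟩
    · obtain ⟨F, hF, hF'⟩ := hf c N
      refine ⟨fun y => z • F y, hF.const_smul z, fun y hy i j => ?_⟩
      change z • F y (i, j) = _ • (z • f _ i j)
      rw [hF' y hy, smul_comm]
    · change z • f _ i j = z • f _ _ _
      rw [hf']

end Trace
end ClosedTrace

end

open ClosedTrace

/-! Closedness. Because Td is closed, d(α₀₀ ∧ Td) = dα₀₀ ∧ Td, so τ(dα) is the integral of an exact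
form over the closed manifold S*M and vanishes by Stokes' theorem (`formIntegral_extD`, `tau_dM`).

Trace property. For α of degree k and β of degree l, τ(αβ) is the sum over s ∈ ℤ of the integrals of
α₀ₛ ∧ βₛ₀ ∧ Td. The forms α, β and Td are invariant and ∂g preserves integrals over S*M, so both
indices of a summand may be shifted by the same integer (`traceTerm_add`). The summand with index s
= -m becomes the integral of αₘ₀ ∧ β₀ₘ ∧ Td, and graded commutativity turns it into (-1)^(kl) times
the summand with index m of τ(βα). Summing over ℤ, reindexed by m ↦ -m, gives `tau_mulM_comm`.

Orientation. Invariance of the integral requires that ∂g preserve the canonical orientation, whether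
or not g preserves local orientations of M. In affine charts the differential of ∂g is block
triangular. One block is the differential A of g. The other is the differential of the
projectivization of the inverse transpose of A, whose determinant has the sign of det A⁻¹ up to the
signs attached to the two charts. The sign of det A therefore cancels (`projective_det`,
`det_fderiv_projMap_pos`). For g = id the same computation shows that the chart signs define an
orientation, which makes Stokes' theorem and changes of chart available (`preservesOrientation_id`).

Convergence. An 𝒮-valued form is, for each order of decay, locally a smooth map into a Banach space
of bounded matrices. Matrix multiplication is a bounded bilinear map between these spaces at a cost
of two orders of decay: the weight 1 + |i - j| is submultiplicative and its inverse square is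
summable (`wtCoef_le`, `BMat.mul`). This yields smoothness of products, the termwise Leibniz rule
(`flatD_mulP`), associativity by interchange of sums, and the exchange of sum and integral in τ(αβ)
(`hasSum_formIntegral`).

The exterior calculus is derived from explicit antisymmetrization. Associativity, graded
commutativity and the Leibniz rule all come from two facts: composing with a permutation multiplies
an antisymmetrization by a sign, and antisymmetrizing first in a block multiplies it by a factorial.
The grading is finite because forms of degree above 2n + 1 vanish, and the algebra of symbols
inherits its axioms from that of 0-forms. -/

noncomputable section
namespace ClosedTrace

/-! ### Antisymmetrization of functions of several vectors. -/

section Antisymmetrization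

variable {V : Type*} {ι κ μ : Type*} [Fintype ι] [DecidableEq ι] [Fintype κ] [DecidableEq κ]
  [Fintype μ] [DecidableEq μ]

/-- The antisymmetrization of a function of several vectors. -/
def antisymm (T : (ι → V) → ℂ) (v : ι → V) : ℂ :=
  ∑ σ : Equiv.Perm ι, ((Equiv.Perm.sign σ : ℤ) : ℂ) * T (v ∘ σ)

/-- Right translation by τ permutes the summands and changes each sign by the sign of τ. -/
theorem antisymm_comp_perm (T : (ι → V) → ℂ) (τ : Equiv.Perm ι) (v : ι → V) :
    antisymm (fun v => T (v ∘ τ)) v = ((Equiv.Perm.sign τ : ℤ) : ℂ) * antisymm T v := by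
  unfold antisymm
  rw [Finset.mul_sum]
  refine Fintype.sum_equiv (Equiv.mulRight τ) _ _ fun σ => ?_
  have h : ((Equiv.Perm.sign τ : ℤ) : ℂ) * ((Equiv.Perm.sign τ : ℤ) : ℂ) = 1 := by
    rw [← Int.cast_mul, ← Units.val_mul, Int.units_mul_self]; simp
  rw [Equiv.coe_mulRight, Equiv.Perm.sign_mul, Units.val_mul, Int.cast_mul, ← mul_assoc,
    mul_left_comm, h, mul_one]
  rfl

theorem antisymm_const_mul (z : ℂ) (T : (ι → V) → ℂ) (v : ι → V) :
    antisymm (fun v => z * T v) v = z * antisymm T v := by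
  simp only [antisymm, Finset.mul_sum, mul_left_comm]

theorem antisymm_sum {J : Type*} (s : Finset J) (T : J → (ι → V) → ℂ) (v : ι → V) :
    antisymm (fun v => ∑ j ∈ s, T j v) v = ∑ j ∈ s, antisymm (T j) v := by
  simp only [antisymm, Finset.mul_sum]
  exact Finset.sum_comm

/-- Antisymmetrizing first in a block of variables only contributes a factor. -/
theorem antisymm_antisymm_block (e : ι ⊕ κ ≃ μ) (T : (ι → V) → (κ → V) → ℂ) (v : μ → V) :
    antisymm (fun v => antisymm (fun u => T u (v ∘ e ∘ Sum.inr)) (v ∘ e ∘ Sum.inl)) v =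
      (Fintype.card ι).factorial *
        antisymm (fun v => T (v ∘ e ∘ Sum.inl) (v ∘ e ∘ Sum.inr)) v := by
  -- The inner antisymmetrization runs over the permutations of μ that fix every index of the second
  -- block.
  have h1 : ∀ v : μ → V, antisymm (fun u => T u (v ∘ e ∘ Sum.inr)) (v ∘ e ∘ Sum.inl) =
      ∑ τ : Equiv.Perm ι, ((Equiv.Perm.sign τ : ℤ) : ℂ) *
        (fun v : μ → V => T (v ∘ e ∘ Sum.inl) (v ∘ e ∘ Sum.inr))
          (v ∘ (e.permCongr (Equiv.Perm.sumCongr τ 1))) := by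
    intro v
    refine Finset.sum_congr rfl fun τ _ => ?_
    have hl : (v ∘ (e.permCongr (Equiv.Perm.sumCongr τ 1))) ∘ e ∘ Sum.inl =
        (v ∘ e ∘ Sum.inl) ∘ τ := by funext i; simp
    have hr : (v ∘ (e.permCongr (Equiv.Perm.sumCongr τ 1))) ∘ e ∘ Sum.inr =
        v ∘ e ∘ Sum.inr := by funext i; simp
    simp only [hl, hr]
  simp only [h1]
  rw [antisymm_sum]
  -- Extending τ by the identity keeps its sign, so the sign produced by the outer
  -- antisymmetrization cancels the inner one. All inner permutations contribute equally, which
  -- accounts for the factorial.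
  have h2 : ∀ τ : Equiv.Perm ι, antisymm (fun v => ((Equiv.Perm.sign τ : ℤ) : ℂ) *
        (fun v : μ → V => T (v ∘ e ∘ Sum.inl) (v ∘ e ∘ Sum.inr))
          (v ∘ (e.permCongr (Equiv.Perm.sumCongr τ 1)))) v =
      antisymm (fun v => T (v ∘ e ∘ Sum.inl) (v ∘ e ∘ Sum.inr)) v := by
    intro τ
    have h : ((Equiv.Perm.sign τ : ℤ) : ℂ) * ((Equiv.Perm.sign τ : ℤ) : ℂ) = 1 := by
      rw [← Int.cast_mul, ← Units.val_mul, Int.units_mul_self]; simp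
    rw [antisymm_const_mul,
      antisymm_comp_perm (fun v : μ → V => T (v ∘ e ∘ Sum.inl) (v ∘ e ∘ Sum.inr)), Equiv.Perm.sign_permCongr,
      Equiv.Perm.sign_sumCongr, Equiv.Perm.sign_one, mul_one, ← mul_assoc, h, one_mul]
  rw [Finset.sum_congr rfl fun τ _ => h2 τ, Finset.sum_const, Finset.card_univ,
    Fintype.card_perm, nsmul_eq_mul]

end Antisymmetrization

/-! ### Algebra of the exterior product. -/

section Wedge

variable {E : Type*} [NormedAddCommGroup E] [NormedSpace ℝ E]
  {E' : Type*} [NormedAddCommGroup E'] [NormedSpace ℝ E']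

theorem antisymm_form {k : ℕ} (α : E [⋀^Fin k]→L[ℝ] ℂ) (v : Fin k → E) :
    antisymm α v = k.factorial * α v := by
  have : ∀ σ : Equiv.Perm (Fin k), ((Equiv.Perm.sign σ : ℤ) : ℂ) * α (v ∘ σ) = α v := by
    intro σ
    have h : ((Equiv.Perm.sign σ : ℤ) : ℂ) * ((Equiv.Perm.sign σ : ℤ) : ℂ) = 1 := by
      rw [← Int.cast_mul, ← Units.val_mul, Int.units_mul_self]; simp
    have h2 : α (v ∘ σ) = ((Equiv.Perm.sign σ : ℤ) : ℂ) * α v := by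
      have := α.toAlternatingMap.map_perm v σ
      rw [Units.smul_def, zsmul_eq_mul] at this
      exact this
    rw [h2, ← mul_assoc, h, one_mul]
  rw [antisymm, Finset.sum_congr rfl fun σ _ => this σ, Finset.sum_const, Finset.card_univ,
    Fintype.card_perm, nsmul_eq_mul, Fintype.card_fin]

/-- The position of the first and of the last variables of an exterior product. -/
def blockEquiv {k l m : ℕ} (hm : k + l = m) : Fin k ⊕ Fin l ≃ Fin m :=
  finSumFinEquiv.trans (finCongr hm)

/-- Through this formula, identities between exterior products become reindexings of
antisymmetrizations. -/
theorem wedge_apply {k l m : ℕ} (hm : k + l = m) (α : E [⋀^Fin k]→L[ℝ] ℂ)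
    (β : E [⋀^Fin l]→L[ℝ] ℂ) (v : Fin m → E) :
    wedge hm α β v = ((k.factorial * l.factorial : ℝ)⁻¹ : ℂ) *
      antisymm (fun v => α (v ∘ blockEquiv hm ∘ Sum.inl) * β (v ∘ blockEquiv hm ∘ Sum.inr)) v := by
  have : ContinuousMultilinearMap.alternatization (tensor hm α β) v =
      antisymm (fun v => α (v ∘ blockEquiv hm ∘ Sum.inl) * β (v ∘ blockEquiv hm ∘ Sum.inr)) v := by
    rw [ContinuousMultilinearMap.alternatization_apply_apply, antisymm]
    refine Finset.sum_congr rfl fun σ _ => ?_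
    rw [Units.smul_def, zsmul_eq_mul, tensor_apply]
    rfl
  rw [wedge, ContinuousAlternatingMap.smul_apply, this, Complex.real_smul]
  push_cast
  rfl

theorem wedge_add_left {k l m : ℕ} (hm : k + l = m) (α α' : E [⋀^Fin k]→L[ℝ] ℂ)
    (β : E [⋀^Fin l]→L[ℝ] ℂ) : wedge hm (α + α') β = wedge hm α β + wedge hm α' β := by
  ext v
  simp only [wedge_apply, ContinuousAlternatingMap.add_apply, antisymm, add_mul, mul_add,
    Finset.sum_add_distrib]

theorem wedge_add_right {k l m : ℕ} (hm : k + l = m) (α : E [⋀^Fin k]→L[ℝ] ℂ)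
    (β β' : E [⋀^Fin l]→L[ℝ] ℂ) : wedge hm α (β + β') = wedge hm α β + wedge hm α β' := by
  ext v
  simp only [wedge_apply, ContinuousAlternatingMap.add_apply, antisymm, mul_add,
    Finset.sum_add_distrib]

theorem wedge_smul_left {k l m : ℕ} (hm : k + l = m) (z : ℂ) (α : E [⋀^Fin k]→L[ℝ] ℂ)
    (β : E [⋀^Fin l]→L[ℝ] ℂ) : wedge hm (z • α) β = z • wedge hm α β := by
  ext v
  simp only [wedge_apply, ContinuousAlternatingMap.smul_apply, smul_eq_mul, mul_assoc,
    antisymm_const_mul]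
  ring

theorem wedge_smul_right {k l m : ℕ} (hm : k + l = m) (z : ℂ) (α : E [⋀^Fin k]→L[ℝ] ℂ)
    (β : E [⋀^Fin l]→L[ℝ] ℂ) : wedge hm α (z • β) = z • wedge hm α β := by
  ext v
  simp only [wedge_apply, ContinuousAlternatingMap.smul_apply, smul_eq_mul, mul_left_comm,
    antisymm_const_mul]

theorem wedge_comp {k l m : ℕ} (hm : k + l = m) (α : E' [⋀^Fin k]→L[ℝ] ℂ)
    (β : E' [⋀^Fin l]→L[ℝ] ℂ) (A : E →L[ℝ] E') :
    (wedge hm α β).compContinuousLinearMap A =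
      wedge hm (α.compContinuousLinearMap A) (β.compContinuousLinearMap A) := by
  ext v
  rw [ContinuousAlternatingMap.compContinuousLinearMap_apply, wedge_apply, wedge_apply]
  rfl

/-- There is one summand for each of the m! permutations, each of size at most ‖α‖ ‖β‖ ∏ ‖v i‖, and
the normalizing factor is at most 1. Boundedness is what later makes products of smooth forms
smooth. -/
theorem norm_wedge_le {k l m : ℕ} (hm : k + l = m) (α : E [⋀^Fin k]→L[ℝ] ℂ)
    (β : E [⋀^Fin l]→L[ℝ] ℂ) : ‖wedge hm α β‖ ≤ m.factorial * ‖α‖ * ‖β‖ := by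
  refine ContinuousAlternatingMap.opNorm_le_bound _ (by positivity) fun v => ?_
  have hb : ∀ σ : Equiv.Perm (Fin m), ‖((Equiv.Perm.sign σ : ℤ) : ℂ) *
      (α ((v ∘ σ) ∘ blockEquiv hm ∘ Sum.inl) * β ((v ∘ σ) ∘ blockEquiv hm ∘ Sum.inr))‖ ≤
      ‖α‖ * ‖β‖ * ∏ i, ‖v i‖ := by
    intro σ
    have h1 : ‖((Equiv.Perm.sign σ : ℤ) : ℂ)‖ = 1 := by
      rcases Int.units_eq_one_or (Equiv.Perm.sign σ) with h | h <;> simp [h]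
    have h2 : ∏ i, ‖v i‖ = (∏ i, ‖((v ∘ σ) ∘ blockEquiv hm ∘ Sum.inl) i‖) *
        ∏ i, ‖((v ∘ σ) ∘ blockEquiv hm ∘ Sum.inr) i‖ := by
      rw [← Equiv.prod_comp ((blockEquiv hm).trans σ), Fintype.prod_sum_type]
      rfl
    rw [norm_mul, norm_mul, h1, one_mul, h2]
    calc _ ≤ (‖α‖ * _) * (‖β‖ * _) :=
          mul_le_mul (α.le_opNorm _) (β.le_opNorm _) (norm_nonneg _) (by positivity)
      _ = _ := by ring
  rw [wedge_apply, norm_mul]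
  have h3 : ‖((k.factorial * l.factorial : ℝ)⁻¹ : ℂ)‖ ≤ 1 := by
    rw [norm_inv, Complex.ofReal_mul, norm_mul]
    simp only [Complex.ofReal_natCast, Complex.norm_natCast]
    refine inv_le_one_of_one_le₀ (one_le_mul_of_one_le_of_one_le ?_ ?_)
    · exact_mod_cast k.factorial_pos
    · exact_mod_cast l.factorial_pos
  calc _ ≤ 1 * ‖_‖ := mul_le_mul_of_nonneg_right h3 (norm_nonneg _)
    _ ≤ ∑ _σ : Equiv.Perm (Fin m), ‖α‖ * ‖β‖ * ∏ i, ‖v i‖ := by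
      rw [one_mul]; exact norm_sum_le_of_le _ fun σ _ => hb σ
    _ = _ := by
      rw [Finset.sum_const, Finset.card_univ, Fintype.card_perm, nsmul_eq_mul, Fintype.card_fin]
      ring

/-- The sign of the permutation exchanging the first `k` and the last `l` positions. -/
theorem sign_block_swap {k l m : ℕ} (hm : k + l = m) (hm' : l + k = m) :
    Equiv.Perm.sign ((blockEquiv hm).symm.trans
      ((Equiv.sumComm (Fin k) (Fin l)).trans (blockEquiv hm')) : Equiv.Perm (Fin m)) =
      (-1) ^ (k * l) := by
  subst hm
  rcases Nat.eq_zero_or_pos (k + l) with h0 | h0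
  · obtain ⟨rfl, rfl⟩ : k = 0 ∧ l = 0 := by omega
    rw [show ((blockEquiv _).symm.trans ((Equiv.sumComm (Fin 0) (Fin 0)).trans (blockEquiv hm'))) =
      (1 : Equiv.Perm (Fin (0 + 0))) from Equiv.ext fun x => x.elim0]
    simp
  obtain ⟨m, hm⟩ : ∃ m, k + l = m + 1 := ⟨k + l - 1, by omega⟩
  have : NeZero (k + l) := ⟨by omega⟩
  have hrot : ∀ (j : ℕ) (i : Fin (k + l)), ((finRotate (k + l) ^ j) i : ℕ) = (i + j) % (k + l) := by
    intro j i
    induction j with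
    | zero => simp [Nat.mod_eq_of_lt i.2]
    | succ j ih =>
      rw [pow_succ', Equiv.Perm.mul_apply, finRotate_apply, Fin.val_add, ih, Fin.val_one', ← add_assoc]
      simp
  -- Exchanging the blocks is adding l modulo k + l: the first block moves up by l and the second
  -- wraps around to the front.
  have key : ((blockEquiv rfl).symm.trans
      ((Equiv.sumComm (Fin k) (Fin l)).trans (blockEquiv hm')) : Equiv.Perm (Fin (k + l))) =
      finRotate (k + l) ^ l := by
    ext x
    obtain ⟨y, rfl⟩ := (blockEquiv rfl : Fin k ⊕ Fin l ≃ Fin (k + l)).surjective x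
    rw [hrot]
    rcases y with i | j
    · have := i.2
      simp [blockEquiv]
      rw [Nat.mod_eq_of_lt (by omega), add_comm]
    · have := j.2
      simp [blockEquiv]
      rw [show k + j + l = j + (k + l) by omega, Nat.add_mod_right, Nat.mod_eq_of_lt (by omega)]
  -- A rotation of k + l letters has sign (-1)^(k+l-1). The exponent (k+l-1)l has the parity of kl,
  -- because l² and l have the same parity.
  rw [key, map_pow, sign_finRotate, ← pow_mul]
  have h1 : (-1 : ℤˣ) ^ (l * l) = (-1) ^ l := by
    rcases Nat.even_or_odd l with h | h
    · rw [h.neg_one_pow, (h.mul_left l).neg_one_pow]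
    · rw [h.neg_one_pow, (h.mul h).neg_one_pow]
  have h2 : (k + l - 1) * l + l = k * l + l * l := by
    rw [← Nat.succ_mul, show (k + l - 1).succ = k + l by omega, add_mul]
  have h3 := congrArg (fun j => (-1 : ℤˣ) ^ j) h2
  simp only [pow_add, h1] at h3
  exact mul_right_cancel h3

/-- The two tensor products differ by the exchange of the two blocks of variables, whose sign is
(-1)^(kl). -/
theorem wedge_comm {k l m : ℕ} (hm : k + l = m) (hm' : l + k = m) (α : E [⋀^Fin k]→L[ℝ] ℂ)
    (β : E [⋀^Fin l]→L[ℝ] ℂ) : wedge hm α β = (-1 : ℂ) ^ (k * l) • wedge hm' β α := by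
  ext v
  rw [ContinuousAlternatingMap.smul_apply, wedge_apply, wedge_apply, smul_eq_mul]
  have h2 : antisymm (fun v => α (v ∘ blockEquiv hm ∘ Sum.inl) * β (v ∘ blockEquiv hm ∘ Sum.inr)) v
      = (-1 : ℂ) ^ (k * l) * antisymm (fun v : Fin m → E =>
    β (v ∘ blockEquiv hm' ∘ Sum.inl) * α (v ∘ blockEquiv hm' ∘ Sum.inr)) v := by
    have h3 : (((((-1 : ℤˣ) ^ (k * l) : ℤˣ)) : ℤ) : ℂ) = (-1 : ℂ) ^ (k * l) := by push_cast; rfl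
    have h4 := antisymm_comp_perm (fun v : Fin m → E =>
      α (v ∘ blockEquiv hm ∘ Sum.inl) * β (v ∘ blockEquiv hm ∘ Sum.inr))
      ((blockEquiv hm).symm.trans ((Equiv.sumComm (Fin k) (Fin l)).trans (blockEquiv hm'))) v
    rw [sign_block_swap hm hm'] at h4
    have h5 : antisymm (fun v : Fin m → E =>
        β (v ∘ blockEquiv hm' ∘ Sum.inl) * α (v ∘ blockEquiv hm' ∘ Sum.inr)) v =
        (-1 : ℂ) ^ (k * l) * antisymm (fun v : Fin m → E =>
      α (v ∘ blockEquiv hm ∘ Sum.inl) * β (v ∘ blockEquiv hm ∘ Sum.inr)) v := by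
      rw [← h3, ← h4]
      congr 1
      funext v
      rw [mul_comm]
      congr 2 <;> funext i <;> simp
    rw [h5, ← mul_assoc, ← pow_add, ← two_mul, pow_mul]
    simp
  rw [h2]
  simp only [mul_comm, mul_left_comm]

/-- Both sides equal the antisymmetrization of α ⊗ β ⊗ γ divided by k! l! q!: the inner
antisymmetrization contributes s! on the left and t! on the right, cancelling the corresponding
normalizing factor. -/
theorem wedge_assoc {k l q s t m : ℕ} (h1 : k + l = s) (h2 : s + q = m) (h3 : l + q = t)
    (h4 : k + t = m) (α : E [⋀^Fin k]→L[ℝ] ℂ) (β : E [⋀^Fin l]→L[ℝ] ℂ)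
    (γ : E [⋀^Fin q]→L[ℝ] ℂ) :
    wedge h2 (wedge h1 α β) γ = wedge h4 α (wedge h3 β γ) := by
  ext v
  rw [wedge_apply, wedge_apply]
  simp only [wedge_apply, mul_assoc, mul_left_comm (α _), antisymm_const_mul]
  have hs : (s.factorial : ℂ) ≠ 0 := by exact_mod_cast s.factorial_ne_zero
  have ht : (t.factorial : ℂ) ≠ 0 := by exact_mod_cast t.factorial_ne_zero
  have e1 := antisymm_antisymm_block (blockEquiv h2) (fun (u : Fin s → E) (w : Fin q → E) =>
    γ w * (α (u ∘ blockEquiv h1 ∘ Sum.inl) * β (u ∘ blockEquiv h1 ∘ Sum.inr))) v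
  -- The block lemma antisymmetrizes in the first summand, whereas here the inner product occupies
  -- the last variables.
  have e2 := antisymm_antisymm_block ((Equiv.sumComm _ _).trans (blockEquiv h4))
    (fun (u : Fin t → E) (w : Fin k → E) =>
    α w * (β (u ∘ blockEquiv h3 ∘ Sum.inl) * γ (u ∘ blockEquiv h3 ∘ Sum.inr))) v
  simp only [antisymm_const_mul, Fintype.card_fin] at e1 e2
  have e1' : antisymm (fun v : Fin m → E => antisymm (fun v : Fin s → E =>
      α (v ∘ blockEquiv h1 ∘ Sum.inl) * β (v ∘ blockEquiv h1 ∘ Sum.inr))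
      (v ∘ blockEquiv h2 ∘ Sum.inl) * γ (v ∘ blockEquiv h2 ∘ Sum.inr)) v = _ :=
    Eq.trans (by simp only [mul_comm]) e1
  have e2' : antisymm (fun v : Fin m → E => α (v ∘ blockEquiv h4 ∘ Sum.inl) *
      antisymm (fun v : Fin t → E =>
      β (v ∘ blockEquiv h3 ∘ Sum.inl) * γ (v ∘ blockEquiv h3 ∘ Sum.inr))
      (v ∘ blockEquiv h4 ∘ Sum.inr)) v = _ := e2
  rw [e1', e2']
  have e3 : antisymm (fun v : Fin m → E => γ (v ∘ blockEquiv h2 ∘ Sum.inr) *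
        (α ((v ∘ blockEquiv h2 ∘ Sum.inl) ∘ blockEquiv h1 ∘ Sum.inl) *
          β ((v ∘ blockEquiv h2 ∘ Sum.inl) ∘ blockEquiv h1 ∘ Sum.inr))) v =
      antisymm (fun v : Fin m → E =>
        α (v ∘ ((Equiv.sumComm _ _).trans (blockEquiv h4)) ∘ Sum.inr) *
        (β ((v ∘ ((Equiv.sumComm _ _).trans (blockEquiv h4)) ∘ Sum.inl) ∘ blockEquiv h3 ∘ Sum.inl) *
          γ ((v ∘ ((Equiv.sumComm _ _).trans (blockEquiv h4)) ∘ Sum.inl) ∘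
            blockEquiv h3 ∘ Sum.inr))) v := by
    congr 1
    funext v
    rw [mul_comm, mul_assoc]
    subst h1 h3 h2
    have hv : ∀ x y : Fin (k + l + q), (x : ℕ) = y → v x = v y := fun x y hxy =>
      congrArg v (Fin.ext hxy)
    refine congrArg₂ _ (congrArg _ ?_) (congrArg₂ _ (congrArg _ ?_) (congrArg _ ?_)) <;>
      funext i <;> refine hv _ _ ?_ <;> simp [blockEquiv, add_assoc]
  rw [e3]
  push_cast
  field_simp

end Wedge

/-- A bounded bilinear map, as a continuous bilinear map. -/
def bilinOfBound {A B C : Type*} [NormedAddCommGroup A] [NormedSpace ℝ A] [NormedAddCommGroup B]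
    [NormedSpace ℝ B] [NormedAddCommGroup C] [NormedSpace ℝ C] (f : A → B → C)
    (h1 : ∀ a a' b, f (a + a') b = f a b + f a' b) (h2 : ∀ (c : ℝ) a b, f (c • a) b = c • f a b)
    (h3 : ∀ a b b', f a (b + b') = f a b + f a b') (h4 : ∀ (c : ℝ) a b, f a (c • b) = c • f a b)
    (K : ℝ) (hK : ∀ a b, ‖f a b‖ ≤ K * ‖a‖ * ‖b‖) : A →L[ℝ] B →L[ℝ] C :=
  (LinearMap.mk₂ ℝ f h1 h2 h3 h4).mkContinuous₂ K hK

/-! ### The Leibniz rule for constant-coefficient alternation. -/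

section Leibniz

variable {E : Type*} [NormedAddCommGroup E] [NormedSpace ℝ E]
  {E' : Type*} [NormedAddCommGroup E'] [NormedSpace ℝ E']

open ContinuousAlternatingMap

/-- Let F(v) = f (v 0) (tail v). The form on the left is alternating, so antisymmetrizing it
multiplies it by (k+1)!. It is also a signed sum of k + 1 permuted copies of F, and these have equal
antisymmetrizations once the signs are included. Comparing the two counts leaves k!. -/
theorem factorial_mul_alternatizeUncurryFin {k : ℕ} (f : E →L[ℝ] E [⋀^Fin k]→L[ℝ] ℂ)
    (v : Fin (k + 1) → E) : (k.factorial : ℂ) * alternatizeUncurryFin f v =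
      antisymm (fun v : Fin (k + 1) → E => f (v 0) (Fin.tail v)) v := by
  have h1 := antisymm_form (alternatizeUncurryFin f) v
  have h2 : (alternatizeUncurryFin f : (Fin (k + 1) → E) → ℂ) = fun v => ∑ i : Fin (k + 1),
      (-1 : ℂ) ^ (i : ℕ) * (fun v : Fin (k + 1) → E => f (v 0) (Fin.tail v))
        (v ∘ (i.cycleRange.symm : Equiv.Perm (Fin (k + 1)))) := by
    funext v
    rw [alternatizeUncurryFin_apply]
    refine Finset.sum_congr rfl fun i _ => ?_
    have : Fin.tail (v ∘ (i.cycleRange.symm : Equiv.Perm (Fin (k + 1)))) = i.removeNth v := by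
      funext j
      simp [Fin.tail, Fin.removeNth]
    simp only [this, Function.comp_apply, Fin.cycleRange_symm_zero]
    rcases Nat.even_or_odd (i : ℕ) with h | h <;> simp [h.neg_one_pow]
  have h3 : antisymm (alternatizeUncurryFin f) v = ((k + 1 : ℕ) : ℂ) *
      antisymm (fun v : Fin (k + 1) → E => f (v 0) (Fin.tail v)) v := by
    rw [h2, antisymm_sum]
    have h4 : ∀ i : Fin (k + 1), antisymm (fun v : Fin (k + 1) → E => (-1 : ℂ) ^ (i : ℕ) *
        (fun v : Fin (k + 1) → E => f (v 0) (Fin.tail v))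
        (v ∘ (i.cycleRange.symm : Equiv.Perm (Fin (k + 1))))) v =
        antisymm (fun v : Fin (k + 1) → E => f (v 0) (Fin.tail v)) v := by
      intro i
      rw [antisymm_const_mul, antisymm_comp_perm (fun v : Fin (k + 1) → E => f (v 0) (Fin.tail v)),
        Equiv.Perm.sign_symm, Fin.sign_cycleRange]
      push_cast
      rw [← mul_assoc, ← mul_pow]
      simp
    rw [Finset.sum_congr rfl fun i _ => h4 i, Finset.sum_const, Finset.card_univ,
      Fintype.card_fin, nsmul_eq_mul]
  rw [h3, Nat.factorial_succ, Nat.cast_mul, mul_assoc] at h1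
  exact (mul_left_cancel₀ (by exact_mod_cast k.succ_ne_zero) h1).symm

/-- Both sides are the antisymmetrization of A (v 0) ⊗ β divided by k! l!. The direction of
differentiation already stands in front of the variables of the first factor, so no sign appears. -/
theorem alternatizeUncurryFin_wedge_left {k l m : ℕ} (hm : k + l = m) (hm' : (k + 1) + l = m + 1)
    (A : E →L[ℝ] E [⋀^Fin k]→L[ℝ] ℂ) (β : E [⋀^Fin l]→L[ℝ] ℂ)
    (f : E →L[ℝ] E [⋀^Fin m]→L[ℝ] ℂ) (hf : ∀ v, f v = wedge hm (A v) β) :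
    alternatizeUncurryFin f = wedge hm' (alternatizeUncurryFin A) β := by
  ext v
  have hm0 : (m.factorial : ℂ) ≠ 0 := by exact_mod_cast m.factorial_ne_zero
  have hk0 : (k.factorial : ℂ) ≠ 0 := by exact_mod_cast k.factorial_ne_zero
  have hk1 : ((k + 1).factorial : ℂ) ≠ 0 := by exact_mod_cast (k + 1).factorial_ne_zero
  have hl0 : (l.factorial : ℂ) ≠ 0 := by exact_mod_cast l.factorial_ne_zero
  have e1 := factorial_mul_alternatizeUncurryFin f v
  simp only [hf, wedge_apply, antisymm_const_mul] at e1
  have e2 := antisymm_antisymm_block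
    ((Equiv.sumComm (Fin m) (Fin 1)).trans (blockEquiv (Nat.add_comm 1 m)))
    (fun (u : Fin m → E) (w : Fin 1 → E) =>
      A (w 0) (u ∘ blockEquiv hm ∘ Sum.inl) * β (u ∘ blockEquiv hm ∘ Sum.inr)) v
  have c1 : ∀ v : Fin (m + 1) → E, v ∘ ((Equiv.sumComm (Fin m) (Fin 1)).trans
      (blockEquiv (Nat.add_comm 1 m))) ∘ Sum.inl = Fin.tail v := by
    intro v
    funext i
    simp only [Function.comp_apply, Fin.tail, blockEquiv, Equiv.trans_apply, Equiv.sumComm_apply,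
      Sum.swap_inl, finSumFinEquiv_apply_right, finCongr_apply]
    exact congrArg v (Fin.ext (by simp))
  have c2 : ∀ v : Fin (m + 1) → E, (v ∘ ((Equiv.sumComm (Fin m) (Fin 1)).trans
      (blockEquiv (Nat.add_comm 1 m))) ∘ Sum.inr) 0 = v 0 := by
    intro v
    exact congrArg v (Fin.ext (by simp [blockEquiv]))
  simp only [c1, c2, Fintype.card_fin] at e2
  rw [e2] at e1
  have e3 := antisymm_antisymm_block (blockEquiv hm') (fun (u : Fin (k + 1) → E) (w : Fin l → E) =>
    β w * A (u 0) (Fin.tail u)) v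
  simp only [antisymm_const_mul, Fintype.card_fin, ← factorial_mul_alternatizeUncurryFin,
    mul_left_comm (β _)] at e3
  rw [wedge_apply]
  have e4 : antisymm (fun v : Fin (m + 1) → E => alternatizeUncurryFin A
      (v ∘ blockEquiv hm' ∘ Sum.inl) * β (v ∘ blockEquiv hm' ∘ Sum.inr)) v =
      ((k.factorial : ℂ))⁻¹ * ((k + 1).factorial * antisymm (fun v : Fin (m + 1) → E =>
        β (v ∘ blockEquiv hm' ∘ Sum.inr) * A ((v ∘ blockEquiv hm' ∘ Sum.inl) 0)
          (Fin.tail (v ∘ blockEquiv hm' ∘ Sum.inl))) v) := by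
    rw [← e3, eq_inv_mul_iff_mul_eq₀ hk0]
    simp only [mul_comm]
  have e5 : antisymm (fun v : Fin (m + 1) → E =>
        β (v ∘ blockEquiv hm' ∘ Sum.inr) * A ((v ∘ blockEquiv hm' ∘ Sum.inl) 0)
          (Fin.tail (v ∘ blockEquiv hm' ∘ Sum.inl))) v =
      antisymm (fun v : Fin (m + 1) → E => A (v 0) (Fin.tail v ∘ blockEquiv hm ∘ Sum.inl) *
        β (Fin.tail v ∘ blockEquiv hm ∘ Sum.inr)) v := by
    congr 1
    funext v
    have hv : ∀ x y : Fin (m + 1), (x : ℕ) = y → v x = v y := fun x y hxy =>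
      congrArg v (Fin.ext hxy)
    rw [mul_comm]
    have a1 : (v ∘ blockEquiv hm' ∘ Sum.inl) 0 = v 0 := hv _ _ (by simp [blockEquiv])
    have a2 : Fin.tail (v ∘ blockEquiv hm' ∘ Sum.inl) = Fin.tail v ∘ blockEquiv hm ∘ Sum.inl := by
      funext i; exact hv _ _ (by simp [blockEquiv])
    have a3 : v ∘ blockEquiv hm' ∘ Sum.inr = Fin.tail v ∘ blockEquiv hm ∘ Sum.inr := by
      funext i; exact hv _ _ (by simp [blockEquiv]; omega)
    rw [a1, a2, a3]
  rw [e4, e5]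
  apply mul_left_cancel₀ hm0
  rw [e1]
  push_cast
  field_simp

/-- Commute the factors, differentiate the left one, and commute back. The signs (-1)^(kl) and
(-1)^((l+1)k) combine to (-1)^k. -/
theorem alternatizeUncurryFin_wedge_right {k l m : ℕ} (hm : k + l = m)
    (hm' : k + (l + 1) = m + 1) (α : E [⋀^Fin k]→L[ℝ] ℂ) (B : E →L[ℝ] E [⋀^Fin l]→L[ℝ] ℂ)
    (f : E →L[ℝ] E [⋀^Fin m]→L[ℝ] ℂ) (hf : ∀ v, f v = wedge hm α (B v)) :
    alternatizeUncurryFin f = (-1 : ℂ) ^ k • wedge hm' α (alternatizeUncurryFin B) := by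
  have h1 := alternatizeUncurryFin_wedge_left ((Nat.add_comm l k).trans hm)
    (by omega : (l + 1) + k = m + 1) B α ((-1 : ℂ) ^ (k * l) • f) (fun v => by
      rw [_root_.smul_apply, hf, wedge_comm hm ((Nat.add_comm l k).trans hm), smul_smul,
        ← pow_add, ← two_mul, pow_mul]
      simp)
  rw [alternatizeUncurryFin_smul, wedge_comm (by omega : (l + 1) + k = m + 1) hm'] at h1
  have h2 := congrArg (fun x => (-1 : ℂ) ^ (k * l) • x) h1
  simp only [smul_smul, ← pow_add, ← two_mul] at h2
  rw [pow_mul, show k * l + (l + 1) * k = 2 * (k * l) + k by ring, pow_add, pow_mul] at h2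
  simpa using h2

end Leibniz

/-! ### The graded algebra of inhomogeneous forms. -/

section Graded

variable {E : Type*} [NormedAddCommGroup E] [NormedSpace ℝ E]
  {E' : Type*} [NormedAddCommGroup E'] [NormedSpace ℝ E']

theorem form_smul_zero {k : ℕ} (z : ℂ) : z • (0 : E [⋀^Fin k]→L[ℝ] ℂ) = 0 := by
  ext v; exact mul_zero z

theorem form_zero_smul {k : ℕ} (α : E [⋀^Fin k]→L[ℝ] ℂ) : (0 : ℂ) • α = 0 := by
  ext v; exact zero_mul (α v)

/-- The exterior product with values in a prescribed degree, zero if the degrees do not match. -/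
def wedgeTo (m : ℕ) {k l : ℕ} (α : E [⋀^Fin k]→L[ℝ] ℂ) (β : E [⋀^Fin l]→L[ℝ] ℂ) :
    E [⋀^Fin m]→L[ℝ] ℂ :=
  if hm : k + l = m then wedge hm α β else 0

theorem wedgeTo_eq {k l m : ℕ} (hm : k + l = m) (α : E [⋀^Fin k]→L[ℝ] ℂ)
    (β : E [⋀^Fin l]→L[ℝ] ℂ) : wedgeTo m α β = wedge hm α β := dif_pos hm

/-- With values in a prescribed degree, the summands no longer depend on a proof that the degrees
add up, so the sum can be split and reindexed freely. -/
theorem gwedge_eq (α β : GForm E) (m : ℕ) :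
    gwedge α β m = ∑ p ∈ Finset.HasAntidiagonal.antidiagonal m, wedgeTo m (α p.1) (β p.2) := by
  rw [← Finset.sum_coe_sort]
  exact Finset.sum_congr rfl fun p _ => (wedgeTo_eq _ _ _).symm

theorem wedgeTo_add_left {k l m : ℕ} (α α' : E [⋀^Fin k]→L[ℝ] ℂ) (β : E [⋀^Fin l]→L[ℝ] ℂ) :
    wedgeTo m (α + α') β = wedgeTo m α β + wedgeTo m α' β := by
  unfold wedgeTo; split_ifs; exacts [wedge_add_left _ _ _ _, (add_zero _).symm]

theorem wedgeTo_add_right {k l m : ℕ} (α : E [⋀^Fin k]→L[ℝ] ℂ) (β β' : E [⋀^Fin l]→L[ℝ] ℂ) :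
    wedgeTo m α (β + β') = wedgeTo m α β + wedgeTo m α β' := by
  unfold wedgeTo; split_ifs; exacts [wedge_add_right _ _ _ _, (add_zero _).symm]

theorem wedgeTo_smul_left {k l m : ℕ} (z : ℂ) (α : E [⋀^Fin k]→L[ℝ] ℂ)
    (β : E [⋀^Fin l]→L[ℝ] ℂ) : wedgeTo m (z • α) β = z • wedgeTo m α β := by
  unfold wedgeTo; split_ifs; exacts [wedge_smul_left _ _ _ _, (form_smul_zero _).symm]

theorem wedgeTo_smul_right {k l m : ℕ} (z : ℂ) (α : E [⋀^Fin k]→L[ℝ] ℂ)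
    (β : E [⋀^Fin l]→L[ℝ] ℂ) : wedgeTo m α (z • β) = z • wedgeTo m α β := by
  unfold wedgeTo; split_ifs; exacts [wedge_smul_right _ _ _ _, (form_smul_zero _).symm]

theorem wedgeTo_zero_left {k l m : ℕ} (β : E [⋀^Fin l]→L[ℝ] ℂ) :
    wedgeTo m (0 : E [⋀^Fin k]→L[ℝ] ℂ) β = 0 := by
  have := wedgeTo_smul_left (m := m) 0 (0 : E [⋀^Fin k]→L[ℝ] ℂ) β
  rwa [form_zero_smul, form_zero_smul] at this

theorem wedgeTo_zero_right {k l m : ℕ} (α : E [⋀^Fin k]→L[ℝ] ℂ) :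
    wedgeTo m α (0 : E [⋀^Fin l]→L[ℝ] ℂ) = 0 := by
  have := wedgeTo_smul_right (m := m) 0 α (0 : E [⋀^Fin l]→L[ℝ] ℂ)
  rwa [form_zero_smul, form_zero_smul] at this

theorem wedgeTo_sum_left {J : Type*} {k l m : ℕ} (s : Finset J) (α : J → E [⋀^Fin k]→L[ℝ] ℂ)
    (β : E [⋀^Fin l]→L[ℝ] ℂ) : wedgeTo m (∑ j ∈ s, α j) β = ∑ j ∈ s, wedgeTo m (α j) β :=
  map_sum (AddMonoidHom.mk' (fun α : E [⋀^Fin k]→L[ℝ] ℂ => wedgeTo m α β)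
    fun α α' => wedgeTo_add_left α α' β) α s

theorem wedgeTo_sum_right {J : Type*} {k l m : ℕ} (s : Finset J) (α : E [⋀^Fin k]→L[ℝ] ℂ)
    (β : J → E [⋀^Fin l]→L[ℝ] ℂ) : wedgeTo m α (∑ j ∈ s, β j) = ∑ j ∈ s, wedgeTo m α (β j) :=
  map_sum (AddMonoidHom.mk' (fun β : E [⋀^Fin l]→L[ℝ] ℂ => wedgeTo m α β)
    fun β β' => wedgeTo_add_right α β β') β s

theorem norm_wedgeTo_le {k l m : ℕ} (α : E [⋀^Fin k]→L[ℝ] ℂ) (β : E [⋀^Fin l]→L[ℝ] ℂ) :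
    ‖wedgeTo m α β‖ ≤ m.factorial * ‖α‖ * ‖β‖ := by
  unfold wedgeTo
  split_ifs with h
  · exact norm_wedge_le h α β
  · rw [norm_zero]; positivity

theorem ofReal_smul_form {k : ℕ} (r : ℝ) (α : E [⋀^Fin k]→L[ℝ] ℂ) : (r : ℂ) • α = r • α := by
  ext v; simp

/-- The exterior product as a continuous real bilinear map. -/
def wedgeL (E : Type*) [NormedAddCommGroup E] [NormedSpace ℝ E] (k l m : ℕ) :
    (E [⋀^Fin k]→L[ℝ] ℂ) →L[ℝ] (E [⋀^Fin l]→L[ℝ] ℂ) →L[ℝ] (E [⋀^Fin m]→L[ℝ] ℂ) :=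
  bilinOfBound (wedgeTo m) wedgeTo_add_left
    (fun z α β => by rw [← ofReal_smul_form, wedgeTo_smul_left, ofReal_smul_form])
    wedgeTo_add_right
    (fun z α β => by rw [← ofReal_smul_form, wedgeTo_smul_right, ofReal_smul_form])
    m.factorial norm_wedgeTo_le

theorem wedgeL_apply {k l m : ℕ} (α : E [⋀^Fin k]→L[ℝ] ℂ) (β : E [⋀^Fin l]→L[ℝ] ℂ) :
    wedgeL E k l m α β = wedgeTo m α β := rfl

theorem gwedge_add_left (α α' β : GForm E) : gwedge (α + α') β = gwedge α β + gwedge α' β := by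
  funext m
  simp only [gwedge_eq, Pi.add_apply, wedgeTo_add_left, Finset.sum_add_distrib]

theorem gwedge_add_right (α β β' : GForm E) : gwedge α (β + β') = gwedge α β + gwedge α β' := by
  funext m
  simp only [gwedge_eq, Pi.add_apply, wedgeTo_add_right, Finset.sum_add_distrib]

theorem gwedge_smul_left (z : ℂ) (α β : GForm E) : gwedge (z • α) β = z • gwedge α β := by
  funext m
  simp only [gwedge_eq, Pi.smul_apply, wedgeTo_smul_left, Finset.smul_sum]

theorem gwedge_smul_right (z : ℂ) (α β : GForm E) : gwedge α (z • β) = z • gwedge α β := by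
  funext m
  simp only [gwedge_eq, Pi.smul_apply, wedgeTo_smul_right, Finset.smul_sum]

/-- Inhomogeneous forms are pulled back along linear maps degree by degree. -/
def gcomp (α : GForm E') (A : E →L[ℝ] E') : GForm E := fun k => (α k).compContinuousLinearMap A

theorem gwedge_gcomp (α β : GForm E') (A : E →L[ℝ] E') :
    gcomp (gwedge α β) A = gwedge (gcomp α A) (gcomp β A) := by
  funext m
  simp only [gcomp, gwedge_eq]
  have : ∀ (s : Finset (ℕ × ℕ)) (F : ℕ × ℕ → E' [⋀^Fin m]→L[ℝ] ℂ),
      (∑ p ∈ s, F p).compContinuousLinearMap A = ∑ p ∈ s, (F p).compContinuousLinearMap A :=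
    fun s F => map_sum (ContinuousAlternatingMap.compContinuousLinearMapCLM A) F s
  rw [this]
  refine Finset.sum_congr rfl fun p hp => ?_
  rw [wedgeTo_eq (Finset.HasAntidiagonal.mem_antidiagonal.1 hp), wedgeTo_eq (Finset.HasAntidiagonal.mem_antidiagonal.1 hp),
    wedge_comp]

theorem gwedge_assoc (α β γ : GForm E) :
    gwedge (gwedge α β) γ = gwedge α (gwedge β γ) := by
  funext m
  simp only [gwedge_eq, wedgeTo_sum_left, wedgeTo_sum_right]
  rw [Finset.sum_sigma', Finset.sum_sigma']
  -- Both double sums run over triples of degrees with sum m, bracketed in the two possible ways.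
  refine Finset.sum_nbij' (fun x => ⟨(x.2.1, x.2.2 + x.1.2), (x.2.2, x.1.2)⟩)
    (fun x => ⟨(x.1.1 + x.2.1, x.2.2), (x.1.1, x.2.1)⟩) ?_ ?_ ?_ ?_ ?_
  · rintro ⟨⟨a, b⟩, ⟨c, d⟩⟩ h
    simp only [Finset.mem_sigma, Finset.HasAntidiagonal.mem_antidiagonal] at h ⊢
    exact ⟨by omega, trivial⟩
  · rintro ⟨⟨a, b⟩, ⟨c, d⟩⟩ h
    simp only [Finset.mem_sigma, Finset.HasAntidiagonal.mem_antidiagonal] at h ⊢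
    exact ⟨by omega, trivial⟩
  · rintro ⟨⟨a, b⟩, ⟨c, d⟩⟩ h
    simp only [Finset.mem_sigma, Finset.HasAntidiagonal.mem_antidiagonal] at h
    obtain ⟨h1, rfl⟩ := h
    rfl
  · rintro ⟨⟨a, b⟩, ⟨c, d⟩⟩ h
    simp only [Finset.mem_sigma, Finset.HasAntidiagonal.mem_antidiagonal] at h
    obtain ⟨h1, rfl⟩ := h
    rfl
  · rintro ⟨⟨a, b⟩, ⟨c, d⟩⟩ h
    simp only [Finset.mem_sigma, Finset.HasAntidiagonal.mem_antidiagonal] at h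
    obtain ⟨h1, h2⟩ := h
    dsimp only
    rw [wedgeTo_eq h2, wedgeTo_eq h1, wedgeTo_eq rfl, wedgeTo_eq (by omega)]
    exact wedge_assoc _ _ _ _ _ _ _

/-- The antisymmetrization of β is m! β, which cancels the normalization. -/
theorem wedgeTo_const_left (z : ℂ) {m : ℕ} (β : E [⋀^Fin m]→L[ℝ] ℂ) :
    wedgeTo m (ContinuousAlternatingMap.constOfIsEmpty ℝ E (Fin 0) z) β = z • β := by
  ext v
  rw [wedgeTo_eq (zero_add m), wedge_apply]
  simp only [ContinuousAlternatingMap.constOfIsEmpty_apply, antisymm_const_mul]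
  have h1 : antisymm (fun v : Fin m → E => β (v ∘ blockEquiv (zero_add m) ∘ Sum.inr)) v =
      antisymm β v := by
    congr 1
    funext v
    congr 1
    funext i
    exact congrArg v (Fin.ext (by simp [blockEquiv]))
  have hm : (m.factorial : ℂ) ≠ 0 := by exact_mod_cast m.factorial_ne_zero
  rw [h1, antisymm_form]
  simp
  field_simp

theorem gscalar_gwedge (z : ℂ) (β : GForm E) : gwedge (gscalar z) β = z • β := by
  funext m
  rw [gwedge_eq, Finset.sum_eq_single (0, m)]
  · exact wedgeTo_const_left z _
  · rintro ⟨a, b⟩ h1 h2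
    rw [Finset.HasAntidiagonal.mem_antidiagonal] at h1
    obtain ⟨a, rfl⟩ : ∃ a', a = a' + 1 := Nat.exists_eq_succ_of_ne_zero (by
      rintro rfl; apply h2; simp at h1; simp [h1])
    exact wedgeTo_zero_left _
  · simp

theorem gwedge_gscalar (z : ℂ) (β : GForm E) : gwedge β (gscalar z) = z • β := by
  funext m
  rw [gwedge_eq, Finset.sum_eq_single (m, 0)]
  · change wedgeTo m (β m) (ContinuousAlternatingMap.constOfIsEmpty ℝ E (Fin 0) z) = z • β m
    rw [wedgeTo_eq (add_zero m), wedge_comm (add_zero m) (zero_add m), ← wedgeTo_eq,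
      wedgeTo_const_left, mul_zero, pow_zero, one_smul]
  · rintro ⟨a, b⟩ h1 h2
    rw [Finset.HasAntidiagonal.mem_antidiagonal] at h1
    obtain ⟨b, rfl⟩ : ∃ b', b = b' + 1 := Nat.exists_eq_succ_of_ne_zero (by
      rintro rfl; apply h2; simp at h1; simp [h1])
    exact wedgeTo_zero_right _
  · simp

/-- A form concentrated in degree `k`. -/
def IsHomogeneous (k : ℕ) (α : GForm E) : Prop := ∀ m, m ≠ k → α m = 0

theorem gwedge_homogeneous {k l : ℕ} {α β : GForm E} (hα : IsHomogeneous k α)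
    (hβ : IsHomogeneous l β) : IsHomogeneous (k + l) (gwedge α β) := by
  intro m hm
  rw [gwedge_eq]
  refine Finset.sum_eq_zero fun p hp => ?_
  rw [Finset.HasAntidiagonal.mem_antidiagonal] at hp
  by_cases h1 : p.1 = k
  · rw [hβ p.2 (by omega), wedgeTo_zero_right]
  · rw [hα p.1 h1, wedgeTo_zero_left]

/-- Homogeneity leaves at most one pair of degrees in each sum, and for this pair the sign is that
of `wedge_comm`. -/
theorem gwedge_comm {k l : ℕ} {α β : GForm E} (hα : IsHomogeneous k α)
    (hβ : IsHomogeneous l β) : gwedge α β = (-1 : ℂ) ^ (k * l) • gwedge β α := by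
  funext m
  simp only [Pi.smul_apply, gwedge_eq, Finset.smul_sum]
  rw [← Finset.Nat.sum_antidiagonal_swap]
  refine Finset.sum_congr rfl fun p hp => ?_
  rw [Finset.HasAntidiagonal.mem_antidiagonal] at hp
  simp only [Prod.fst_swap, Prod.snd_swap]
  by_cases h1 : p.1 = l ∧ p.2 = k
  · obtain ⟨a, b⟩ := p
    obtain ⟨rfl, rfl⟩ : a = l ∧ b = k := h1
    rw [wedgeTo_eq hp, wedgeTo_eq ((add_comm _ _).trans hp), ← wedge_comm]
  · by_cases h2 : p.1 = l
    · rw [hα p.2 fun h => h1 ⟨h2, h⟩, wedgeTo_zero_left, wedgeTo_zero_right, form_smul_zero]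
    · rw [hβ p.1 h2, wedgeTo_zero_left, wedgeTo_zero_right, form_smul_zero]

/-- The sign operator `(-1) ^ deg`. -/
def signDeg (α : GForm E) : GForm E := fun k => (-1 : ℂ) ^ k • α k

theorem signDeg_homogeneous {k : ℕ} {α : GForm E} (hα : IsHomogeneous k α) :
    signDeg α = (-1 : ℂ) ^ k • α := by
  funext m
  by_cases h : m = k
  · subst h; rfl
  · simp only [signDeg, Pi.smul_apply, hα m h, form_smul_zero]

end Graded

/-! ### The weights 1 + |i| and their summability. -/

section Weights

/-- The weight `1 + |i|`. -/
def wt (i : ℤ) : ℝ := 1 + |(i : ℝ)|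

theorem one_le_wt (i : ℤ) : 1 ≤ wt i := le_add_of_nonneg_right (abs_nonneg _)

theorem wt_pos (i : ℤ) : 0 < wt i := zero_lt_one.trans_le (one_le_wt i)

/-- Triangle inequality together with 1 + a + b ≤ (1 + a)(1 + b) for a, b ≥ 0. This is why rapidly
decreasing matrices are closed under multiplication. -/
theorem wt_sub_le (i j k : ℤ) : wt (i - j) ≤ wt (i - k) * wt (k - j) := by
  have h1 : |((i - j : ℤ) : ℝ)| ≤ |((i - k : ℤ) : ℝ)| + |((k - j : ℤ) : ℝ)| := by
    rw [show i - j = (i - k) + (k - j) by ring, Int.cast_add]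
    exact abs_add_le _ _
  have h2 := mul_nonneg (abs_nonneg ((i - k : ℤ) : ℝ)) (abs_nonneg ((k - j : ℤ) : ℝ))
  unfold wt
  nlinarith

/-- Comparison with 1/k². It fails at k = 0, so the bound is required only off a finite set. -/
theorem summable_wt : Summable fun k : ℤ => (wt k ^ 2)⁻¹ := by
  refine Summable.of_norm_bounded_eventually
    ((Real.summable_one_div_int_pow (p := 2)).2 (by norm_num)) ?_
  have : ({0} : Set ℤ)ᶜ ∈ Filter.cofinite := (Set.finite_singleton 0).compl_mem_cofinite
  filter_upwards [this] with k hk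
  have hk' : (0 : ℝ) < |(k : ℝ)| := abs_pos.2 (by exact_mod_cast hk)
  rw [Real.norm_of_nonneg (by have := wt_pos k; positivity), one_div]
  refine inv_anti₀ (by rw [← sq_abs]; positivity) ?_
  rw [← sq_abs (k : ℝ)]
  exact pow_le_pow_left₀ hk'.le (le_add_of_nonneg_left zero_le_one) 2

theorem summable_wt_sub (i : ℤ) : Summable fun k : ℤ => (wt (i - k) ^ 2)⁻¹ :=
  summable_wt.comp_injective (i := fun k : ℤ => i - k) fun _ _ h => sub_right_injective h

/-- The sum does not depend on i, which makes the estimates on products uniform in the row. -/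
theorem tsum_wt_sub (i : ℤ) : ∑' k : ℤ, (wt (i - k) ^ 2)⁻¹ = ∑' k : ℤ, (wt k ^ 2)⁻¹ :=
  (Equiv.subLeft i).tsum_eq fun k : ℤ => (wt k ^ 2)⁻¹

/-- The coefficients of the product of weighted matrices. -/
def wtCoef (N : ℕ) (i j k : ℤ) : ℝ :=
  wt (i - j) ^ N * (wt (i - k) ^ (N + 2))⁻¹ * (wt (k - j) ^ (N + 2))⁻¹

theorem wtCoef_nonneg (N : ℕ) (i j k : ℤ) : 0 ≤ wtCoef N i j k := by
  have := wt_pos (i - j); have := wt_pos (i - k); have := wt_pos (k - j)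
  unfold wtCoef; positivity

/-- Submultiplicativity absorbs the weight of order N. Of the two extra powers in each factor, one
pair is kept for summability in k and the other is discarded as at least 1. -/
theorem wtCoef_le (N : ℕ) (i j k : ℤ) : wtCoef N i j k ≤ (wt (i - k) ^ 2)⁻¹ := by
  have h1 := wt_pos (i - j); have h2 := wt_pos (i - k); have h3 := wt_pos (k - j)
  have h4 : wt (i - j) ^ N ≤ wt (i - k) ^ N * wt (k - j) ^ N := by
    rw [← mul_pow]; exact pow_le_pow_left₀ h1.le (wt_sub_le i j k) N
  have h5 : 1 ≤ wt (k - j) ^ 2 := one_le_pow₀ (one_le_wt _)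
  unfold wtCoef
  rw [← div_eq_mul_inv, ← div_eq_mul_inv, div_div, div_le_iff₀ (by positivity)]
  calc wt (i - j) ^ N ≤ wt (i - k) ^ N * wt (k - j) ^ N * 1 := by rw [mul_one]; exact h4
    _ ≤ wt (i - k) ^ N * wt (k - j) ^ N * wt (k - j) ^ 2 := by gcongr
    _ = _ := by field_simp; ring

end Weights

/-! ### Products of bounded matrices with Banach space entries. -/

section BanachMatrices

variable {A B C C' : Type*} [NormedAddCommGroup A] [NormedSpace ℝ A]
  [NormedAddCommGroup B] [NormedSpace ℝ B] [NormedAddCommGroup C] [NormedSpace ℝ C]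
  [NormedAddCommGroup C'] [NormedSpace ℝ C'] {E : Type*} [NormedAddCommGroup E] [NormedSpace ℝ E]

/-- Bounded `ℤ × ℤ`-matrices. -/
abbrev BMat (A : Type*) [NormedAddCommGroup A] : Type _ := lp (fun _ : ℤ × ℤ => A) ⊤

theorem BMat.norm_apply_le (a : BMat A) (p : ℤ × ℤ) : ‖a p‖ ≤ ‖a‖ :=
  lp.norm_apply_le_norm ENNReal.top_ne_zero a p

/-- The bounded matrix with given entries. -/
def BMat.mk (f : ℤ × ℤ → A) (K : ℝ) (hK : ∀ p, ‖f p‖ ≤ K) : BMat A :=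
  ⟨f, memℓp_infty ⟨K, by rintro _ ⟨p, rfl⟩; exact hK p⟩⟩

theorem BMat.norm_mk_le (f : ℤ × ℤ → A) (K : ℝ) (hK : ∀ p, ‖f p‖ ≤ K) : ‖BMat.mk f K hK‖ ≤ K :=
  lp.norm_le_of_forall_le ((norm_nonneg _).trans (hK 0)) hK

theorem BMat.ext {a b : BMat A} (h : ∀ i j, a (i, j) = b (i, j)) : a = b :=
  lp.ext (funext fun p => h p.1 p.2)

/-- The entries of a bounded matrix are continuous linear functionals. -/
def BMat.entry (A : Type*) [NormedAddCommGroup A] [NormedSpace ℝ A] (i j : ℤ) : BMat A →L[ℝ] A :=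
  (⟨⟨fun a => a (i, j), fun _ _ => rfl⟩, fun _ _ => rfl⟩ : BMat A →ₗ[ℝ] A).mkContinuous 1
    fun a => by rw [one_mul]; exact BMat.norm_apply_le a _

theorem BMat.entry_apply (i j : ℤ) (a : BMat A) : BMat.entry A i j a = a (i, j) := rfl

/-- The majorant is summable in k, with a sum independent of i and j. It gives both convergence of
the product and its bound in the supremum norm. -/
theorem norm_mulTerm_le (β : A →L[ℝ] B →L[ℝ] C) (N : ℕ) (a : BMat A) (b : BMat B) (i j k : ℤ) :
    ‖wtCoef N i j k • β (a (i, k)) (b (k, j))‖ ≤ (wt (i - k) ^ 2)⁻¹ * (‖β‖ * ‖a‖ * ‖b‖) := by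
  rw [norm_smul, Real.norm_of_nonneg (wtCoef_nonneg _ _ _ _)]
  refine mul_le_mul (wtCoef_le _ _ _ _) ?_ (norm_nonneg _) (by have := wt_pos (i - k); positivity)
  exact (β.le_opNorm₂ _ _).trans (by
    gcongr <;> exact BMat.norm_apply_le _ _)

theorem summable_mulTerm [CompleteSpace C] (β : A →L[ℝ] B →L[ℝ] C) (N : ℕ) (a : BMat A) (b : BMat B) (i j : ℤ) :
    Summable fun k => wtCoef N i j k • β (a (i, k)) (b (k, j)) :=
  Summable.of_norm_bounded ((summable_wt_sub i).mul_right _)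
    fun k => norm_mulTerm_le β N a b i j k

theorem norm_tsum_mulTerm_le [CompleteSpace C] (β : A →L[ℝ] B →L[ℝ] C) (N : ℕ) (a : BMat A) (b : BMat B)
    (p : ℤ × ℤ) : ‖∑' k, wtCoef N p.1 p.2 k • β (a (p.1, k)) (b (k, p.2))‖ ≤
      (∑' k : ℤ, (wt k ^ 2)⁻¹) * ‖β‖ * ‖a‖ * ‖b‖ := by
  refine (tsum_of_norm_bounded ((summable_wt_sub p.1).mul_right _).hasSum
    fun k => norm_mulTerm_le β N a b p.1 p.2 k).trans ?_
  rw [tsum_mul_right, tsum_wt_sub]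
  exact le_of_eq (by ring)

/-- The product of weighted matrices, as a continuous bilinear map on bounded matrices. -/
def BMat.mul [CompleteSpace C] (β : A →L[ℝ] B →L[ℝ] C) (N : ℕ) : BMat A →L[ℝ] BMat B →L[ℝ] BMat C :=
  bilinOfBound (fun a b => BMat.mk
      (fun p => ∑' k, wtCoef N p.1 p.2 k • β (a (p.1, k)) (b (k, p.2))) _
      (norm_tsum_mulTerm_le β N a b))
    (fun a a' b => BMat.ext fun i j => by
      change ∑' k, wtCoef N i j k • β (a (i, k) + a' (i, k)) (b (k, j)) =
        (∑' k, wtCoef N i j k • β (a (i, k)) (b (k, j))) +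
          ∑' k, wtCoef N i j k • β (a' (i, k)) (b (k, j))
      rw [← (summable_mulTerm β N a b i j).tsum_add (summable_mulTerm β N a' b i j)]
      refine tsum_congr fun k => ?_
      rw [map_add, add_apply, smul_add])
    (fun c a b => BMat.ext fun i j => by
      change ∑' k, wtCoef N i j k • β (c • a (i, k)) (b (k, j)) =
        c • ∑' k, wtCoef N i j k • β (a (i, k)) (b (k, j))
      rw [← (summable_mulTerm β N a b i j).tsum_const_smul]
      refine tsum_congr fun k => ?_
      rw [map_smul, smul_apply, smul_comm])
    (fun a b b' => BMat.ext fun i j => by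
      change ∑' k, wtCoef N i j k • β (a (i, k)) (b (k, j) + b' (k, j)) =
        (∑' k, wtCoef N i j k • β (a (i, k)) (b (k, j))) +
          ∑' k, wtCoef N i j k • β (a (i, k)) (b' (k, j))
      rw [← (summable_mulTerm β N a b i j).tsum_add (summable_mulTerm β N a b' i j)]
      refine tsum_congr fun k => ?_
      rw [map_add, smul_add])
    (fun c a b => BMat.ext fun i j => by
      change ∑' k, wtCoef N i j k • β (a (i, k)) (c • b (k, j)) =
        c • ∑' k, wtCoef N i j k • β (a (i, k)) (b (k, j))
      rw [← (summable_mulTerm β N a b i j).tsum_const_smul]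
      refine tsum_congr fun k => ?_
      rw [map_smul, smul_comm])
    ((∑' k : ℤ, (wt k ^ 2)⁻¹) * ‖β‖) fun a b => BMat.norm_mk_le _ _ _

theorem BMat.mul_apply [CompleteSpace C] (β : A →L[ℝ] B →L[ℝ] C) (N : ℕ) (a : BMat A) (b : BMat B) (i j : ℤ) :
    BMat.mul β N a b (i, j) = ∑' k, wtCoef N i j k • β (a (i, k)) (b (k, j)) := rfl

/-- This bound makes the series of derivatives converge in operator norm and not only vector by
vector. -/
theorem norm_smul_comp_le {D : Type*} [NormedAddCommGroup D] [NormedSpace ℝ D]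
    (β : A →L[ℝ] B →L[ℝ] C) (N : ℕ) (a : BMat A) (G : D →L[ℝ] BMat B) (i j k : ℤ) :
    ‖wtCoef N i j k • (β (a (i, k))).comp ((BMat.entry B k j).comp G)‖ ≤
      (wt (i - k) ^ 2)⁻¹ * (‖β‖ * ‖a‖ * ‖G‖) := by
  refine ContinuousLinearMap.opNorm_le_bound _
    (by have := wt_pos (i - k); positivity) fun v => ?_
  refine (norm_mulTerm_le β N a (G v) i j k).trans ?_
  have := wt_pos (i - k)
  calc (wt (i - k) ^ 2)⁻¹ * (‖β‖ * ‖a‖ * ‖G v‖)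
      ≤ (wt (i - k) ^ 2)⁻¹ * (‖β‖ * ‖a‖ * (‖G‖ * ‖v‖)) := by gcongr; exact G.le_opNorm v
    _ = _ := by ring

/-- Termwise application of a continuous linear map to the derivative of a product. -/
theorem map_fderiv_mul [CompleteSpace C] (β : A →L[ℝ] B →L[ℝ] C) (Φ : (E →L[ℝ] C) →L[ℝ] C') {F : E → BMat A}
    {G : E → BMat B} {y : E} (hF : DifferentiableAt ℝ F y) (hG : DifferentiableAt ℝ G y)
    (i j : ℤ) :
    HasSum (fun k => Φ (wtCoef 0 i j k • (β (F y (i, k))).comp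
        ((BMat.entry B k j).comp (fderiv ℝ G y))) +
      Φ (wtCoef 0 i j k • (β.flip (G y (k, j))).comp ((BMat.entry A i k).comp (fderiv ℝ F y))))
      (Φ (fderiv ℝ (fun z => BMat.mul β 0 (F z) (G z) (i, j)) y)) := by
  -- Convergence of both series in the space of operators is what allows the continuous map Φ to be
  -- applied term by term.
  have h1 : Summable fun k => wtCoef 0 i j k • (β (F y (i, k))).comp
      ((BMat.entry B k j).comp (fderiv ℝ G y)) :=
    Summable.of_norm_bounded ((summable_wt_sub i).mul_right _)
      fun k => norm_smul_comp_le β 0 (F y) (fderiv ℝ G y) i j k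
  have h2 : Summable fun k => wtCoef 0 i j k • (β.flip (G y (k, j))).comp
      ((BMat.entry A i k).comp (fderiv ℝ F y)) := by
    refine Summable.of_norm_bounded
      ((summable_wt_sub i).mul_right (‖β‖ * ‖fderiv ℝ F y‖ * ‖G y‖)) fun k => ?_
    refine ContinuousLinearMap.opNorm_le_bound _
      (by have := wt_pos (i - k); positivity) fun v => ?_
    refine (norm_mulTerm_le β 0 (fderiv ℝ F y v) (G y) i j k).trans ?_
    have := wt_pos (i - k)
    calc (wt (i - k) ^ 2)⁻¹ * (‖β‖ * ‖fderiv ℝ F y v‖ * ‖G y‖)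
        ≤ (wt (i - k) ^ 2)⁻¹ * (‖β‖ * (‖fderiv ℝ F y‖ * ‖v‖) * ‖G y‖) := by
          gcongr; exact (fderiv ℝ F y).le_opNorm v
      _ = _ := by ring
  -- The product rule for the bounded bilinear multiplication gives the derivative as a whole;
  -- evaluating it at a vector then identifies it with the termwise series.
  have h3 := (BMat.mul β 0).hasFDerivAt_of_bilinear hF.hasFDerivAt hG.hasFDerivAt
  have h4 := ((BMat.entry C i j).hasFDerivAt.comp y h3).fderiv
  have h5 : fderiv ℝ (fun z => BMat.mul β 0 (F z) (G z) (i, j)) y =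
      ∑' k, (wtCoef 0 i j k • (β (F y (i, k))).comp ((BMat.entry B k j).comp (fderiv ℝ G y)) +
        wtCoef 0 i j k • (β.flip (G y (k, j))).comp ((BMat.entry A i k).comp (fderiv ℝ F y))) := by
    refine Eq.trans h4 (ContinuousLinearMap.ext fun v => ?_)
    have h6 := (ContinuousLinearMap.apply ℝ C v).map_tsum (h1.add h2)
    simp only [ContinuousLinearMap.apply_apply] at h6
    rw [h6]
    have h7 := (summable_mulTerm β 0 (F y) (fderiv ℝ G y v) i j).tsum_add
      (summable_mulTerm β 0 (fderiv ℝ F y v) (G y) i j)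
    exact h7.symm
  rw [h5]
  have h8 := ((h1.add h2).hasSum).mapL Φ
  simpa only [map_add] using h8

/-- Entrywise application of a continuous linear map to the derivative of a matrix. -/
theorem exists_entrywise (Φ : (E →L[ℝ] C) →L[ℝ] C') :
    ∃ T : (E →L[ℝ] BMat C) →L[ℝ] BMat C', ∀ L i j,
      T L (i, j) = Φ ((BMat.entry C i j).comp L) := by
  have hb : ∀ (L : E →L[ℝ] BMat C) (p : ℤ × ℤ),
      ‖Φ ((BMat.entry C p.1 p.2).comp L)‖ ≤ ‖Φ‖ * ‖L‖ := fun L p => by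
    refine (Φ.le_opNorm _).trans (mul_le_mul_of_nonneg_left ?_ (norm_nonneg _))
    refine ContinuousLinearMap.opNorm_le_bound _ (norm_nonneg _) fun v => ?_
    exact (BMat.norm_apply_le (L v) p).trans (L.le_opNorm v)
  let T : (E →L[ℝ] BMat C) →ₗ[ℝ] BMat C' :=
    { toFun := fun L => BMat.mk (fun p => Φ ((BMat.entry C p.1 p.2).comp L)) _ (hb L)
      map_add' := fun L L' => BMat.ext fun i j => by
        change Φ ((BMat.entry C i j).comp (L + L')) =
          Φ ((BMat.entry C i j).comp L) + Φ ((BMat.entry C i j).comp L')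
        rw [ContinuousLinearMap.comp_add, map_add]
      map_smul' := fun c L => BMat.ext fun i j => by
        change Φ ((BMat.entry C i j).comp (c • L)) = c • Φ ((BMat.entry C i j).comp L)
        rw [ContinuousLinearMap.comp_smul, map_smul] }
  exact ⟨T.mkContinuous ‖Φ‖ fun L => BMat.norm_mk_le _ _ (hb L), fun L i j => rfl⟩

end BanachMatrices

/-! ### Pointwise products of matrices of forms. -/

section Decay

variable {E : Type*} [NormedAddCommGroup E] [NormedSpace ℝ E]
  {E' : Type*} [NormedAddCommGroup E'] [NormedSpace ℝ E']

/-- Matrices of inhomogeneous forms with rapidly decreasing off-diagonal entries. -/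
def Decay (a : ℤ → ℤ → GForm E) : Prop :=
  ∀ k N : ℕ, ∃ K : ℝ, ∀ i j, wt (i - j) ^ N * ‖a i j k‖ ≤ K

/-- The product of matrices of inhomogeneous forms. -/
def mulP (a b : ℤ → ℤ → GForm E) : ℤ → ℤ → GForm E := fun i j m =>
  ∑' k : ℤ, gwedge (a i k) (b k j) m

theorem Decay.norm_le {a : ℤ → ℤ → GForm E} (ha : Decay a) (k N : ℕ) :
    ∃ K : ℝ, 0 ≤ K ∧ ∀ i j, ‖a i j k‖ ≤ (wt (i - j) ^ N)⁻¹ * K := by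
  obtain ⟨K, hK⟩ := ha k N
  refine ⟨K, (mul_nonneg (pow_nonneg (wt_pos _).le _) (norm_nonneg _)).trans (hK 0 0),
    fun i j => ?_⟩
  have := wt_pos (i - j)
  rw [inv_mul_eq_div, le_div_iff₀ (by positivity), mul_comm]
  exact hK i j

/-- Decay of order two of one factor and boundedness of the other suffice. -/
theorem Decay.summable_wedgeTo {a b : ℤ → ℤ → GForm E} (ha : Decay a) (hb : Decay b)
    (p q m : ℕ) (i j : ℤ) : Summable fun k => ‖wedgeTo m (a i k p) (b k j q)‖ := by
  obtain ⟨K, hK, ha⟩ := ha.norm_le p 2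
  obtain ⟨K', hK', hb⟩ := hb.norm_le q 0
  refine Summable.of_nonneg_of_le (fun _ => norm_nonneg _) (fun k => ?_)
    ((summable_wt_sub i).mul_right (m.factorial * K * K'))
  refine (norm_wedgeTo_le _ _).trans ?_
  have h1 := ha i k
  have h2 := hb k j
  rw [pow_zero, inv_one, one_mul] at h2
  have := wt_pos (i - k)
  calc m.factorial * ‖a i k p‖ * ‖b k j q‖
      ≤ m.factorial * ((wt (i - k) ^ 2)⁻¹ * K) * K' := by gcongr
    _ = _ := by ring

theorem Decay.summable_norm_gwedge {a b : ℤ → ℤ → GForm E} (ha : Decay a) (hb : Decay b)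
    (m : ℕ) (i j : ℤ) : Summable fun k => ‖gwedge (a i k) (b k j) m‖ := by
  simp only [gwedge_eq]
  exact Summable.of_nonneg_of_le (fun _ => norm_nonneg _) (fun k => norm_sum_le _ _)
    (summable_sum fun p _ => ha.summable_wedgeTo hb p.1 p.2 m i j)

theorem Decay.summable_gwedge {a b : ℤ → ℤ → GForm E} (ha : Decay a) (hb : Decay b)
    (m : ℕ) (i j : ℤ) : Summable fun k => gwedge (a i k) (b k j) m :=
  (ha.summable_norm_gwedge hb m i j).of_norm

/-- The weights of order N + 2 carried by F and G cancel the inverse weights in `wtCoef`, leaving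
the weight of order N of the product. This identifies the abstract Banach space product with the
product of forms. -/
theorem BMat.mul_wedgeL_apply {p q : ℕ} (m N : ℕ) {a b : ℤ → ℤ → GForm E}
    {F : BMat (E [⋀^Fin p]→L[ℝ] ℂ)} {G : BMat (E [⋀^Fin q]→L[ℝ] ℂ)}
    (hF : ∀ i j, F (i, j) = wt (i - j) ^ (N + 2) • a i j p)
    (hG : ∀ i j, G (i, j) = wt (i - j) ^ (N + 2) • b i j q) (i j : ℤ) :
    BMat.mul (wedgeL E p q m) N F G (i, j) =
      wt (i - j) ^ N • ∑' k, wedgeTo m (a i k p) (b k j q) := by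
  rw [BMat.mul_apply, ← tsum_const_smul'']
  refine tsum_congr fun k => ?_
  have := wt_pos (i - k)
  have := wt_pos (k - j)
  rw [hF, hG, map_smul, map_smul, smul_apply, smul_smul, smul_smul, wtCoef, wedgeL_apply]
  congr 1
  field_simp

theorem mulP_eq_sum {a b : ℤ → ℤ → GForm E} (ha : Decay a) (hb : Decay b) (i j : ℤ) (m : ℕ) :
    mulP a b i j m = ∑ p ∈ Finset.HasAntidiagonal.antidiagonal m,
      ∑' k, wedgeTo m (a i k p.1) (b k j p.2) := by
  rw [mulP]
  simp only [gwedge_eq]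
  exact Summable.tsum_finsetSum fun p _ => (ha.summable_wedgeTo hb p.1 p.2 m i j).of_norm

theorem Decay.of_bMat {a : ℤ → ℤ → GForm E}
    (h : ∀ k N : ℕ, ∃ F : BMat (E [⋀^Fin k]→L[ℝ] ℂ), ∀ i j, F (i, j) = wt (i - j) ^ N • a i j k) :
    Decay a := by
  intro k N
  obtain ⟨F, hF⟩ := h k N
  refine ⟨‖F‖, fun i j => ?_⟩
  rw [← Real.norm_of_nonneg (pow_nonneg (wt_pos (i - j)).le N), ← norm_smul, ← hF]
  exact BMat.norm_apply_le F _

theorem gwedge_tsum_left {J : Type*} {a : J → GForm E} (ha : ∀ k, Summable fun j => a j k)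
    (β : GForm E) (m : ℕ) :
    HasSum (fun j => gwedge (a j) β m) (gwedge (fun k => ∑' j, a j k) β m) := by
  simp only [gwedge_eq]
  refine hasSum_sum fun p _ => ?_
  exact (ha p.1).hasSum.mapL ((wedgeL E p.1 p.2 m).flip (β p.2))

theorem gwedge_tsum_right {J : Type*} {b : J → GForm E} (hb : ∀ k, Summable fun j => b j k)
    (α : GForm E) (m : ℕ) :
    HasSum (fun j => gwedge α (b j) m) (gwedge α (fun k => ∑' j, b j k) m) := by
  simp only [gwedge_eq]
  refine hasSum_sum fun p _ => ?_
  exact (hb p.2).hasSum.mapL (wedgeL E p.1 p.2 m (α p.1))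

theorem norm_gwedge_le (α β : GForm E) (m : ℕ) : ‖gwedge α β m‖ ≤
    ∑ p ∈ Finset.HasAntidiagonal.antidiagonal m, m.factorial * ‖α p.1‖ * ‖β p.2‖ := by
  rw [gwedge_eq]
  exact norm_sum_le_of_le _ fun p _ => norm_wedgeTo_le _ _

/-- Associativity of the exterior product reduces the claim to interchanging the sums over k and l,
which is legitimate because the double series converges absolutely. -/
theorem mulP_assoc {a b c : ℤ → ℤ → GForm E} (ha : Decay a) (hb : Decay b) (hc : Decay c) :
    mulP (mulP a b) c = mulP a (mulP b c) := by
  funext i j m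
  have h1 : ∀ l, HasSum (fun k => gwedge (gwedge (a i k) (b k l)) (c l j) m)
      (gwedge (mulP a b i l) (c l j) m) := fun l =>
    gwedge_tsum_left (fun k => ha.summable_gwedge hb k i l) _ m
  have h2 : ∀ k, HasSum (fun l => gwedge (a i k) (gwedge (b k l) (c l j)) m)
      (gwedge (a i k) (mulP b c k j) m) := fun k =>
    gwedge_tsum_right (fun l => hb.summable_gwedge hc l k j) _ m
  -- Decay of order two is used for the first two factors and boundedness for the third. The map (l,
  -- k) ↦ (i - k, k - l) is injective, so the majorant is part of a product of two convergent
  -- series.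
  have hs : Summable (Function.uncurry fun l k : ℤ =>
      gwedge (a i k) (gwedge (b k l) (c l j)) m) := by
    choose K hK ha using fun p => ha.norm_le p 2
    choose K' hK' hb using fun p => hb.norm_le p 2
    choose K'' hK'' hc using fun p => hc.norm_le p 0
    have hs1 : Summable fun x : ℤ × ℤ => (wt (i - x.2) ^ 2)⁻¹ * (wt (x.2 - x.1) ^ 2)⁻¹ := by
      have h0 : Summable fun x : ℤ × ℤ => (wt x.1 ^ 2)⁻¹ * (wt x.2 ^ 2)⁻¹ :=
        summable_wt.mul_of_nonneg summable_wt
          (fun k => by have := wt_pos k; positivity) (fun k => by have := wt_pos k; positivity)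
      refine h0.comp_injective (i := fun x : ℤ × ℤ => (i - x.2, x.2 - x.1)) ?_
      rintro ⟨x, y⟩ ⟨x', y'⟩ h
      simp only [Prod.mk.injEq] at h ⊢
      omega
    set D : ℝ := ∑ p ∈ Finset.HasAntidiagonal.antidiagonal m,
      ∑ q ∈ Finset.HasAntidiagonal.antidiagonal p.2,
        m.factorial * K p.1 * (p.2.factorial * K' q.1 * K'' q.2) with hD
    refine Summable.of_norm_bounded (hs1.mul_right D) ?_
    rintro ⟨l, k⟩
    change ‖gwedge (a i k) (gwedge (b k l) (c l j)) m‖ ≤ _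
    refine (norm_gwedge_le _ _ _).trans ?_
    rw [hD, Finset.mul_sum]
    refine Finset.sum_le_sum fun p _ => ?_
    rw [Finset.mul_sum]
    refine (mul_le_mul_of_nonneg_left (norm_gwedge_le _ _ _) (by positivity)).trans ?_
    rw [Finset.mul_sum]
    refine Finset.sum_le_sum fun q _ => ?_
    have e1 := ha p.1 i k
    have e2 := hb q.1 k l
    have e3 := hc q.2 l j
    rw [pow_zero, inv_one, one_mul] at e3
    have := wt_pos (i - k)
    have := wt_pos (k - l)
    have := hK p.1
    have := hK' q.1
    calc m.factorial * ‖a i k p.1‖ * (p.2.factorial * ‖b k l q.1‖ * ‖c l j q.2‖)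
        ≤ m.factorial * ((wt (i - k) ^ 2)⁻¹ * K p.1) *
          (p.2.factorial * ((wt (k - l) ^ 2)⁻¹ * K' q.1) * K'' q.2) := by gcongr
      _ = _ := by ring
  rw [mulP, mulP]
  rw [← tsum_congr fun l => (h1 l).tsum_eq, ← tsum_congr fun k => (h2 k).tsum_eq]
  simp only [gwedge_assoc]
  exact hs.tsum_comm.symm

theorem mulP_add_left {a a' b : ℤ → ℤ → GForm E} (ha : Decay a) (ha' : Decay a') (hb : Decay b) :
    mulP (a + a') b = mulP a b + mulP a' b := by
  funext i j m
  refine Eq.trans (tsum_congr fun k => ?_)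
    ((ha.summable_gwedge hb m i j).tsum_add (ha'.summable_gwedge hb m i j))
  exact congrFun (gwedge_add_left _ _ _) m

theorem mulP_add_right {a b b' : ℤ → ℤ → GForm E} (ha : Decay a) (hb : Decay b) (hb' : Decay b') :
    mulP a (b + b') = mulP a b + mulP a b' := by
  funext i j m
  refine Eq.trans (tsum_congr fun k => ?_)
    ((ha.summable_gwedge hb m i j).tsum_add (ha.summable_gwedge hb' m i j))
  exact congrFun (gwedge_add_right _ _ _) m

theorem mulP_smul_left (z : ℂ) {a b : ℤ → ℤ → GForm E} (ha : Decay a) (hb : Decay b) :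
    mulP (z • a) b = z • mulP a b := by
  funext i j m
  refine Eq.trans (tsum_congr fun k => ?_) ((ha.summable_gwedge hb m i j).tsum_const_smul z)
  exact congrFun (gwedge_smul_left z _ _) m

theorem mulP_smul_right (z : ℂ) {a b : ℤ → ℤ → GForm E} (ha : Decay a) (hb : Decay b) :
    mulP a (z • b) = z • mulP a b := by
  funext i j m
  refine Eq.trans (tsum_congr fun k => ?_) ((ha.summable_gwedge hb m i j).tsum_const_smul z)
  exact congrFun (gwedge_smul_right z _ _) m

theorem gwedge_zero_left (β : GForm E) : gwedge 0 β = 0 := by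
  funext m
  rw [gwedge_eq]
  exact Finset.sum_eq_zero fun p _ => wedgeTo_zero_left _

theorem gwedge_zero_right (β : GForm E) : gwedge β 0 = 0 := by
  funext m
  rw [gwedge_eq]
  exact Finset.sum_eq_zero fun p _ => wedgeTo_zero_right _

theorem gscalar_zero : (gscalar 0 : GForm E) = 0 := by
  funext k
  cases k with
  | zero => ext v; rfl
  | succ k => rfl

theorem form_one_smul {k : ℕ} (α : E [⋀^Fin k]→L[ℝ] ℂ) : (1 : ℂ) • α = α := by
  ext v; exact one_mul (α v)

theorem one_mulP (b : ℤ → ℤ → GForm E) :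
    mulP (fun i j => gscalar (if i = j then 1 else 0)) b = b := by
  funext i j m
  refine (tsum_eq_single i fun k hk => ?_).trans ?_
  · dsimp only; rw [if_neg (Ne.symm hk), gscalar_zero, gwedge_zero_left]; rfl
  · dsimp only; rw [if_pos rfl, gscalar_gwedge]; exact form_one_smul _

theorem mulP_one (b : ℤ → ℤ → GForm E) :
    mulP b (fun i j => gscalar (if i = j then 1 else 0)) = b := by
  funext i j m
  refine (tsum_eq_single j fun k hk => ?_).trans ?_
  · dsimp only; rw [if_neg hk, gscalar_zero, gwedge_zero_right]; rfl
  · dsimp only; rw [if_pos rfl, gwedge_gscalar]; exact form_one_smul _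

/-- Pullback along a linear map is continuous in each degree, hence commutes with the series, and it
is multiplicative on each term. -/
theorem mulP_gcomp {a b : ℤ → ℤ → GForm E'} (ha : Decay a) (hb : Decay b) (A : E →L[ℝ] E')
    (i j : ℤ) : gcomp (mulP a b i j) A =
      mulP (fun i j => gcomp (a i j) A) (fun i j => gcomp (b i j) A) i j := by
  funext m
  have h1 := ((ha.summable_gwedge hb m i j).hasSum.mapL
    (ContinuousAlternatingMap.compContinuousLinearMapCLM A)).tsum_eq
  refine h1.symm.trans (tsum_congr fun k => ?_)
  exact congrFun (gwedge_gcomp _ _ A) m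

theorem mulP_homogeneous {k l : ℕ} {a b : ℤ → ℤ → GForm E} (ha : ∀ i j, IsHomogeneous k (a i j))
    (hb : ∀ i j, IsHomogeneous l (b i j)) (i j : ℤ) : IsHomogeneous (k + l) (mulP a b i j) :=
  fun m hm => (tsum_congr fun s => gwedge_homogeneous (ha i s) (hb s j) m hm).trans tsum_zero

end Decay

/-! ### Differentiability of bilinear and linear expressions. -/

section Calculus

variable {E A B C : Type*} [NormedAddCommGroup E] [NormedSpace ℝ E] [NormedAddCommGroup A]
  [NormedSpace ℝ A] [NormedAddCommGroup B] [NormedSpace ℝ B] [NormedAddCommGroup C]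
  [NormedSpace ℝ C] {U : Set E}

theorem contDiffOn_bilin (β : A →L[ℝ] B →L[ℝ] C) {F : E → A} {G : E → B}
    (hF : ContDiffOn ℝ ∞ F U) (hG : ContDiffOn ℝ ∞ G U) :
    ContDiffOn ℝ ∞ (fun y => β (F y) (G y)) U :=
  β.isBoundedBilinearMap.contDiff.comp_contDiffOn (hF.prodMk hG)

theorem contDiffOn_clm_fderiv (Φ : (E →L[ℝ] A) →L[ℝ] C) {F : E → A}
    (hF : ContDiffOn ℝ ∞ F U) (hU : IsOpen U) :
    ContDiffOn ℝ ∞ (fun y => Φ (fderiv ℝ F y)) U :=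
  Φ.contDiff.comp_contDiffOn (hF.fderiv_of_isOpen hU (by simp))

theorem contDiffOn_clm (Φ : A →L[ℝ] C) {F : E → A} (hF : ContDiffOn ℝ ∞ F U) :
    ContDiffOn ℝ ∞ (fun y => Φ (F y)) U :=
  Φ.contDiff.comp_contDiffOn hF

theorem differentiableAt_of_contDiffOn {F : E → A} (hF : ContDiffOn ℝ ∞ F U) (hU : IsOpen U)
    {y : E} (hy : y ∈ U) : DifferentiableAt ℝ F y :=
  (hF.differentiableOn (by simp) y hy).differentiableAt (hU.mem_nhds hy)

theorem differentiableAt_bilin (β : A →L[ℝ] B →L[ℝ] C) {F : E → A} {G : E → B} {y : E}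
    (hF : DifferentiableAt ℝ F y) (hG : DifferentiableAt ℝ G y) :
    DifferentiableAt ℝ (fun y => β (F y) (G y)) y :=
  (β.hasFDerivAt_of_bilinear hF.hasFDerivAt hG.hasFDerivAt).differentiableAt

theorem fderiv_clm_comp (Φ : A →L[ℝ] C) {F : E → A} {y : E} (hF : DifferentiableAt ℝ F y) :
    fderiv ℝ (fun y => Φ (F y)) y = Φ.comp (fderiv ℝ F y) :=
  (Φ.hasFDerivAt.comp y hF.hasFDerivAt).fderiv

/-- Used to remove the weights from the termwise derivative: c is the coefficient of the product,
and r and s are the weights of the two matrices. -/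
theorem clm_smul_comp_smul {C' : Type*} [NormedAddCommGroup C'] [NormedSpace ℝ C']
    (β : A →L[ℝ] B →L[ℝ] C) (Φ : (E →L[ℝ] C) →L[ℝ] C') {c r s : ℝ} (h : c * r * s = 1) (x : A)
    (T : E →L[ℝ] B) : Φ (c • (β (r • x)).comp (s • T)) = Φ ((β x).comp T) := by
  congr 1
  ext v
  simp only [map_smul, smul_apply, ContinuousLinearMap.comp_apply, smul_smul]
  rw [show c * (s * r) = 1 by rw [← h]; ring, one_smul]

theorem map_fderiv_sum {C' ι : Type*} [NormedAddCommGroup C'] [NormedSpace ℝ C']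
    (Φ : (E →L[ℝ] C) →L[ℝ] C') (s : Finset ι) {f : ι → E → C} {y : E}
    (h : ∀ p ∈ s, DifferentiableAt ℝ (f p) y) :
    Φ (fderiv ℝ (fun z => ∑ p ∈ s, f p z) y) = ∑ p ∈ s, Φ (fderiv ℝ (f p) y) := by
  rw [fderiv_fun_sum h, map_sum]

theorem map_sum_add_comm {C' ι : Type*} [NormedAddCommGroup C'] [NormedSpace ℝ C']
    (Φ : (E →L[ℝ] C) →L[ℝ] C') (s : Finset ι) (f g : ι → E →L[ℝ] C) :
    Φ (∑ p ∈ s, (f p + g p)) = ∑ p ∈ s, (Φ (g p) + Φ (f p)) := by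
  simp only [map_sum, map_add, add_comm]

theorem BMat.differentiableAt_apply {F : E → BMat A} {y : E} (hF : DifferentiableAt ℝ F y)
    (i j : ℤ) : DifferentiableAt ℝ (fun z => F z (i, j)) y :=
  ((BMat.entry A i j).hasFDerivAt.comp y hF.hasFDerivAt).differentiableAt

end Calculus

/-! ### Differential forms and matrices of forms on open sets of a vector space. -/

section FlatForms

variable {E : Type*} [NormedAddCommGroup E] [NormedSpace ℝ E]
  {E' : Type*} [NormedAddCommGroup E'] [NormedSpace ℝ E']

/-- Smooth inhomogeneous forms on a subset of a vector space. -/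
def FlatForm (U : Set E) (a : E → GForm E) : Prop :=
  ∀ k, ContDiffOn ℝ ∞ (fun y => a y k) U

/-- Smooth matrices of inhomogeneous forms, with rapidly decreasing off-diagonal entries, on a
subset of a vector space. -/
def FlatSmooth (U : Set E) (a : ℤ → ℤ → E → GForm E) : Prop :=
  ∀ k N : ℕ, ∃ F : E → BMat (E [⋀^Fin k]→L[ℝ] ℂ), ContDiffOn ℝ ∞ F U ∧
    ∀ y ∈ U, ∀ i j : ℤ, F y (i, j) = wt (i - j) ^ N • a i j y k

variable {U : Set E}

theorem FlatSmooth.decay {a : ℤ → ℤ → E → GForm E} (ha : FlatSmooth U a) {y : E} (hy : y ∈ U) :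
    Decay fun i j => a i j y :=
  Decay.of_bMat fun k N => by
    obtain ⟨F, -, hF⟩ := ha k N
    exact ⟨F y, hF y hy⟩

theorem FlatSmooth.exists_eq {a : ℤ → ℤ → E → GForm E} (ha : FlatSmooth U a) (k N : ℕ) (i j : ℤ) :
    ∃ F : E → BMat (E [⋀^Fin k]→L[ℝ] ℂ), ContDiffOn ℝ ∞ F U ∧
      (∀ y ∈ U, ∀ i j : ℤ, F y (i, j) = wt (i - j) ^ N • a i j y k) ∧
      ∀ y ∈ U, a i j y k = (wt (i - j) ^ N)⁻¹ • BMat.entry _ i j (F y) := by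
  obtain ⟨F, hF, hF'⟩ := ha k N
  refine ⟨F, hF, hF', fun y hy => ?_⟩
  rw [BMat.entry_apply, hF' y hy, smul_smul, inv_mul_cancel₀, one_smul]
  exact pow_ne_zero _ (wt_pos _).ne'

theorem FlatSmooth.flatForm {a : ℤ → ℤ → E → GForm E} (ha : FlatSmooth U a) (i j : ℤ) :
    FlatForm U (a i j) := by
  intro k
  obtain ⟨F, hF, -, h⟩ := ha.exists_eq k 0 i j
  exact ((contDiffOn_clm (BMat.entry _ i j) hF).const_smul _).congr h

/-- In each degree the weighted product is a finite sum of bounded bilinear maps applied to smooth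
Banach-valued maps. -/
theorem FlatSmooth.mulP {a b : ℤ → ℤ → E → GForm E} (ha : FlatSmooth U a) (hb : FlatSmooth U b) :
    FlatSmooth U fun i j y => mulP (fun i j => a i j y) (fun i j => b i j y) i j := by
  intro m N
  -- Multiplication costs two orders of decay, so order N of the product requires order N + 2 of the
  -- factors.
  choose F hF hF' using fun k => ha k (N + 2)
  choose G hG hG' using fun k => hb k (N + 2)
  refine ⟨fun y => ∑ p ∈ Finset.HasAntidiagonal.antidiagonal m,
    BMat.mul (wedgeL E p.1 p.2 m) N (F p.1 y) (G p.2 y), ?_, fun y hy i j => ?_⟩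
  · refine ContDiffOn.sum fun p _ => ?_
    exact contDiffOn_bilin (BMat.mul (wedgeL E p.1 p.2 m) N) (hF p.1) (hG p.2)
  · change BMat.entry _ i j _ =
      wt (i - j) ^ N • ClosedTrace.mulP (fun i j => a i j y) (fun i j => b i j y) i j m
    rw [mulP_eq_sum (ha.decay hy) (hb.decay hy), Finset.smul_sum, map_sum]
    exact Finset.sum_congr rfl fun p _ =>
      BMat.mul_wedgeL_apply m N (hF' p.1 y hy) (hG' p.2 y hy) i j

theorem FlatForm.differentiableAt {a : E → GForm E} (ha : FlatForm U a) (hU : IsOpen U) {y : E}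
    (hy : y ∈ U) (k : ℕ) : DifferentiableAt ℝ (fun y => a y k) y :=
  differentiableAt_of_contDiffOn (ha k) hU hy

theorem alternatizeUncurryFin_zero (k : ℕ) :
    ContinuousAlternatingMap.alternatizeUncurryFin (0 : E →L[ℝ] E [⋀^Fin k]→L[ℝ] ℂ) = 0 := by
  ext v
  rw [ContinuousAlternatingMap.alternatizeUncurryFin_apply]
  exact Finset.sum_eq_zero fun i _ => smul_zero _

theorem FlatForm.flatD {a : E → GForm E} (ha : FlatForm U a) (hU : IsOpen U) :
    FlatForm U (flatD a) := by
  intro k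
  cases k with
  | zero => exact contDiffOn_const
  | succ k =>
    exact contDiffOn_clm_fderiv (ContinuousAlternatingMap.alternatizeUncurryFinCLM ℝ E ℂ (n := k))
      (ha k) hU

theorem flatD_flatD {a : E → GForm E} (ha : FlatForm U a) (hU : IsOpen U) {y : E} (hy : y ∈ U) :
    flatD (flatD a) y = 0 := by
  funext k
  match k with
  | 0 => rfl
  -- A differential has no component of degree 0, so in degree 1 a constant zero function is being
  -- differentiated.
  | 1 =>
    change extDeriv (fun _ => (0 : E [⋀^Fin 0]→L[ℝ] ℂ)) y = 0
    rw [extDeriv, fderiv_fun_const]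
    exact alternatizeUncurryFin_zero _
  | k + 2 =>
    exact extDeriv_extDeriv_apply (r := ∞) ((ha k).contDiffAt (hU.mem_nhds hy))
      (by rw [minSmoothness_of_isRCLikeNormedField]; exact WithTop.coe_le_coe.2 le_top)

theorem flatD_congr {a b : E → GForm E} {y : E} (h : a =ᶠ[𝓝 y] b) : flatD a y = flatD b y := by
  funext k
  cases k with
  | zero => rfl
  | succ k => exact Filter.EventuallyEq.extDeriv_eq (h.mono fun z hz => congrFun hz k)

theorem flatD_add {a b : E → GForm E} {y : E} (ha : ∀ k, DifferentiableAt ℝ (fun y => a y k) y)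
    (hb : ∀ k, DifferentiableAt ℝ (fun y => b y k) y) :
    flatD (fun y => a y + b y) y = flatD a y + flatD b y := by
  funext k
  cases k with
  | zero => exact (add_zero _).symm
  | succ k => exact extDeriv_fun_add (ha k) (hb k)

theorem flatD_smul (z : ℂ) {a : E → GForm E} {y : E}
    (ha : ∀ k, DifferentiableAt ℝ (fun y => a y k) y) :
    flatD (fun y => z • a y) y = z • flatD a y := by
  funext k
  cases k with
  | zero => exact (form_smul_zero z).symm
  | succ k =>
    change ContinuousAlternatingMap.alternatizeUncurryFin (fderiv ℝ (fun y => z • a y k) y) =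
      z • ContinuousAlternatingMap.alternatizeUncurryFin (fderiv ℝ (fun y => a y k) y)
    rw [fderiv_fun_const_smul (ha k)]
    ext v
    rw [ContinuousAlternatingMap.alternatizeUncurryFin_apply, ContinuousAlternatingMap.smul_apply,
      ContinuousAlternatingMap.alternatizeUncurryFin_apply, Finset.smul_sum]
    exact Finset.sum_congr rfl fun i _ => smul_comm _ _ _

theorem FlatForm.gwedge {a b : E → GForm E} (ha : FlatForm U a) (hb : FlatForm U b) :
    FlatForm U fun y => gwedge (a y) (b y) := by
  intro m
  simp only [gwedge_eq]
  refine ContDiffOn.sum fun p _ => ?_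
  exact contDiffOn_bilin (wedgeL E p.1 p.2 m) (ha p.1) (hb p.2)

/-- Taking an entry is a continuous linear functional, so it commutes with the derivative of the
matrix as a Banach-valued map. -/
theorem fderiv_entry {a : ℤ → ℤ → E → GForm E} (ha : FlatSmooth U a) (hU : IsOpen U) {y : E}
    (hy : y ∈ U) {k N : ℕ} {F : E → BMat (E [⋀^Fin k]→L[ℝ] ℂ)} (hd : DifferentiableAt ℝ F y)
    (hF' : ∀ y ∈ U, ∀ i j : ℤ, F y (i, j) = wt (i - j) ^ N • a i j y k) (i j : ℤ) :
    (BMat.entry _ i j).comp (fderiv ℝ F y) =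
        wt (i - j) ^ N • fderiv ℝ (fun z => a i j z k) y := by
  have h1 : (fun z => BMat.entry _ i j (F z)) =ᶠ[𝓝 y] fun z => wt (i - j) ^ N • a i j z k := by
    filter_upwards [hU.mem_nhds hy] with z hz
    exact hF' z hz i j
  rw [← fderiv_fun_const_smul ((ha.flatForm i j).differentiableAt hU hy k), ← h1.fderiv_eq]
  exact (fderiv_clm_comp (BMat.entry _ i j) hd).symm

/-- The derivative of the weighted matrix is again a map into bounded matrices, so differentiation
preserves every order of decay. Alternation is then applied to all entries at once. -/
theorem FlatSmooth.flatD {a : ℤ → ℤ → E → GForm E} (ha : FlatSmooth U a) (hU : IsOpen U) :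
    FlatSmooth U fun i j => flatD (a i j) := by
  intro k N
  cases k with
  | zero =>
    refine ⟨fun _ => 0, contDiffOn_const, fun y _ i j => ?_⟩
    ext v
    exact (mul_zero _).symm
  | succ k =>
    obtain ⟨F, hF, hF'⟩ := ha k N
    obtain ⟨T, hT⟩ := exists_entrywise (ContinuousAlternatingMap.alternatizeUncurryFinCLM ℝ E ℂ
      (n := k))
    refine ⟨fun y => T (fderiv ℝ F y), contDiffOn_clm_fderiv T hF hU, fun y hy i j => ?_⟩
    rw [hT, fderiv_entry ha hU hy (differentiableAt_of_contDiffOn hF hU hy) hF', map_smul]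
    rfl

open ContinuousAlternatingMap in
theorem alternatize_wedgeTo_left {k l m : ℕ} (A : E →L[ℝ] E [⋀^Fin k]→L[ℝ] ℂ)
    (β : E [⋀^Fin l]→L[ℝ] ℂ) :
    alternatizeUncurryFin (((wedgeL E k l m).flip β).comp A) =
      wedgeTo (m + 1) (alternatizeUncurryFin A) β := by
  by_cases h : k + l = m
  · rw [wedgeTo_eq (by omega)]
    exact alternatizeUncurryFin_wedge_left h _ A β _ fun v => wedgeTo_eq h _ _
  · have h1 : ((wedgeL E k l m).flip β).comp A = 0 := by
      ext1 v; exact dif_neg h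
    have h2 : wedgeTo (m + 1) (alternatizeUncurryFin A) β = 0 := dif_neg (by omega)
    rw [h1, h2]
    exact alternatizeUncurryFin_zero _

open ContinuousAlternatingMap in
theorem alternatize_wedgeTo_right {k l m : ℕ} (α : E [⋀^Fin k]→L[ℝ] ℂ)
    (B : E →L[ℝ] E [⋀^Fin l]→L[ℝ] ℂ) :
    alternatizeUncurryFin ((wedgeL E k l m α).comp B) =
      (-1 : ℂ) ^ k • wedgeTo (m + 1) α (alternatizeUncurryFin B) := by
  by_cases h : k + l = m
  · rw [wedgeTo_eq (by omega)]
    exact alternatizeUncurryFin_wedge_right h _ α B _ fun v => wedgeTo_eq h _ _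
  · have h1 : (wedgeL E k l m α).comp B = 0 := by
      ext1 v; exact dif_neg h
    have h2 : wedgeTo (m + 1) α (alternatizeUncurryFin B) = 0 := dif_neg (by omega)
    rw [h1, h2, form_smul_zero]
    exact alternatizeUncurryFin_zero _

theorem gwedge_flatD_succ (a : E → GForm E) (b : E → GForm E) (y : E) (m : ℕ) :
    gwedge (flatD a y) (b y) (m + 1) = ∑ p ∈ Finset.HasAntidiagonal.antidiagonal m,
      wedgeTo (m + 1) (flatD a y (p.1 + 1)) (b y p.2) := by
  rw [gwedge_eq, Finset.Nat.sum_antidiagonal_succ]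
  refine (congrArg (· + _) ?_).trans (zero_add _)
  exact wedgeTo_zero_left _

theorem gwedge_signDeg_flatD_succ (a : E → GForm E) (b : E → GForm E) (y : E) (m : ℕ) :
    gwedge (signDeg (a y)) (flatD b y) (m + 1) = ∑ p ∈ Finset.HasAntidiagonal.antidiagonal m,
      (-1 : ℂ) ^ p.1 • wedgeTo (m + 1) (a y p.1) (flatD b y (p.2 + 1)) := by
  rw [gwedge_eq, Finset.Nat.sum_antidiagonal_succ']
  refine (congrArg (· + _) ?_).trans (zero_add _) |>.trans ?_
  · exact wedgeTo_zero_right _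
  · exact Finset.sum_congr rfl fun p _ => wedgeTo_smul_left _ _ _

/-- The product rule for the bilinear exterior product, followed by alternation. Differentiating the
second factor moves the new variable past p variables of the first, which is the sign recorded by
`signDeg`. -/
theorem flatD_gwedge {a b : E → GForm E} (ha : FlatForm U a) (hb : FlatForm U b) (hU : IsOpen U)
    {y : E} (hy : y ∈ U) : flatD (fun y => gwedge (a y) (b y)) y =
      gwedge (flatD a y) (b y) + gwedge (signDeg (a y)) (flatD b y) := by
  funext m
  cases m with
  | zero =>
    have h : ∀ α β : GForm E, (α 0 = 0 ∨ β 0 = 0) → gwedge α β 0 = 0 := by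
      intro α β h
      rw [gwedge_eq]
      refine Finset.sum_eq_zero fun p hp => ?_
      obtain ⟨rfl⟩ : p = (0, 0) := by simpa using hp
      rcases h with h | h
      · exact (congrArg (fun x => wedgeTo 0 x (β 0)) h).trans (wedgeTo_zero_left _)
      · exact (congrArg (fun x => wedgeTo 0 (α 0) x) h).trans (wedgeTo_zero_right _)
    change 0 = gwedge _ _ 0 + gwedge _ _ 0
    rw [h _ _ (Or.inl rfl), h _ _ (Or.inr rfl), add_zero]
  | succ m =>
    rw [Pi.add_apply, gwedge_flatD_succ, gwedge_signDeg_flatD_succ, ← Finset.sum_add_distrib]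
    have h1 : ∀ p ∈ Finset.HasAntidiagonal.antidiagonal m,
        HasFDerivAt (fun z => wedgeTo m (a z p.1) (b z p.2))
        ((wedgeL E p.1 p.2 m (a y p.1)).comp (fderiv ℝ (fun z => b z p.2) y) +
          ((wedgeL E p.1 p.2 m).flip (b y p.2)).comp (fderiv ℝ (fun z => a z p.1) y)) y :=
      fun p _ => (wedgeL E p.1 p.2 m).hasFDerivAt_of_bilinear
        (ha.differentiableAt hU hy p.1).hasFDerivAt (hb.differentiableAt hU hy p.2).hasFDerivAt
    have h2 : fderiv ℝ (fun z => gwedge (a z) (b z) m) y =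
        ∑ p ∈ Finset.HasAntidiagonal.antidiagonal m,
          ((wedgeL E p.1 p.2 m (a y p.1)).comp (fderiv ℝ (fun z => b z p.2) y) +
          ((wedgeL E p.1 p.2 m).flip (b y p.2)).comp (fderiv ℝ (fun z => a z p.1) y)) := by
      simp only [gwedge_eq]
      exact (HasFDerivAt.fun_sum h1).fderiv
    change ContinuousAlternatingMap.alternatizeUncurryFinCLM ℝ E ℂ (n := m)
      (fderiv ℝ (fun z => gwedge (a z) (b z) m) y) = _
    rw [h2, map_sum_add_comm]
    refine Finset.sum_congr rfl fun p _ => congrArg₂ (· + ·) ?_ ?_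
    · exact alternatize_wedgeTo_left _ _
    · exact alternatize_wedgeTo_right _ _

theorem Decay.signDeg {a : ℤ → ℤ → GForm E} (ha : Decay a) : Decay fun i j => signDeg (a i j) := by
  intro k N
  obtain ⟨K, hK⟩ := ha k N
  refine ⟨K, fun i j => ?_⟩
  refine le_trans (le_of_eq ?_) (hK i j)
  change wt (i - j) ^ N * ‖(-1 : ℂ) ^ k • a i j k‖ = _
  rw [norm_smul, norm_pow, norm_neg, norm_one, one_pow, one_mul]

/-- The Leibniz rule for products of matrices of forms. -/
theorem flatD_mulP {a b : ℤ → ℤ → E → GForm E} (ha : FlatSmooth U a) (hb : FlatSmooth U b)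
    (hU : IsOpen U) {y : E} (hy : y ∈ U) (i j : ℤ) :
    ClosedTrace.flatD (fun y => ClosedTrace.mulP (fun i j => a i j y) (fun i j => b i j y) i j) y =
      ClosedTrace.mulP (fun i j => ClosedTrace.flatD (a i j) y) (fun i j => b i j y) i j +
      ClosedTrace.mulP (fun i j => ClosedTrace.signDeg (a i j y))
        (fun i j => ClosedTrace.flatD (b i j) y) i j := by
  have hda := (ha.flatD hU).decay hy
  have hdb := (hb.flatD hU).decay hy
  -- It suffices to differentiate the series term by term, since the Leibniz rule for each single
  -- product splits the result into two convergent series.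
  suffices h : ∀ m, HasSum (fun k => ClosedTrace.flatD (fun y => gwedge (a i k y) (b k j y)) y m)
      (ClosedTrace.flatD
        (fun y => ClosedTrace.mulP (fun i j => a i j y) (fun i j => b i j y) i j) y m) by
    funext m
    have h1 := (hda.summable_gwedge (hb.decay hy) m i j).hasSum.add
      ((ha.decay hy).signDeg.summable_gwedge hdb m i j).hasSum
    refine HasSum.unique (Eq.mp (congrArg (fun f => HasSum f _) (funext fun k => ?_)) (h m)) h1
    exact congrFun (flatD_gwedge (ha.flatForm i k) (hb.flatForm k j) hU hy) m
  intro m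
  cases m with
  | zero => exact hasSum_zero
  | succ m =>
    choose F hF hF' using fun k => ha k 2
    choose G hG hG' using fun k => hb k 2
    have hdF : ∀ k, DifferentiableAt ℝ (F k) y := fun k =>
      differentiableAt_of_contDiffOn (hF k) hU hy
    have hdG : ∀ k, DifferentiableAt ℝ (G k) y := fun k =>
      differentiableAt_of_contDiffOn (hG k) hU hy
    -- Near y the entry is a finite sum of entries of Banach space products with output order 0.
    -- Their derivative is given by a series to which alternation applies termwise.
    have h1 : (fun z => ClosedTrace.mulP (fun i j => a i j z) (fun i j => b i j z) i j m) =ᶠ[𝓝 y]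
        fun z => ∑ p ∈ Finset.HasAntidiagonal.antidiagonal m,
          BMat.mul (wedgeL E p.1 p.2 m) 0 (F p.1 z) (G p.2 z) (i, j) := by
      filter_upwards [hU.mem_nhds hy] with z hz
      rw [mulP_eq_sum (ha.decay hz) (hb.decay hz)]
      refine Finset.sum_congr rfl fun p _ => ?_
      rw [BMat.mul_wedgeL_apply m 0 (hF' p.1 z hz) (hG' p.2 z hz), pow_zero, one_smul]
    have h2 : ∀ p ∈ Finset.HasAntidiagonal.antidiagonal m, DifferentiableAt ℝ
        (fun z => BMat.mul (wedgeL E p.1 p.2 m) 0 (F p.1 z) (G p.2 z) (i, j)) y := fun p _ =>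
      BMat.differentiableAt_apply
        (differentiableAt_bilin (BMat.mul (wedgeL E p.1 p.2 m) 0) (hdF p.1) (hdG p.2)) i j
    change HasSum _ (ContinuousAlternatingMap.alternatizeUncurryFinCLM ℝ E ℂ (n := m)
      (fderiv ℝ (fun z => ClosedTrace.mulP (fun i j => a i j z) (fun i j => b i j z) i j m) y))
    rw [h1.fderiv_eq, map_fderiv_sum _ _ h2]
    have h3 := hasSum_sum fun p (_ : p ∈ Finset.HasAntidiagonal.antidiagonal m) =>
      map_fderiv_mul (wedgeL E p.1 p.2 m)
        (ContinuousAlternatingMap.alternatizeUncurryFinCLM ℝ E ℂ (n := m))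
        (hdF p.1) (hdG p.2) i j
    refine Eq.mp (congrArg (fun f => HasSum f _) (funext fun k => ?_)) h3
    rw [flatD_gwedge (ha.flatForm i k) (hb.flatForm k j) hU hy, Pi.add_apply,
      gwedge_flatD_succ, gwedge_signDeg_flatD_succ, ← Finset.sum_add_distrib]
    refine Finset.sum_congr rfl fun p _ => ?_
    have h4 := wt_pos (i - k)
    have h5 := wt_pos (k - j)
    -- With output order 0 the coefficient is exactly the inverse of the two input weights of order
    -- 2.
    have h6 : wtCoef 0 i j k * wt (i - k) ^ 2 * wt (k - j) ^ 2 = 1 := by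
      rw [wtCoef]; field_simp
    rw [fderiv_entry hb hU hy (hdG p.2) (hG' p.2), fderiv_entry ha hU hy (hdF p.1) (hF' p.1),
      hF' p.1 y hy, hG' p.2 y hy, clm_smul_comp_smul _ _ h6,
      clm_smul_comp_smul _ _ (by rw [mul_right_comm, h6])]
    refine (add_comm _ _).trans (congrArg₂ (· + ·) ?_ ?_)
    · exact alternatize_wedgeTo_left _ _
    · exact alternatize_wedgeTo_right _ _

end FlatForms

/-! ### Smooth dependence of pullbacks on the linear map. -/

section PullbackSmooth

variable {E : Type*} [NormedAddCommGroup E] [NormedSpace ℝ E]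
  {E' : Type*} [NormedAddCommGroup E'] [NormedSpace ℝ E']

theorem alternatization_form {k : ℕ} (α : E [⋀^Fin k]→L[ℝ] ℂ) :
    ContinuousMultilinearMap.alternatization α.toContinuousMultilinearMap =
      (k.factorial : ℝ) • α := by
  ext v
  have := congrArg (fun f => f v) (AlternatingMap.coe_alternatization α.toAlternatingMap)
  simpa [MultilinearMap.alternatization_apply, ContinuousMultilinearMap.alternatization_apply_apply,
    Function.comp_def] using this

/-- Alternatization as a continuous linear map. -/
def alternatizationL (E : Type*) [NormedAddCommGroup E] [NormedSpace ℝ E] (k : ℕ) :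
    ContinuousMultilinearMap ℝ (fun _ : Fin k => E) ℂ →L[ℝ] E [⋀^Fin k]→L[ℝ] ℂ :=
  LinearMap.mkContinuous
    { toFun := ContinuousMultilinearMap.alternatization
      map_add' := map_add _
      map_smul' := fun c f => by
        ext v
        simp [ContinuousMultilinearMap.alternatization_apply_apply, Finset.mul_sum,
          mul_smul_comm] }
    k.factorial fun f => by
      refine ContinuousAlternatingMap.opNorm_le_bound _ (by positivity) fun v => ?_
      change ‖ContinuousMultilinearMap.alternatization f v‖ ≤ _
      rw [ContinuousMultilinearMap.alternatization_apply_apply]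
      refine (norm_sum_le _ _).trans ?_
      have h : ∀ σ ∈ (Finset.univ : Finset (Equiv.Perm (Fin k))),
          ‖Equiv.Perm.sign σ • f (v ∘ σ)‖ ≤ ‖f‖ * ∏ i, ‖v i‖ := by
        intro σ _
        have h1 : ‖Equiv.Perm.sign σ • f (v ∘ σ)‖ = ‖f (v ∘ σ)‖ := by
          rcases Int.units_eq_one_or (Equiv.Perm.sign σ) with h | h <;> simp [h]
        rw [h1]
        refine (f.le_opNorm _).trans (le_of_eq ?_)
        congr 1
        exact Equiv.prod_comp σ fun i => ‖v i‖
      refine (Finset.sum_le_card_nsmul _ _ _ h).trans (le_of_eq ?_)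
      rw [Finset.card_univ, Fintype.card_perm, Fintype.card_fin, nsmul_eq_mul, mul_assoc]

/-- Alternating maps are a retract of multilinear maps: alternatization divided by k! is a
continuous left inverse of the inclusion. Smoothness questions can thus be settled among multilinear
maps. -/
theorem contDiffOn_form_iff {k : ℕ} {a : E' → E [⋀^Fin k]→L[ℝ] ℂ} {U : Set E'} :
    ContDiffOn ℝ ∞ (fun y => (a y).toContinuousMultilinearMap) U ↔ ContDiffOn ℝ ∞ a U := by
  constructor
  · intro h
    have h1 := (alternatizationL E k).contDiff.comp_contDiffOn h
    refine (h1.const_smul ((k.factorial : ℝ)⁻¹)).congr fun y _ => ?_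
    refine Eq.symm ((congrArg _ (alternatization_form (a y))).trans ?_)
    rw [smul_smul, inv_mul_cancel₀ (by positivity), one_smul]
  · exact (ContinuousAlternatingMap.toContinuousMultilinearMapLI (𝕜 := ℝ) (E := E) (F := ℂ)
      (ι := Fin k)).toContinuousLinearMap.contDiff.comp_contDiffOn

/-- The composition is linear in the form and is a continuous multilinear expression evaluated on k
copies of the linear map. -/
theorem contDiffOn_compContinuousLinearMap {G : Type*} [NormedAddCommGroup G] [NormedSpace ℝ G]
    {k : ℕ} {a : G → E' [⋀^Fin k]→L[ℝ] ℂ}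
    {A : G → E →L[ℝ] E'} {U : Set G} (ha : ContDiffOn ℝ ∞ a U) (hA : ContDiffOn ℝ ∞ A U) :
    ContDiffOn ℝ ∞ (fun y => (a y).compContinuousLinearMap (A y)) U := by
  rw [← contDiffOn_form_iff] at ha ⊢
  have h1 : ContDiff ℝ ∞ (fun A : Fin k → E →L[ℝ] E' =>
      ContinuousMultilinearMap.compContinuousLinearMapContinuousMultilinear ℝ
        (fun _ : Fin k => E) (fun _ : Fin k => E') ℂ A) :=
    ContinuousMultilinearMap.contDiff (E := fun _ : Fin k => E →L[ℝ] E') _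
  have h2 := h1.comp_contDiffOn (contDiffOn_pi.2 fun _ : Fin k => hA)
  exact h2.clm_apply ha

end PullbackSmooth

/-! ### Pullbacks and exterior derivatives on manifolds. -/

section Charts

variable {E : Type*} [NormedAddCommGroup E] [NormedSpace ℝ E]
  {X : Type*} [TopologicalSpace X] [ChartedSpace E X]
  {E' : Type*} [NormedAddCommGroup E'] [NormedSpace ℝ E']
  {Y : Type*} [TopologicalSpace Y] [ChartedSpace E' Y]
  {E'' : Type*} [NormedAddCommGroup E''] [NormedSpace ℝ E'']
  {Z : Type*} [TopologicalSpace Z] [ChartedSpace E'' Z]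

theorem pullback_eq_gcomp (f : X → Y) (α : Y → GForm E') (p : X) :
    pullback (E := E) f α p = gcomp (E := E) (E' := E') (α (f p)) (mfderiv 𝓘(ℝ, E) 𝓘(ℝ, E') f p : E →L[ℝ] E') := rfl

theorem pullback_comp {f : X → Y} {g : Y → Z} {p : X}
    (hg : MDifferentiableAt 𝓘(ℝ, E') 𝓘(ℝ, E'') g (f p))
    (hf : MDifferentiableAt 𝓘(ℝ, E) 𝓘(ℝ, E') f p) (α : Z → GForm E'') :
    pullback (E := E) (g ∘ f) α p = pullback f (pullback (E := E') g α) p := by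
  rw [pullback_eq_gcomp, pullback_eq_gcomp, pullback_eq_gcomp, mfderiv_comp p hg hf]
  rfl

theorem pullback_congr {f f' : X → Y} {p : X} (h : f =ᶠ[𝓝 p] f') (α : Y → GForm E') :
    pullback (E := E) f α p = pullback f' α p := by
  have h1 : (mfderiv 𝓘(ℝ, E) 𝓘(ℝ, E') f p : E →L[ℝ] E') = mfderiv 𝓘(ℝ, E) 𝓘(ℝ, E') f' p :=
    h.mfderiv_eq
  change gcomp (E := E) (E' := E') (α (f p)) (mfderiv 𝓘(ℝ, E) 𝓘(ℝ, E') f p : E →L[ℝ] E') = _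
  rw [h1, h.eq_of_nhds]
  rfl

theorem pullback_congr_form {f : X → Y} {p : X} {α β : Y → GForm E'} (h : α (f p) = β (f p)) :
    pullback (E := E) f α p = pullback f β p := by
  rw [pullback_eq_gcomp, h]
  rfl

theorem pullback_id (α : X → GForm E) : pullback (id : X → X) α = α := by
  funext p
  rw [pullback_eq_gcomp, mfderiv_id]
  rfl

theorem pullback_flat (φ : E → E') (β : E' → GForm E') (y : E) :
    pullback φ β y = gcomp (β (φ y)) (fderiv ℝ φ y) := by
  rw [pullback_eq_gcomp, mfderiv_eq_fderiv]

theorem FlatForm.pullback {φ : E → E'} {β : E' → GForm E'} {U : Set E} {V : Set E'}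
    (hβ : FlatForm V β) (hφ : ContDiffOn ℝ ∞ φ U) (hU : IsOpen U) (hm : MapsTo φ U V) :
    FlatForm U (pullback φ β) := by
  intro k
  have h := contDiffOn_compContinuousLinearMap ((hβ k).comp hφ hm)
    (hφ.fderiv_of_isOpen (m := ∞) hU (by simp))
  exact h.congr fun y _ => congrFun (pullback_flat φ β y) k

theorem flatD_pullback {φ : E → E'} {β : E' → GForm E'} {y : E} (hφ : ContDiffAt ℝ ∞ φ y)
    (hβ : ∀ k, DifferentiableAt ℝ (fun z => β z k) (φ y)) :
    flatD (pullback φ β) y = pullback φ (flatD β) y := by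
  funext k
  rw [pullback_flat]
  cases k with
  | zero => rfl
  | succ k =>
    have h : (fun z => pullback φ β z k) =
        fun z => (β (φ z) k).compContinuousLinearMap (fderiv ℝ φ z) :=
      funext fun z => congrFun (pullback_flat φ β z) k
    change extDeriv (fun z => pullback φ β z k) y = _
    rw [h]
    exact extDeriv_pullback (hβ k) hφ
      (by rw [minSmoothness_of_isRCLikeNormedField]; exact WithTop.coe_le_coe.2 le_top)

variable [IsManifold 𝓘(ℝ, E) ∞ X] [IsManifold 𝓘(ℝ, E') ∞ Y] [IsManifold 𝓘(ℝ, E'') ∞ Z]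

theorem mdifferentiableAt_chart {c p : X} (hp : p ∈ (chartAt E c).source) :
    MDifferentiableAt 𝓘(ℝ, E) 𝓘(ℝ, E) (chartAt E c) p :=
  mdifferentiableAt_atlas (chart_mem_atlas E c) hp

theorem mdifferentiableAt_chart_symm {c : X} {y : E} (hy : y ∈ (chartAt E c).target) :
    MDifferentiableAt 𝓘(ℝ, E) 𝓘(ℝ, E) (chartAt E c).symm y :=
  mdifferentiableAt_atlas_symm (chart_mem_atlas E c) hy

/-- The tangent space at p is identified with the model space through this very chart. Hence the
value of a form at p and its coordinate expression there agree without any correction. -/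
theorem mfderiv_chart_self (p : X) :
    mfderiv 𝓘(ℝ, E) 𝓘(ℝ, E) (chartAt E p) p = ContinuousLinearMap.id ℝ E := by
  rw [mfderiv_chartAt_eq_tangentCoordChange (mem_chart_source E p)]
  ext v
  exact tangentCoordChange_self (mem_extChartAt_source p)

theorem pullback_chart_inChart {c p : X} (hp : p ∈ (chartAt E c).source) (α : X → GForm E) :
    pullback (chartAt E c) (inChart α c) p = α p := by
  rw [inChart, ← pullback_comp (mdifferentiableAt_chart_symm ((chartAt E c).map_source hp))
    (mdifferentiableAt_chart hp)]
  have h : (chartAt E c).symm ∘ chartAt E c =ᶠ[𝓝 p] id := by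
    filter_upwards [(chartAt E c).open_source.mem_nhds hp] with q hq
    exact (chartAt E c).left_inv hq
  rw [pullback_congr h, pullback_id]

theorem inChart_self (α : X → GForm E) (p : X) : inChart α p (chartAt E p p) = α p := by
  have h := pullback_chart_inChart (mem_chart_source E p) α
  rw [pullback_eq_gcomp, mfderiv_chart_self] at h
  exact h

/-- The expression of the map `f` in the charts at `c` and `c'`. -/
def localMap (E E' : Type*) [NormedAddCommGroup E] [NormedSpace ℝ E] [NormedAddCommGroup E']
    [NormedSpace ℝ E'] {X Y : Type*} [TopologicalSpace X] [ChartedSpace E X] [TopologicalSpace Y]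
    [ChartedSpace E' Y] (f : X → Y) (c : X) (c' : Y) : E → E' :=
  fun y => chartAt E' c' (f ((chartAt E c).symm y))

/-- The domain of the expression of `f` in the charts at `c` and `c'`. -/
def localDomain (E E' : Type*) [NormedAddCommGroup E] [NormedSpace ℝ E] [NormedAddCommGroup E']
    [NormedSpace ℝ E'] {X Y : Type*} [TopologicalSpace X] [ChartedSpace E X] [TopologicalSpace Y]
    [ChartedSpace E' Y] (f : X → Y) (c : X) (c' : Y) : Set E :=
  (chartAt E c).target ∩ (chartAt E c).symm ⁻¹' (f ⁻¹' (chartAt E' c').source)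

theorem isOpen_localDomain {f : X → Y} (hf : Continuous f) (c : X) (c' : Y) :
    IsOpen (localDomain E E' f c c') :=
  (chartAt E c).isOpen_inter_preimage_symm ((chartAt E' c').open_source.preimage hf)

theorem contDiffOn_localMap {f : X → Y} (hf : ContMDiff 𝓘(ℝ, E) 𝓘(ℝ, E') ∞ f) (c : X) (c' : Y) :
    ContDiffOn ℝ ∞ (localMap E E' f c c') (localDomain E E' f c c') := by
  refine ContMDiffOn.contDiffOn ?_
  have h1 : ContMDiffOn 𝓘(ℝ, E) 𝓘(ℝ, E') ∞ (f ∘ (chartAt E c).symm) (localDomain E E' f c c') :=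
    hf.comp_contMDiffOn (contMDiffOn_chart_symm.mono inter_subset_left)
  exact (contMDiffOn_chart (I := 𝓘(ℝ, E')) (x := c')).comp h1 fun y hy => hy.2

theorem inChart_pullback {f : X → Y} (hf : ContMDiff 𝓘(ℝ, E) 𝓘(ℝ, E') ∞ f) {c : X} {c' : Y}
    {y : E} (hy : y ∈ localDomain E E' f c c') (α : Y → GForm E') :
    inChart (pullback (E := E) f α) c y = pullback (localMap E E' f c c') (inChart α c') y := by
  have hs := mdifferentiableAt_chart_symm hy.1
  have hf' : MDifferentiableAt 𝓘(ℝ, E) 𝓘(ℝ, E') f ((chartAt E c).symm y) :=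
    hf.mdifferentiableAt (by simp)
  have h0 : MDifferentiableAt 𝓘(ℝ, E) 𝓘(ℝ, E') (f ∘ (chartAt E c).symm) y := hf'.comp y hs
  have hy' : f ((chartAt E c).symm y) ∈ (chartAt E' c').source := hy.2
  have h1 : pullback (localMap E E' f c c') (inChart α c') y =
      pullback (f ∘ (chartAt E c).symm) (pullback (chartAt E' c') (inChart α c')) y :=
    pullback_comp (f := f ∘ (chartAt E c).symm) (mdifferentiableAt_chart hy') h0 _
  rw [h1, inChart, ← pullback_comp hf' hs]
  exact pullback_congr_form (pullback_chart_inChart hy' α).symm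

/-- Chain rule; the chart on the target is the preferred one at the image point, so its differential
is the identity. -/
theorem mfderiv_localMap_self {f : X → Y} (hf : ContMDiff 𝓘(ℝ, E) 𝓘(ℝ, E') ∞ f) {c : X} {y : E}
    (hy : y ∈ (chartAt E c).target) :
    (mfderiv 𝓘(ℝ, E) 𝓘(ℝ, E') (localMap E E' f c (f ((chartAt E c).symm y))) y : E →L[ℝ] E') =
      (mfderiv 𝓘(ℝ, E) 𝓘(ℝ, E') f ((chartAt E c).symm y) : E →L[ℝ] E').comp
        (mfderiv 𝓘(ℝ, E) 𝓘(ℝ, E) (chartAt E c).symm y : E →L[ℝ] E) := by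
  have hs := mdifferentiableAt_chart_symm hy
  have hf' : MDifferentiableAt 𝓘(ℝ, E) 𝓘(ℝ, E') f ((chartAt E c).symm y) :=
    hf.mdifferentiableAt (by simp)
  have h1 := mfderiv_comp (I := 𝓘(ℝ, E)) (I' := 𝓘(ℝ, E')) (I'' := 𝓘(ℝ, E')) y
    (f := f ∘ (chartAt E c).symm)
    (mdifferentiableAt_chart (mem_chart_source E' (f ((chartAt E c).symm y)))) (hf'.comp y hs)
  refine h1.trans ?_
  rw [mfderiv_comp y hf' hs]
  exact congrArg (fun A : E' →L[ℝ] E' => A.comp _) (mfderiv_chart_self (f ((chartAt E c).symm y)))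

theorem IsSmoothForm.flatForm {α : X → GForm E} (hα : IsSmoothForm α) (c : X) :
    FlatForm (chartAt E c).target (inChart α c) := hα c

/-- The exterior derivative commutes with pullbacks, seen in a chart. -/
theorem inChart_pullback_extD {f : X → Y} (hf : ContMDiff 𝓘(ℝ, E) 𝓘(ℝ, E') ∞ f)
    {α : Y → GForm E'} (hα : IsSmoothForm α) {c : X} {y : E} (hy : y ∈ (chartAt E c).target) :
    inChart (pullback (E := E) f (extD α)) c y = flatD (inChart (pullback (E := E) f α) c) y := by
  -- In the target the chart at the image point itself is chosen, as this is the chart defining the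
  -- exterior derivative there.
  set p := f ((chartAt E c).symm y) with hp
  have hyd : y ∈ localDomain E E' f c p := ⟨hy, mem_chart_source E' p⟩
  have hopen := isOpen_localDomain (E := E) (E' := E') hf.continuous c p
  have h1 : inChart (pullback (E := E) f α) c =ᶠ[𝓝 y]
      pullback (localMap E E' f c p) (inChart α p) := by
    filter_upwards [hopen.mem_nhds hyd] with z hz
    exact inChart_pullback hf hz α
  have hs := mdifferentiableAt_chart_symm hy
  have hf' : MDifferentiableAt 𝓘(ℝ, E) 𝓘(ℝ, E') f ((chartAt E c).symm y) :=
    hf.mdifferentiableAt (by simp)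
  rw [flatD_congr h1, flatD_pullback ((contDiffOn_localMap hf c p).contDiffAt (hopen.mem_nhds hyd))
    ((hα.flatForm p).differentiableAt (chartAt E' p).open_target (mem_chart_target E' p)),
    inChart, ← pullback_comp hf' hs, pullback_eq_gcomp, pullback_eq_gcomp, mfderiv_comp y hf' hs]
  exact congrArg (gcomp (extD α p)) (mfderiv_localMap_self hf hy).symm

/-- The case of the identity map: although the derivative is defined at each point with the chart of
that point, it can be computed throughout one fixed chart. -/
theorem inChart_extD {α : X → GForm E} (hα : IsSmoothForm α) {c : X} {y : E}
    (hy : y ∈ (chartAt E c).target) : inChart (extD α) c y = flatD (inChart α c) y := by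
  have h := inChart_pullback_extD contMDiff_id hα hy
  rwa [pullback_id, pullback_id] at h

theorem extD_pullback {f : X → Y} (hf : ContMDiff 𝓘(ℝ, E) 𝓘(ℝ, E') ∞ f)
    {α : Y → GForm E'} (hα : IsSmoothForm α) :
    extD (pullback (E := E) f α) = pullback f (extD α) := by
  funext p
  rw [← inChart_self (pullback f (extD α)) p, inChart_pullback_extD hf hα (mem_chart_target E p)]
  rfl

/-- Smoothness is checked near each y, using on the target the chart at the image of y. -/
theorem IsSmoothForm.pullback {f : X → Y} (hf : ContMDiff 𝓘(ℝ, E) 𝓘(ℝ, E') ∞ f)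
    {α : Y → GForm E'} (hα : IsSmoothForm α) : IsSmoothForm (pullback (E := E) f α) := by
  intro c k y hy
  set p := f ((chartAt E c).symm y)
  have hyd : y ∈ localDomain E E' f c p := ⟨hy, mem_chart_source E' p⟩
  have hopen := isOpen_localDomain (E := E) (E' := E') hf.continuous c p
  have h := (hα.flatForm p).pullback (contDiffOn_localMap hf c p) hopen
    fun z hz => (chartAt E' p).map_source hz.2
  have h1 := (h k).congr fun z hz => congrFun (inChart_pullback hf hz α) k
  exact (h1.contDiffAt (hopen.mem_nhds hyd)).contDiffWithinAt

theorem extD_congr {α β : X → GForm E} {p : X} (h : α =ᶠ[𝓝 p] β) : extD α p = extD β p := by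
  refine flatD_congr ?_
  have h1 := (chartAt E p).continuousAt_symm (mem_chart_target E p)
  rw [ContinuousAt, (chartAt E p).left_inv (mem_chart_source E p)] at h1
  filter_upwards [h1.eventually h] with y hy
  exact pullback_congr_form hy

end Charts

/-! ### Matrix-valued forms on a manifold. -/

section MForms

variable {E : Type*} [NormedAddCommGroup E] [NormedSpace ℝ E]
  {X : Type*} [TopologicalSpace X] [ChartedSpace E X]
  {E' : Type*} [NormedAddCommGroup E'] [NormedSpace ℝ E']
  {Y : Type*} [TopologicalSpace Y] [ChartedSpace E' Y]

theorem isSmoothMForm_iff {α : MForm E X} : IsSmoothMForm α ↔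
    ∀ c, FlatSmooth (chartAt E c).target fun i j => inChart (α i j) c := Iff.rfl

theorem IsSmoothMForm.isSmoothForm {α : MForm E X} (hα : IsSmoothMForm α) (i j : ℤ) :
    IsSmoothForm (α i j) :=
  fun c => (isSmoothMForm_iff.1 hα c).flatForm i j

/-- The matrix of forms whose degree `k` component is multiplied by `(-1) ^ k`. -/
def signM (α : MForm E X) : MForm E X := fun i j p => signDeg (α i j p)

variable [IsManifold 𝓘(ℝ, E) ∞ X] [IsManifold 𝓘(ℝ, E') ∞ Y]

theorem IsSmoothMForm.decay {α : MForm E X} (hα : IsSmoothMForm α) (p : X) :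
    Decay fun i j => α i j p := by
  have h := (isSmoothMForm_iff.1 hα p).decay (mem_chart_target E p)
  simpa only [inChart_self] using h

theorem pullback_mulM {f : X → Y} {α β : MForm E' Y} (hα : IsSmoothMForm α)
    (hβ : IsSmoothMForm β) (i j : ℤ) : pullback (E := E) f (mulM α β i j) =
      mulM (fun i j => pullback f (α i j)) (fun i j => pullback f (β i j)) i j := by
  funext p
  exact mulP_gcomp (hα.decay (f p)) (hβ.decay (f p)) _ i j

theorem inChart_mulM {α β : MForm E X} (hα : IsSmoothMForm α)
    (hβ : IsSmoothMForm β) (c : X) (i j : ℤ) : inChart (mulM α β i j) c =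
      fun y => mulP (fun i j => inChart (α i j) c y) (fun i j => inChart (β i j) c y) i j :=
  pullback_mulM hα hβ i j

theorem IsSmoothMForm.mulM {α β : MForm E X} (hα : IsSmoothMForm α) (hβ : IsSmoothMForm β) :
    IsSmoothMForm (mulM α β) := by
  rw [isSmoothMForm_iff]
  intro c
  simp only [inChart_mulM hα hβ]
  exact (isSmoothMForm_iff.1 hα c).mulP (isSmoothMForm_iff.1 hβ c)

theorem FlatSmooth.congr {U : Set E} {a b : ℤ → ℤ → E → GForm E} (ha : FlatSmooth U a)
    (h : ∀ i j, ∀ y ∈ U, b i j y = a i j y) : FlatSmooth U b := by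
  intro k N
  obtain ⟨F, hF, hF'⟩ := ha k N
  exact ⟨F, hF, fun y hy i j => by rw [hF' y hy, h i j y hy]⟩

theorem IsSmoothMForm.dM {α : MForm E X} (hα : IsSmoothMForm α) : IsSmoothMForm (dM α) :=
  fun c => ((isSmoothMForm_iff.1 hα c).flatD (chartAt E c).open_target).congr
    fun i j _ hy => inChart_extD (hα.isSmoothForm i j) hy

theorem IsSmoothForm.extD {α : X → GForm E} (hα : IsSmoothForm α) : IsSmoothForm (extD α) :=
  fun c k => ((FlatForm.flatD (hα.flatForm c) (chartAt E c).open_target) k).congr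
    fun _ hy => congrFun (inChart_extD hα hy) k

theorem extD_extD {α : X → GForm E} (hα : IsSmoothForm α) :
    ClosedTrace.extD (ClosedTrace.extD α) = 0 := by
  funext p
  have h : inChart (ClosedTrace.extD α) p =ᶠ[𝓝 (chartAt E p p)] flatD (inChart α p) := by
    filter_upwards [(chartAt E p).open_target.mem_nhds (mem_chart_target E p)] with y hy
    exact inChart_extD hα hy
  exact (flatD_congr h).trans
    (flatD_flatD (hα.flatForm p) (chartAt E p).open_target (mem_chart_target E p))

theorem extD_add {α β : X → GForm E} (hα : IsSmoothForm α) (hβ : IsSmoothForm β) :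
    ClosedTrace.extD (α + β) = ClosedTrace.extD α + ClosedTrace.extD β := by
  funext p
  have h : inChart (α + β) p = fun y => inChart α p y + inChart β p y := pullback_add _ α β
  have ho := (chartAt E p).open_target
  have hp := mem_chart_target E p
  exact (congrArg (fun a => flatD a (chartAt E p p)) h).trans
    (flatD_add ((hα.flatForm p).differentiableAt ho hp) ((hβ.flatForm p).differentiableAt ho hp))

theorem extD_smul (z : ℂ) {α : X → GForm E} (hα : IsSmoothForm α) :
    ClosedTrace.extD (z • α) = z • ClosedTrace.extD α := by
  funext p
  have h : inChart (z • α) p = fun y => z • inChart α p y := pullback_smul _ z α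
  exact (congrArg (fun a => flatD a (chartAt E p p)) h).trans
    (flatD_smul z ((hα.flatForm p).differentiableAt (chartAt E p).open_target
      (mem_chart_target E p)))

theorem IsSmoothForm.gwedge {α β : X → GForm E} (hα : IsSmoothForm α) (hβ : IsSmoothForm β) :
    IsSmoothForm fun p => gwedge (α p) (β p) := by
  intro c k
  have h := FlatForm.gwedge (hα.flatForm c) (hβ.flatForm c) k
  exact h.congr fun y _ => congrFun (gwedge_gcomp _ _ _) k

theorem extD_gwedge {α β : X → GForm E} (hα : IsSmoothForm α) (hβ : IsSmoothForm β) :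
    (ClosedTrace.extD fun p => ClosedTrace.gwedge (α p) (β p)) = fun p =>
      ClosedTrace.gwedge (ClosedTrace.extD α p) (β p) +
        ClosedTrace.gwedge (signDeg (α p)) (ClosedTrace.extD β p) := by
  funext p
  have h : inChart (fun p => ClosedTrace.gwedge (α p) (β p)) p =
      fun y => ClosedTrace.gwedge (inChart α p y) (inChart β p y) :=
    funext fun y => gwedge_gcomp _ _ _
  refine (congrArg (fun a => flatD a (chartAt E p p)) h).trans ?_
  rw [flatD_gwedge (hα.flatForm p) (hβ.flatForm p) (chartAt E p).open_target
    (mem_chart_target E p), inChart_self, inChart_self]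
  rfl

/-- At p the identity is the flat Leibniz rule in the chart at p, where forms coincide with their
coordinate expressions. -/
theorem dM_mulM {α β : MForm E X} (hα : IsSmoothMForm α) (hβ : IsSmoothMForm β) :
    ClosedTrace.dM (ClosedTrace.mulM α β) =
      ClosedTrace.mulM (ClosedTrace.dM α) β + ClosedTrace.mulM (signM α) (ClosedTrace.dM β) := by
  funext i j p
  refine (congrArg (fun a => flatD a (chartAt E p p)) (inChart_mulM hα hβ p i j)).trans ?_
  rw [flatD_mulP (isSmoothMForm_iff.1 hα p) (isSmoothMForm_iff.1 hβ p) (chartAt E p).open_target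
    (mem_chart_target E p)]
  simp only [inChart_self]
  rfl

theorem dM_dM {α : MForm E X} (hα : IsSmoothMForm α) :
    ClosedTrace.dM (ClosedTrace.dM α) = 0 :=
  funext fun i => funext fun j => extD_extD (hα.isSmoothForm i j)

theorem mulM_assoc {α β γ : MForm E X} (hα : IsSmoothMForm α) (hβ : IsSmoothMForm β)
    (hγ : IsSmoothMForm γ) : ClosedTrace.mulM (ClosedTrace.mulM α β) γ =
      ClosedTrace.mulM α (ClosedTrace.mulM β γ) := by
  funext i j p
  exact congrFun (congrFun (mulP_assoc (hα.decay p) (hβ.decay p) (hγ.decay p)) i) j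

theorem mulM_add_left {α β γ : MForm E X} (hα : IsSmoothMForm α) (hβ : IsSmoothMForm β)
    (hγ : IsSmoothMForm γ) : ClosedTrace.mulM (α + β) γ =
      ClosedTrace.mulM α γ + ClosedTrace.mulM β γ := by
  funext i j p
  exact congrFun (congrFun (mulP_add_left (hα.decay p) (hβ.decay p) (hγ.decay p)) i) j

theorem mulM_add_right {α β γ : MForm E X} (hα : IsSmoothMForm α) (hβ : IsSmoothMForm β)
    (hγ : IsSmoothMForm γ) : ClosedTrace.mulM α (β + γ) =
      ClosedTrace.mulM α β + ClosedTrace.mulM α γ := by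
  funext i j p
  exact congrFun (congrFun (mulP_add_right (hα.decay p) (hβ.decay p) (hγ.decay p)) i) j

theorem mulM_smul_left (z : ℂ) {α β : MForm E X} (hα : IsSmoothMForm α) (hβ : IsSmoothMForm β) :
    ClosedTrace.mulM (z • α) β = z • ClosedTrace.mulM α β := by
  funext i j p
  exact congrFun (congrFun (mulP_smul_left z (hα.decay p) (hβ.decay p)) i) j

theorem mulM_smul_right (z : ℂ) {α β : MForm E X} (hα : IsSmoothMForm α) (hβ : IsSmoothMForm β) :
    ClosedTrace.mulM α (z • β) = z • ClosedTrace.mulM α β := by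
  funext i j p
  exact congrFun (congrFun (mulP_smul_right z (hα.decay p) (hβ.decay p)) i) j

theorem ofFun_oneF_mulM (α : MForm E X) : ClosedTrace.mulM (ofFun oneF) α = α := by
  funext i j p
  exact congrFun (congrFun (one_mulP fun i j => α i j p) i) j

theorem mulM_ofFun_oneF (α : MForm E X) : ClosedTrace.mulM α (ofFun oneF) = α := by
  funext i j p
  exact congrFun (congrFun (mulP_one fun i j => α i j p) i) j

end MForms

/-! ### Sign of the Jacobian of a projectivized linear map. -/

section Determinants

variable {n : ℕ}

/-- A determinant identity behind the orientation of affine charts of a projective space: `C` is the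
differential of the projectivization of the linear map with matrix `B`. -/
theorem projective_det (a a' : Fin (n + 1)) (ε ε' : ℤˣ) (w F : Fin n → ℝ)
    (B : Matrix (Fin (n + 1)) (Fin (n + 1)) ℝ) (C : Matrix (Fin n) (Fin n) ℝ) (l : ℝ)
    (μ : Fin n → ℝ)
    (h0 : ∀ b, (a'.insertNth ((ε' : ℤ) : ℝ) F : Fin (n + 1) → ℝ) b =
      l * ∑ d, (a.insertNth ((ε : ℤ) : ℝ) w : Fin (n + 1) → ℝ) d * B d b)
    (h1 : ∀ j b, (a'.insertNth 0 (C j) : Fin (n + 1) → ℝ) b = l * B (a.succAbove j) b +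
      μ j * ∑ d, (a.insertNth ((ε : ℤ) : ℝ) w : Fin (n + 1) → ℝ) d * B d b) :
    (((ε' * (-1) ^ (a' : ℕ) : ℤˣ) : ℤ) : ℝ) * C.det =
      l ^ (n + 1) * (((ε * (-1) ^ (a : ℕ) : ℤˣ) : ℤ) : ℝ) * B.det := by
  -- K is the frame formed by the radial vector and the coordinate vectors of the source chart, and
  -- M is its counterpart for the target chart. R records the rescaling by l and the multiples of
  -- the radial vector coming from normalization, so that M = R K B; the determinants of K and M
  -- carry the two chart signs.
  set K : Matrix (Fin (n + 1)) (Fin (n + 1)) ℝ :=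
    Matrix.of (Fin.cons (a.insertNth ((ε : ℤ) : ℝ) w)
      fun b => Pi.single (a.succAbove b) 1 : Fin (n + 1) → Fin (n + 1) → ℝ) with hK
  set R : Matrix (Fin (n + 1)) (Fin (n + 1)) ℝ :=
    Matrix.of (Fin.cons (Pi.single 0 l)
      fun j => Fin.cons (μ j) (Pi.single j l) : Fin (n + 1) → Fin (n + 1) → ℝ) with hR
  set M : Matrix (Fin (n + 1)) (Fin (n + 1)) ℝ :=
    Matrix.of (Fin.cons (a'.insertNth ((ε' : ℤ) : ℝ) F)
      fun j => a'.insertNth 0 (C j) : Fin (n + 1) → Fin (n + 1) → ℝ) with hM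
  have hRdet : R.det = l ^ (n + 1) := by
    rw [Matrix.det_of_isLowerTriangular]
    · rw [Fin.prod_univ_succ]
      simp [hR, pow_succ']
    · intro i j h
      have hij : i < j := h
      clear h
      revert hij
      refine Fin.cases (fun hij => ?_) (fun i hij => ?_) i
      · have : j ≠ 0 := fun h => by simp [h] at hij
        simp [hR, this]
      · revert hij
        refine Fin.cases (fun hij => ?_) (fun j hij => ?_) j
        · exact absurd hij (by simp)
        · have : j ≠ i := fun h => by simp [h] at hij
          simp [hR, this]
  have hMdet : M.det = (((ε' * (-1) ^ (a' : ℕ) : ℤˣ) : ℤ) : ℝ) * C.det := by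
    -- Column a' of M vanishes below the first row: the component with index a' is normalized to the
    -- constant ε', so it does not vary.
    rw [Matrix.det_succ_column M a', Fin.sum_univ_succ, Finset.sum_eq_zero, add_zero]
    · have h2 : M.submatrix (Fin.succAbove 0) a'.succAbove = C := by
        ext i j
        simp [hM]
      rw [h2]
      simp [hM]
      exact Or.inl (mul_comm _ _)
    · intro i _
      simp [hM]
  have hprod : M = R * (K * B) := by
    have hKB0 : ∀ b, (K * B) 0 b =
        ∑ d, (a.insertNth ((ε : ℤ) : ℝ) w : Fin (n + 1) → ℝ) d * B d b := fun b => rfl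
    have hKBs : ∀ j b, (K * B) (Fin.succ j) b = B (a.succAbove j) b := fun j b => by
      rw [Matrix.mul_apply]
      simp [hK, Pi.single_apply]
    ext i b
    rw [Matrix.mul_apply, Fin.sum_univ_succ, hKB0]
    simp only [hKBs]
    refine Fin.cases ?_ (fun j => ?_) i
    · simp only [hM, hR, Matrix.of_apply, Fin.cons_zero]
      rw [h0]
      simp
    · simp only [hM, hR, Matrix.of_apply, Fin.cons_succ, Fin.cons_zero]
      rw [h1]
      simp [Pi.single_apply, add_comm]
  rw [← hMdet, hprod, Matrix.det_mul, Matrix.det_mul, hRdet, hK, orientation_eq_det, mul_assoc]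

theorem det_blockTriangular {V W : Type*} [NormedAddCommGroup V] [NormedSpace ℝ V]
    [FiniteDimensional ℝ V] [NormedAddCommGroup W] [NormedSpace ℝ W] [FiniteDimensional ℝ W]
    (L : V × W →L[ℝ] V × W) (A : V →L[ℝ] V) (C : W →ₗ[ℝ] W) (h1 : ∀ v u, (L (v, u)).1 = A v)
    (h2 : ∀ u, (L (0, u)).2 = C u) : L.det = A.det * LinearMap.det C := by
  set b := Module.finBasis ℝ V
  set b' := Module.finBasis ℝ W
  have h : LinearMap.toMatrix (b.prod b') (b.prod b') (L : V × W →ₗ[ℝ] V × W) =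
      Matrix.fromBlocks (LinearMap.toMatrix b b (A : V →ₗ[ℝ] V)) 0
        (Matrix.of fun i j => b'.repr (L (b j, 0)).2 i) (LinearMap.toMatrix b' b' C) := by
    ext i j
    rcases i with i | i <;> rcases j with j | j <;>
      simp [LinearMap.toMatrix_apply, h1, h2]
  rw [ContinuousLinearMap.det, ← LinearMap.det_toMatrix (b.prod b'), h,
    Matrix.det_fromBlocks_zero₁₂, LinearMap.det_toMatrix, LinearMap.det_toMatrix]

theorem insertNth_add_single (a : Fin (n + 1)) (ε : ℝ) (w : Fin n → ℝ) (t : ℝ) (j : Fin n)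
    (d : Fin (n + 1)) : (a.insertNth ε (w + t • Pi.single j 1) : Fin (n + 1) → ℝ) d =
      (a.insertNth ε w : Fin (n + 1) → ℝ) d + t * Pi.single (M := fun _ => ℝ) (a.succAbove j) 1 d := by
  refine Fin.succAboveCases a ?_ (fun b => ?_) d
  · simp
  · simp [Pi.single_apply]

/-- The homogeneous coordinates of the image of the covector with affine coordinates `w`. -/
def projCoord (a : Fin (n + 1)) (ε : ℤˣ) (B : Coord (n + 1) → Coord (n + 1) →L[ℝ] Coord (n + 1))
    (b : Fin (n + 1)) (q : SCoord n) : ℝ :=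
  ∑ d, (a.insertNth ((ε : ℤ) : ℝ) q.2 : Fin (n + 1) → ℝ) d *
    (B q.1 (EuclideanSpace.single b 1)) d

/-- The map covering `φ`, given on covectors by the transposes of `B`, in affine coordinates. -/
def projMap (a : Fin (n + 1)) (ε : ℤˣ) (a' : Fin (n + 1)) (ε' : ℤˣ)
    (φ : Coord (n + 1) → Coord (n + 1))
    (B : Coord (n + 1) → Coord (n + 1) →L[ℝ] Coord (n + 1)) (q : SCoord n) : SCoord n :=
  (φ q.1, fun b => projCoord a ε B (a'.succAbove b) q / (((ε' : ℤ) : ℝ) * projCoord a ε B a' q))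

theorem contDiffOn_projCoord (a : Fin (n + 1)) (ε : ℤˣ)
    {B : Coord (n + 1) → Coord (n + 1) →L[ℝ] Coord (n + 1)} {U : Set (Coord (n + 1))}
    (hB : ContDiffOn ℝ ∞ B U) (b : Fin (n + 1)) :
    ContDiffOn ℝ ∞ (projCoord a ε B b) (U ×ˢ univ) := by
  unfold projCoord
  refine ContDiffOn.sum fun d _ => ContDiffOn.mul ?_ ?_
  · refine ContDiff.contDiffOn ?_
    refine Fin.succAboveCases a ?_ (fun b => ?_) d
    · simp only [Fin.insertNth_apply_same]; exact contDiff_const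
    · simp only [Fin.insertNth_apply_succAbove]
      exact (contDiff_apply ℝ ℝ b).comp contDiff_snd
  · have h : ContDiffOn ℝ ∞ (fun q : SCoord n => B q.1) (U ×ˢ univ) :=
      hB.comp contDiff_fst.contDiffOn fun q hq => hq.1
    exact (EuclideanSpace.proj d : Coord (n + 1) →L[ℝ] ℝ).contDiff.comp_contDiffOn
      (h.clm_apply contDiffOn_const)

theorem contDiffOn_projMap (a : Fin (n + 1)) (ε : ℤˣ) (a' : Fin (n + 1)) (ε' : ℤˣ)
    {φ : Coord (n + 1) → Coord (n + 1)}
    {B : Coord (n + 1) → Coord (n + 1) →L[ℝ] Coord (n + 1)} {U : Set (Coord (n + 1))}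
    (hφ : ContDiffOn ℝ ∞ φ U) (hB : ContDiffOn ℝ ∞ B U) :
    ContDiffOn ℝ ∞ (projMap a ε a' ε' φ B)
      (U ×ˢ univ ∩ {q | 0 < ((ε' : ℤ) : ℝ) * projCoord a ε B a' q}) := by
  refine ContDiffOn.prodMk ?_ (contDiffOn_pi.2 fun b => ContDiffOn.div ?_ ?_ ?_)
  · exact hφ.comp contDiff_fst.contDiffOn fun q hq => hq.1.1
  · exact (contDiffOn_projCoord a ε hB _).mono inter_subset_left
  · exact contDiffOn_const.mul ((contDiffOn_projCoord a ε hB _).mono inter_subset_left)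
  · intro q hq
    have h : 0 < ((ε' : ℤ) : ℝ) * projCoord a ε B a' q := hq.2
    exact h.ne'

/-- The first component of the map depends only on the base point, so the differential is block
triangular with diagonal blocks A, the differential of φ, and C, that of the projectivized covector
map. By `projective_det`, det C is the product of the two chart signs, a positive factor and det B.
As B inverts A, det B · det A = 1, so the sign of det A disappears. -/
theorem det_fderiv_projMap_pos {a a' : Fin (n + 1)} {ε ε' : ℤˣ}
    {φ : Coord (n + 1) → Coord (n + 1)}
    {B : Coord (n + 1) → Coord (n + 1) →L[ℝ] Coord (n + 1)} {q : SCoord n}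
    (hφ : DifferentiableAt ℝ φ q.1) (hd : DifferentiableAt ℝ (projMap a ε a' ε' φ B) q)
    (hpos : 0 < ((ε' : ℤ) : ℝ) * projCoord a ε B a' q)
    (hinv : (B q.1).comp (fderiv ℝ φ q.1) = ContinuousLinearMap.id ℝ _) :
    0 < (((ε * (-1) ^ (a : ℕ) : ℤˣ) : ℤ) : ℝ) * (((ε' * (-1) ^ (a' : ℕ) : ℤˣ) : ℤ) : ℝ) *
      (fderiv ℝ (projMap a ε a' ε' φ B) q).det := by
  obtain ⟨y, w⟩ := q
  set L := fderiv ℝ (projMap a ε a' ε' φ B) (y, w) with hL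
  set A := fderiv ℝ φ y with hA
  set z : Fin (n + 1) → ℝ := fun b => projCoord a ε B b (y, w) with hz
  set Bm : Matrix (Fin (n + 1)) (Fin (n + 1)) ℝ :=
    Matrix.of fun d b => (B y (EuclideanSpace.single b 1)) d with hBm
  have h1 : ∀ v u, (L (v, u)).1 = A v := by
    intro v u
    have e1 := hd.hasFDerivAt.fst
    have e2 : HasFDerivAt (fun q : SCoord n => φ q.1)
        (A.comp (ContinuousLinearMap.fst ℝ _ _)) (y, w) :=
      HasFDerivAt.comp (y, w) hφ.hasFDerivAt hasFDerivAt_fst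
    exact congrArg (fun T : SCoord n →L[ℝ] Coord (n + 1) => T (v, u)) (e1.unique e2)
  set C : (Fin n → ℝ) →ₗ[ℝ] (Fin n → ℝ) :=
    ((ContinuousLinearMap.snd ℝ _ _ ∘L L ∘L ContinuousLinearMap.inr ℝ _ _ :
      (Fin n → ℝ) →L[ℝ] (Fin n → ℝ)) : (Fin n → ℝ) →ₗ[ℝ] (Fin n → ℝ)) with hC
  have hdet : L.det = A.det * LinearMap.det C := det_blockTriangular L A C h1 fun u => rfl
  set Cm : Matrix (Fin n) (Fin n) ℝ := Matrix.of fun j b => C (Pi.single j 1) b with hCm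
  have hCdet : LinearMap.det C = Cm.det := by
    rw [← LinearMap.det_toMatrix', ← Matrix.det_transpose]
    congr 1
  have hAB : Bm.det * A.det = 1 := by
    have e1 : Bm.det = LinearMap.det (B y : Coord (n + 1) →ₗ[ℝ] Coord (n + 1)) := by
      rw [← LinearMap.det_toMatrix (EuclideanSpace.basisFun (Fin (n + 1)) ℝ).toBasis]
      congr 1
    have e2 : (B y : Coord (n + 1) →ₗ[ℝ] Coord (n + 1)) ∘ₗ (A : Coord (n + 1) →ₗ[ℝ] _) =
        LinearMap.id := LinearMap.ext fun v => congrArg (fun T : Coord (n + 1) →L[ℝ] Coord (n + 1) => T v) hinv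
    rw [e1, ContinuousLinearMap.det, ← LinearMap.det_comp, e2, LinearMap.det_id]
  have hε := sgn_mul_self ε'
  have hε0 := sgn_ne_zero ε'
  have hz0 : z a' ≠ 0 := fun h => hpos.ne' (by
    change _ * z a' = 0
    rw [h, mul_zero])
  have hzt : ∀ (t : ℝ) (j : Fin n) (b : Fin (n + 1)),
      projCoord a ε B b (y, w + t • Pi.single j 1) = z b + t * Bm (a.succAbove j) b := by
    intro t j b
    simp only [projCoord, insertNth_add_single, add_mul, Finset.sum_add_distrib, hz, mul_assoc,
      ← Finset.mul_sum]
    congr 2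
    rw [Finset.sum_eq_single (a.succAbove j)]
    · simp [hBm]
    · intro d _ hd
      simp [hd]
    · simp
  -- Along a coordinate line of the fibre the homogeneous coordinates are affine functions of t; the
  -- quotient rule at t = 0 gives the entries of the fibre block.
  have hCj : ∀ j b, Cm j b = (Bm (a.succAbove j) (a'.succAbove b) * (((ε' : ℤ) : ℝ) * z a') -
      z (a'.succAbove b) * (((ε' : ℤ) : ℝ) * Bm (a.succAbove j) a')) /
        (((ε' : ℤ) : ℝ) * z a') ^ 2 := by
    intro j b
    have hline : HasDerivAt (fun t : ℝ => ((y, w + t • Pi.single j 1) : SCoord n))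
        (0, Pi.single j 1) 0 := by
      refine HasDerivAt.prodMk (hasDerivAt_const _ _) ?_
      simpa using ((hasDerivAt_id (0 : ℝ)).smul_const (Pi.single j 1 : Fin n → ℝ)).const_add w
    have hd' : HasFDerivAt (projMap a ε a' ε' φ B) L
        ((fun t : ℝ => ((y, w + t • Pi.single j 1) : SCoord n)) 0) := by
      simpa using hd.hasFDerivAt
    have e1 := (hasDerivAt_pi.1 ((hasFDerivAt_snd (𝕜 := ℝ)).comp_hasDerivAt 0
      (hd'.comp_hasDerivAt 0 hline))) b
    have e2 : ∀ b, HasDerivAt (fun t : ℝ => z b + t * Bm (a.succAbove j) b)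
        (Bm (a.succAbove j) b) 0 := fun b => by
      simpa using ((hasDerivAt_id (0 : ℝ)).mul_const (Bm (a.succAbove j) b)).const_add (z b)
    have e3 := (e2 (a'.succAbove b)).div ((e2 a').const_mul ((ε' : ℤ) : ℝ))
      (by simpa using hz0)
    have e4 := e1.unique (e3.congr_of_eventuallyEq (Filter.Eventually.of_forall fun t => by
      simp only [Function.comp_def, projMap, hzt]
      rfl))
    rw [hCm]
    refine Eq.trans e4 ?_
    simp
  -- The scale l is the inverse of the positive normalizing denominator, and μ is the derivative of
  -- that inverse along the j-th fibre direction.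
  have key := projective_det a a' ε ε' w (projMap a ε a' ε' φ B (y, w)).2 Bm Cm
    ((((ε' : ℤ) : ℝ) * z a')⁻¹)
    (fun j => - (((ε' : ℤ) : ℝ) * Bm (a.succAbove j) a') / (((ε' : ℤ) : ℝ) * z a') ^ 2)
    (fun b => by
      change _ = _ * z b
      refine Fin.succAboveCases a' ?_ (fun b => ?_) b
      · rw [Fin.insertNth_apply_same]
        field_simp
        linear_combination hε
      · rw [Fin.insertNth_apply_succAbove, inv_mul_eq_div]
        rfl)
    (fun j b => by
      change _ = _ + _ * z b
      refine Fin.succAboveCases a' ?_ (fun b => ?_) b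
      · rw [Fin.insertNth_apply_same]
        field_simp
        ring
      · rw [Fin.insertNth_apply_succAbove, hCj]
        field_simp
        ring)
  rw [hdet, hCdet]
  have ho := sgn_mul_self (ε * (-1) ^ (a : ℕ))
  -- The quantity in question equals l^(n+1) exactly, since signs square to 1 and det B · det A = 1.
  calc 0 < ((((ε' : ℤ) : ℝ) * z a')⁻¹) ^ (n + 1) := by
        have : 0 < ((ε' : ℤ) : ℝ) * z a' := hpos
        positivity
    _ = _ := by
      linear_combination (-(((ε * (-1) ^ (a : ℕ) : ℤˣ) : ℤ) : ℝ) * A.det) * key -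
        ((((ε' : ℤ) : ℝ) * z a')⁻¹) ^ (n + 1) * Bm.det * A.det * ho -
        ((((ε' : ℤ) : ℝ) * z a')⁻¹) ^ (n + 1) * hAB

end Determinants

/-! ### Smoothness of ∂g and preservation of the canonical orientation. -/

section Codifferential

variable {n : ℕ} {M : Type*} [TopologicalSpace M] [ChartedSpace (Coord (n + 1)) M]
  [IsManifold (𝓡 (n + 1)) ∞ M] {h : Metric (n + 1) M}
  {g : M ≃ₘ^∞⟮𝓡 (n + 1), 𝓡 (n + 1)⟯ M}

/-- A chain rule for points that are only propositionally equal, stated with all differentials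
acting on the model space to avoid transport between tangent spaces. -/
theorem mfderiv_comp_apply_of_eq {f f' : M → M} {x y : M}
    (hf' : MDifferentiableAt (𝓡 (n + 1)) (𝓡 (n + 1)) f' y)
    (hf : MDifferentiableAt (𝓡 (n + 1)) (𝓡 (n + 1)) f x) (hy : f x = y) (v : Coord (n + 1)) :
    (mfderiv (𝓡 (n + 1)) (𝓡 (n + 1)) (f' ∘ f) x : Coord (n + 1) →L[ℝ] Coord (n + 1)) v =
      (mfderiv (𝓡 (n + 1)) (𝓡 (n + 1)) f' y : Coord (n + 1) →L[ℝ] Coord (n + 1))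
        ((mfderiv (𝓡 (n + 1)) (𝓡 (n + 1)) f x : Coord (n + 1) →L[ℝ] Coord (n + 1)) v) := by
  subst hy
  rw [mfderiv_comp x hf' hf]
  rfl

theorem mdifferentiableAt_diffeo (g : M ≃ₘ^∞⟮𝓡 (n + 1), 𝓡 (n + 1)⟯ M) (x : M) :
    MDifferentiableAt (𝓡 (n + 1)) (𝓡 (n + 1)) g x :=
  g.contMDiff.mdifferentiableAt (by simp)

theorem mfderiv_symm_apply (g : M ≃ₘ^∞⟮𝓡 (n + 1), 𝓡 (n + 1)⟯ M) (x : M) (v : Coord (n + 1)) :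
    (mfderiv (𝓡 (n + 1)) (𝓡 (n + 1)) g x : Coord (n + 1) →L[ℝ] Coord (n + 1))
      ((mfderiv (𝓡 (n + 1)) (𝓡 (n + 1)) g.symm (g x) : Coord (n + 1) →L[ℝ] Coord (n + 1)) v) =
        v := by
  rw [← mfderiv_comp_apply_of_eq (mdifferentiableAt_diffeo g x)
    (mdifferentiableAt_diffeo g.symm (g x)) (g.symm_apply_apply x)]
  have h1 : (g ∘ g.symm : M → M) = id := funext g.apply_symm_apply
  rw [h1, mfderiv_id]
  rfl

theorem mfderiv_apply_symm (g : M ≃ₘ^∞⟮𝓡 (n + 1), 𝓡 (n + 1)⟯ M) (x : M) (v : Coord (n + 1)) :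
    (mfderiv (𝓡 (n + 1)) (𝓡 (n + 1)) g.symm (g x) : Coord (n + 1) →L[ℝ] Coord (n + 1))
      ((mfderiv (𝓡 (n + 1)) (𝓡 (n + 1)) g x : Coord (n + 1) →L[ℝ] Coord (n + 1)) v) = v := by
  rw [← mfderiv_comp_apply_of_eq (mdifferentiableAt_diffeo g.symm (g x))
    (mdifferentiableAt_diffeo g x) rfl]
  have h1 : (g.symm ∘ g : M → M) = id := funext g.symm_apply_apply
  rw [h1, mfderiv_id]
  rfl

theorem diffEquiv_symm_apply (g : M ≃ₘ^∞⟮𝓡 (n + 1), 𝓡 (n + 1)⟯ M) (x : M) (v : Coord (n + 1)) :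
    ((diffEquiv g x).symm v : Coord (n + 1)) =
      (mfderiv (𝓡 (n + 1)) (𝓡 (n + 1)) g.symm (g x) : Coord (n + 1) →L[ℝ] Coord (n + 1)) v := by
  refine ((diffEquiv g x).symm_apply_eq).2 ?_
  exact (mfderiv_symm_apply g x v).symm

theorem codiff_cov (hg : IsIsometric h g) (p : Cosphere h) : (codiff hg p).cov = p.cov.comp
    (mfderiv (𝓡 (n + 1)) (𝓡 (n + 1)) g.symm (g p.base) : Coord (n + 1) →L[ℝ] Coord (n + 1)) :=
  ContinuousLinearMap.ext fun v => congrArg p.cov (diffEquiv_symm_apply g p.base v)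

theorem Cosphere.ext_cov {p q : Cosphere h} (hb : p.base = q.base) (hc : p.cov = q.cov) :
    p = q := by
  obtain ⟨x, ξ, hξ⟩ := p
  obtain ⟨x', ξ', hξ'⟩ := q
  obtain rfl : x = x' := hb
  obtain rfl : ξ = ξ' := hc
  rfl

theorem inner_congr {x x' : M} (hx : x = x') (v w : Coord (n + 1)) :
    h.inner x v w = h.inner x' v w := by
  subst hx; rfl

theorem IsIsometric.symm (hg : IsIsometric h g) : IsIsometric h g.symm := by
  intro x v w
  obtain ⟨z, rfl⟩ := g.surjective x
  refine (inner_congr (g.symm_apply_apply z) _ _).trans ?_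
  refine (hg z _ _).symm.trans ?_
  have h1 := mfderiv_symm_apply g z v
  have h2 := mfderiv_symm_apply g z w
  exact congrArg₂ (fun v w : Coord (n + 1) => h.inner (g z) v w) h1 h2

theorem isIsometric_refl : IsIsometric h (Diffeomorph.refl (𝓡 (n + 1)) M ∞) := by
  intro x v w
  have h1 : mfderiv (𝓡 (n + 1)) (𝓡 (n + 1)) (Diffeomorph.refl (𝓡 (n + 1)) M ∞) x =
    ContinuousLinearMap.id ℝ _ := mfderiv_id
  rw [h1]
  rfl

theorem codiff_refl (hr : IsIsometric h (Diffeomorph.refl (𝓡 (n + 1)) M ∞)) (p : Cosphere h) :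
    codiff hr p = p := by
  refine Cosphere.ext_cov rfl ?_
  rw [codiff_cov]
  have h1 : (mfderiv (𝓡 (n + 1)) (𝓡 (n + 1)) (Diffeomorph.refl (𝓡 (n + 1)) M ∞).symm p.base) =
    ContinuousLinearMap.id ℝ _ := mfderiv_id
  exact ContinuousLinearMap.ext fun v =>
    congrArg (fun T : Coord (n + 1) →L[ℝ] Coord (n + 1) => p.cov (T v)) h1

theorem codiff_symm_codiff (hg : IsIsometric h g) (p : Cosphere h) :
    codiff hg.symm (codiff hg p) = p := by
  refine Cosphere.ext_cov (g.symm_apply_apply p.base) ?_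
  rw [codiff_cov, codiff_cov]
  ext1 v
  refine congrArg p.cov ?_
  exact (congrArg _ (congrArg (fun z => (mfderiv (𝓡 (n + 1)) (𝓡 (n + 1)) g z :
    Coord (n + 1) →L[ℝ] Coord (n + 1)) v) (g.symm_apply_apply p.base))).trans
      (mfderiv_apply_symm g p.base v)

theorem symm_symm_codiff (hg : IsIsometric h g) (p : Cosphere h) :
    codiff hg (codiff hg.symm p) = p :=
  codiff_symm_codiff hg.symm p

theorem mfderiv_chart_symm_eq {c x : M} (hx : x ∈ (chartAt (Coord (n + 1)) c).source)
    (v : Coord (n + 1)) :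
    (mfderiv (𝓡 (n + 1)) (𝓡 (n + 1)) (chartAt (Coord (n + 1)) c).symm
      (chartAt (Coord (n + 1)) c x) : Coord (n + 1) →L[ℝ] Coord (n + 1)) v =
      tangentCoordChange (𝓡 (n + 1)) c x x v := by
  have h1 := (mdifferentiable_chart (I := 𝓡 (n + 1)) c).symm_comp_deriv hx
  rw [mfderiv_chartAt_eq_tangentCoordChange hx] at h1
  have h2 := congrArg (fun T : Coord (n + 1) →L[ℝ] Coord (n + 1) =>
    T (tangentCoordChange (𝓡 (n + 1)) c x x v)) h1
  have h3 : tangentCoordChange (𝓡 (n + 1)) x c x (tangentCoordChange (𝓡 (n + 1)) c x x v) = v := by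
    rw [tangentCoordChange_comp, tangentCoordChange_self] <;> simp [hx]
  refine Eq.trans ?_ h2
  exact congrArg _ h3.symm

/-- The differential of `g⁻¹` in the charts at `c'` and `c`, as a function of the coordinates of the
image point. -/
def invDeriv (g : M ≃ₘ^∞⟮𝓡 (n + 1), 𝓡 (n + 1)⟯ M) (c c' : M) (y : Coord (n + 1)) :
    Coord (n + 1) →L[ℝ] Coord (n + 1) :=
  fderiv ℝ (localMap (Coord (n + 1)) (Coord (n + 1)) g.symm c' c)
    (localMap (Coord (n + 1)) (Coord (n + 1)) g c c' y)

theorem localMap_symm_mem (g : M ≃ₘ^∞⟮𝓡 (n + 1), 𝓡 (n + 1)⟯ M) {c c' : M} {y : Coord (n + 1)}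
    (hy : y ∈ localDomain (Coord (n + 1)) (Coord (n + 1)) g c c') :
    localMap (Coord (n + 1)) (Coord (n + 1)) g c c' y ∈
      localDomain (Coord (n + 1)) (Coord (n + 1)) g.symm c' c := by
  refine ⟨(chartAt (Coord (n + 1)) c').map_source hy.2, ?_⟩
  change g.symm ((chartAt (Coord (n + 1)) c').symm (chartAt (Coord (n + 1)) c' _)) ∈
    (chartAt (Coord (n + 1)) c).source
  rw [(chartAt (Coord (n + 1)) c').left_inv hy.2, g.symm_apply_apply]
  exact (chartAt (Coord (n + 1)) c).map_target hy.1

theorem localMap_symm_localMap (g : M ≃ₘ^∞⟮𝓡 (n + 1), 𝓡 (n + 1)⟯ M) {c c' : M}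
    {y : Coord (n + 1)} (hy : y ∈ localDomain (Coord (n + 1)) (Coord (n + 1)) g c c') :
    localMap (Coord (n + 1)) (Coord (n + 1)) g.symm c' c
      (localMap (Coord (n + 1)) (Coord (n + 1)) g c c' y) = y := by
  change chartAt (Coord (n + 1)) c (g.symm ((chartAt (Coord (n + 1)) c').symm
    (chartAt (Coord (n + 1)) c' _))) = y
  rw [(chartAt (Coord (n + 1)) c').left_inv hy.2, g.symm_apply_apply]
  exact (chartAt (Coord (n + 1)) c).right_inv hy.1

theorem contDiffOn_invDeriv (g : M ≃ₘ^∞⟮𝓡 (n + 1), 𝓡 (n + 1)⟯ M) (c c' : M) :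
    ContDiffOn ℝ ∞ (invDeriv g c c') (localDomain (Coord (n + 1)) (Coord (n + 1)) g c c') :=
  ((contDiffOn_localMap g.symm.contMDiff c' c).fderiv_of_isOpen (m := ∞)
    (isOpen_localDomain g.symm.continuous c' c) (by simp)).comp
    (contDiffOn_localMap g.contMDiff c c') fun _ hy => localMap_symm_mem g hy

theorem invDeriv_comp (g : M ≃ₘ^∞⟮𝓡 (n + 1), 𝓡 (n + 1)⟯ M) {c c' : M} {y : Coord (n + 1)}
    (hy : y ∈ localDomain (Coord (n + 1)) (Coord (n + 1)) g c c') :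
    (invDeriv g c c' y).comp
      (fderiv ℝ (localMap (Coord (n + 1)) (Coord (n + 1)) g c c') y) =
        ContinuousLinearMap.id ℝ _ := by
  have ho := isOpen_localDomain (E := Coord (n + 1)) (E' := Coord (n + 1)) g.continuous c c'
  have ho' := isOpen_localDomain (E := Coord (n + 1)) (E' := Coord (n + 1)) g.symm.continuous c' c
  have h1 := differentiableAt_of_contDiffOn (contDiffOn_localMap g.contMDiff c c') ho hy
  have h2 := differentiableAt_of_contDiffOn (contDiffOn_localMap g.symm.contMDiff c' c) ho'
    (localMap_symm_mem g hy)
  rw [invDeriv, ← fderiv_comp y h2 h1, ← fderiv_id]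
  refine Filter.EventuallyEq.fderiv_eq ?_
  filter_upwards [ho.mem_nhds hy] with z hz
  exact localMap_symm_localMap g hz

/-- Chain rule for chart ∘ g⁻¹ ∘ inverse chart, with the chart differentials expressed by the
coordinate changes to the preferred frames at x and g x. -/
theorem invDeriv_apply (g : M ≃ₘ^∞⟮𝓡 (n + 1), 𝓡 (n + 1)⟯ M) {c c' : M} {x : M}
    (hx : x ∈ (chartAt (Coord (n + 1)) c).source) (hx' : g x ∈ (chartAt (Coord (n + 1)) c').source)
    (v : Coord (n + 1)) :
    invDeriv g c c' (chartAt (Coord (n + 1)) c x) v =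
      tangentCoordChange (𝓡 (n + 1)) x c x
        ((mfderiv (𝓡 (n + 1)) (𝓡 (n + 1)) g.symm (g x) : Coord (n + 1) →L[ℝ] Coord (n + 1))
          (tangentCoordChange (𝓡 (n + 1)) c' (g x) (g x) v)) := by
  have hz : localMap (Coord (n + 1)) (Coord (n + 1)) g c c' (chartAt (Coord (n + 1)) c x) =
      chartAt (Coord (n + 1)) c' (g x) := by
    rw [localMap, (chartAt (Coord (n + 1)) c).left_inv hx]
  have hxs : g.symm (g x) ∈ (chartAt (Coord (n + 1)) c).source := by rwa [g.symm_apply_apply]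
  rw [invDeriv, hz, ← mfderiv_eq_fderiv]
  have h1 := mdifferentiableAt_chart_symm (E := Coord (n + 1))
    ((chartAt (Coord (n + 1)) c').map_source hx')
  have h2 : MDifferentiableAt (𝓡 (n + 1)) (𝓡 (n + 1)) (chartAt (Coord (n + 1)) c ∘ g.symm)
      (g x) := (mdifferentiableAt_chart hxs).comp (g x) (mdifferentiableAt_diffeo g.symm (g x))
  have e1 := (chartAt (Coord (n + 1)) c').left_inv hx'
  -- The point reached through the inverse chart equals g x only propositionally and occurs in the
  -- types of the differentials. A variable point allows the equality to be substituted.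
  have k1 : ∀ z : M, z = g x → (chartAt (Coord (n + 1)) c').symm
      (chartAt (Coord (n + 1)) c' (g x)) = z →
      (mfderiv (𝓡 (n + 1)) (𝓡 (n + 1)) ((chartAt (Coord (n + 1)) c ∘ g.symm) ∘
        (chartAt (Coord (n + 1)) c').symm) (chartAt (Coord (n + 1)) c' (g x)) :
        Coord (n + 1) →L[ℝ] Coord (n + 1)) v =
      (mfderiv (𝓡 (n + 1)) (𝓡 (n + 1)) (chartAt (Coord (n + 1)) c ∘ g.symm) z :
        Coord (n + 1) →L[ℝ] Coord (n + 1))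
        ((mfderiv (𝓡 (n + 1)) (𝓡 (n + 1)) (chartAt (Coord (n + 1)) c').symm
          (chartAt (Coord (n + 1)) c' (g x)) : Coord (n + 1) →L[ℝ] Coord (n + 1)) v) := by
    rintro z hz rfl
    rw [mfderiv_comp _ (by rw [hz]; exact h2) h1]
    rfl
  refine (k1 (g x) rfl e1).trans ?_
  rw [mfderiv_chart_symm_eq hx']
  have k2 : ∀ z : M, g.symm (g x) = z → ∀ u : Coord (n + 1),
      (mfderiv (𝓡 (n + 1)) (𝓡 (n + 1)) (chartAt (Coord (n + 1)) c ∘ g.symm) (g x) :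
        Coord (n + 1) →L[ℝ] Coord (n + 1)) u =
      (mfderiv (𝓡 (n + 1)) (𝓡 (n + 1)) (chartAt (Coord (n + 1)) c) z :
        Coord (n + 1) →L[ℝ] Coord (n + 1))
        ((mfderiv (𝓡 (n + 1)) (𝓡 (n + 1)) g.symm (g x) : Coord (n + 1) →L[ℝ] Coord (n + 1)) u) := by
    rintro z rfl u
    rw [mfderiv_comp _ (mdifferentiableAt_chart hxs) (mdifferentiableAt_diffeo g.symm (g x))]
    rfl
  rw [k2 x (g.symm_apply_apply x), mfderiv_chartAt_eq_tangentCoordChange hx]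
  rfl

theorem affineChart_symm_cov (p₀ : Cosphere h) (c : M) (a : Fin (n + 1)) (ε : ℤˣ) {q : SCoord n}
    (hq : q.1 ∈ (chartAt (Coord (n + 1)) c).target) :
    ∃ t : ℝ, 0 < t ∧ ((affineChart p₀ c a ε).symm q).cov =
      t • covecOf c ((chartAt (Coord (n + 1)) c).symm q.1) (a.insertNth ((ε : ℤ) : ℝ) q.2) := by
  obtain ⟨h1, t, ht, h2⟩ := insertNth_spec p₀ c a ε hq q.2
  refine ⟨t, ht, ?_⟩
  have h3 : ((affineChart p₀ c a ε).symm q).base ∈ (chartAt (Coord (n + 1)) c).source := by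
    rw [affineChart_symm_base p₀ c a ε hq]
    exact (chartAt (Coord (n + 1)) c).map_target hq
  rw [← covecOf_coord c _ h3, affineChart_symm_base p₀ c a ε hq, ← covecOf_smul]
  congr 1
  funext b
  exact h2 b

/-- The components of the image of a covector under the codifferential. -/
theorem coord_codiff_affineChart_symm (hg : IsIsometric h g) (p₀ : Cosphere h) (c c' : M)
    (a : Fin (n + 1)) (ε : ℤˣ) {q : SCoord n}
    (hq : q.1 ∈ localDomain (Coord (n + 1)) (Coord (n + 1)) g c c') :
    ∃ t : ℝ, 0 < t ∧ ∀ b, (codiff hg ((affineChart p₀ c a ε).symm q)).coord c' b =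
      t * projCoord a ε (invDeriv g c c') b q := by
  obtain ⟨t, ht, h1⟩ := affineChart_symm_cov p₀ c a ε hq.1
  refine ⟨t, ht, fun b => ?_⟩
  have hb := affineChart_symm_base p₀ c a ε hq.1
  set P := (affineChart p₀ c a ε).symm q
  set x := (chartAt (Coord (n + 1)) c).symm q.1 with hx
  have hxc : x ∈ (chartAt (Coord (n + 1)) c).source := (chartAt (Coord (n + 1)) c).map_target hq.1
  have hqx : q.1 = chartAt (Coord (n + 1)) c x := ((chartAt (Coord (n + 1)) c).right_inv hq.1).symm
  have h2 : (codiff hg P).coord c' b = P.cov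
      ((mfderiv (𝓡 (n + 1)) (𝓡 (n + 1)) g.symm (g x) : Coord (n + 1) →L[ℝ] Coord (n + 1))
        (tangentCoordChange (𝓡 (n + 1)) c' (g x) (g x) (EuclideanSpace.single b (1 : ℝ)))) := by
    rw [Cosphere.coord, codiff_cov, ← hb]
    rfl
  rw [h2, h1]
  refine congrArg (t * ·) ((covecOf_apply c x _ _).trans ?_)
  rw [projCoord, hqx]
  refine Finset.sum_congr rfl fun d _ => ?_
  rw [invDeriv_apply g hxc hq.2]

theorem chartAt_cosphere_symm_base {p : Cosphere h} {q : SCoord n}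
    (hq : q ∈ (chartAt (SCoord n) p).target) :
    ((chartAt (SCoord n) p).symm q).base = (chartAt (Coord (n + 1)) p.base).symm q.1 :=
  affineChart_symm_base p p.base p.dir.1 p.dir.2 hq.1

/-- The domain of the codifferential in the charts at `p` and `p'`. -/
def codiffDomain (g : M ≃ₘ^∞⟮𝓡 (n + 1), 𝓡 (n + 1)⟯ M) (p p' : Cosphere h) : Set (SCoord n) :=
  localDomain (Coord (n + 1)) (Coord (n + 1)) g p.base p'.base ×ˢ univ ∩
    {q | 0 < ((p'.dir.2 : ℤ) : ℝ) *
      projCoord p.dir.1 p.dir.2 (invDeriv g p.base p'.base) p'.dir.1 q}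

/-- The codifferential in the charts at `p` and `p'`. -/
def codiffLocal (g : M ≃ₘ^∞⟮𝓡 (n + 1), 𝓡 (n + 1)⟯ M) (p p' : Cosphere h) : SCoord n → SCoord n :=
  projMap p.dir.1 p.dir.2 p'.dir.1 p'.dir.2
    (localMap (Coord (n + 1)) (Coord (n + 1)) g p.base p'.base) (invDeriv g p.base p'.base)

/-- Normalizing the covector multiplies its components by a positive number, which does not affect
the sign condition of the target chart. -/
theorem localDomain_codiff (hg : IsIsometric h g) (p p' : Cosphere h) :
    localDomain (SCoord n) (SCoord n) (codiff hg) p p' = codiffDomain g p p' := by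
  ext q
  have key : q.1 ∈ localDomain (Coord (n + 1)) (Coord (n + 1)) g p.base p'.base →
      (0 < ((p'.dir.2 : ℤ) : ℝ) *
        (codiff hg ((chartAt (SCoord n) p).symm q)).coord p'.base p'.dir.1 ↔
      0 < ((p'.dir.2 : ℤ) : ℝ) *
        projCoord p.dir.1 p.dir.2 (invDeriv g p.base p'.base) p'.dir.1 q) := by
    intro hq
    obtain ⟨t, ht, h2⟩ := coord_codiff_affineChart_symm hg p p.base p'.base p.dir.1 p.dir.2 hq
    refine (iff_of_eq (congrArg (fun s => 0 < ((p'.dir.2 : ℤ) : ℝ) * s) (h2 p'.dir.1))).trans ?_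
    rw [mul_left_comm, mul_pos_iff_of_pos_left ht]
  constructor
  · rintro ⟨h1, h2⟩
    have h3 : g ((chartAt (SCoord n) p).symm q).base ∈
        (chartAt (Coord (n + 1)) p'.base).source := h2.1
    rw [chartAt_cosphere_symm_base h1] at h3
    exact ⟨⟨⟨h1.1, h3⟩, mem_univ _⟩, (key ⟨h1.1, h3⟩).1 h2.2⟩
  · rintro ⟨⟨h1, -⟩, h2⟩
    have h3 : q ∈ (chartAt (SCoord n) p).target := ⟨h1.1, mem_univ _⟩
    refine ⟨h3, ?_, (key h1).2 h2⟩
    change g ((chartAt (SCoord n) p).symm q).base ∈ _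
    rw [chartAt_cosphere_symm_base h3]
    exact h1.2

/-- The normalizing factor cancels in the ratios that serve as fibre coordinates. -/
theorem localMap_codiff (hg : IsIsometric h g) {p p' : Cosphere h} {q : SCoord n}
    (hq : q ∈ codiffDomain g p p') :
    localMap (SCoord n) (SCoord n) (codiff hg) p p' q = codiffLocal g p p' q := by
  obtain ⟨t, ht, h2⟩ := coord_codiff_affineChart_symm hg p p.base p'.base p.dir.1 p.dir.2 hq.1.1
  have h3 : q ∈ (chartAt (SCoord n) p).target := ⟨hq.1.1.1, mem_univ _⟩
  refine Prod.ext ?_ (funext fun b => ?_)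
  · change chartAt (Coord (n + 1)) p'.base (g ((chartAt (SCoord n) p).symm q).base) = _
    rw [chartAt_cosphere_symm_base h3]
    rfl
  · refine (congrArg₂ (fun s t => s / (((p'.dir.2 : ℤ) : ℝ) * t)) (h2 (p'.dir.1.succAbove b))
      (h2 p'.dir.1)).trans ?_
    rw [mul_left_comm, mul_div_mul_left _ _ ht.ne']
    rfl

theorem isOpen_codiffDomain (g : M ≃ₘ^∞⟮𝓡 (n + 1), 𝓡 (n + 1)⟯ M) (p p' : Cosphere h) :
    IsOpen (codiffDomain g p p') :=
  (continuousOn_const.mul (contDiffOn_projCoord _ _ (contDiffOn_invDeriv g p.base p'.base)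
    p'.dir.1).continuousOn).isOpen_inter_preimage
    ((isOpen_localDomain g.continuous p.base p'.base).prod isOpen_univ) isOpen_Ioi

theorem contDiffOn_codiffLocal (g : M ≃ₘ^∞⟮𝓡 (n + 1), 𝓡 (n + 1)⟯ M) (p p' : Cosphere h) :
    ContDiffOn ℝ ∞ (codiffLocal g p p') (codiffDomain g p p') :=
  contDiffOn_projMap _ _ _ _ (contDiffOn_localMap g.contMDiff p.base p'.base)
    (contDiffOn_invDeriv g p.base p'.base)

theorem mem_codiffDomain_self (hg : IsIsometric h g) (p : Cosphere h) :
    chartAt (SCoord n) p p ∈ codiffDomain g p (codiff hg p) := by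
  rw [← localDomain_codiff hg]
  refine ⟨mem_chart_target _ p, ?_⟩
  change codiff hg ((chartAt (SCoord n) p).symm (chartAt (SCoord n) p p)) ∈
    (chartAt (SCoord n) (codiff hg p)).source
  rw [(chartAt (SCoord n) p).left_inv (mem_chart_source _ p)]
  exact mem_chart_source _ _

theorem contDiffAt_localMap_codiff (hg : IsIsometric h g) (p : Cosphere h) :
    ContDiffAt ℝ ∞ (localMap (SCoord n) (SCoord n) (codiff hg) p (codiff hg p))
      (chartAt (SCoord n) p p) :=
  ((contDiffOn_codiffLocal g p _).congr fun _ hq => localMap_codiff hg hq).contDiffAt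
    ((isOpen_codiffDomain g p _).mem_nhds (mem_codiffDomain_self hg p))

theorem contMDiff_codiff (hg : IsIsometric h g) :
    ContMDiff 𝓘(ℝ, SCoord n) 𝓘(ℝ, SCoord n) ∞ (codiff hg) := by
  intro p
  have hsm := contDiffAt_localMap_codiff hg p
  refine contMDiffAt_iff.2 ⟨?_, ?_⟩
  · refine Cosphere.continuousAt_of_chart ?_
    set p' := codiff hg p
    have h1 : ContinuousAt (fun q => (chartAt (SCoord n) p').symm
        (localMap (SCoord n) (SCoord n) (codiff hg) p p' q)) (chartAt (SCoord n) p p) := by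
      refine ContinuousAt.comp (g := (chartAt (SCoord n) p').symm) ?_ hsm.continuousAt
      refine (chartAt (SCoord n) p').continuousAt_symm ?_
      rw [localMap, (chartAt (SCoord n) p).left_inv (mem_chart_source _ p)]
      exact mem_chart_target _ _
    refine h1.congr ?_
    filter_upwards [(isOpen_codiffDomain g p p').mem_nhds (mem_codiffDomain_self hg p)] with q hq
    rw [← localDomain_codiff hg] at hq
    exact (chartAt (SCoord n) p').left_inv hq.2
  · have h2 : ContDiffWithinAt ℝ ∞ (fun q => chartAt (SCoord n) (codiff hg p)
        (codiff hg ((chartAt (SCoord n) p).symm q))) (range 𝓘(ℝ, SCoord n))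
        (chartAt (SCoord n) p p) := hsm.contDiffWithinAt
    simpa [Function.comp_def] using h2

theorem contMDiff_base : ContMDiff 𝓘(ℝ, SCoord n) (𝓡 (n + 1)) ∞ (Cosphere.base (h := h)) := by
  intro p
  refine contMDiffAt_iff.2 ⟨Cosphere.continuous_base.continuousAt, ?_⟩
  have h1 : ContDiffAt ℝ ∞ (localMap (SCoord n) (Coord (n + 1)) (Cosphere.base (h := h)) p p.base)
      (chartAt (SCoord n) p p) := by
    refine contDiffAt_fst.congr_of_eventuallyEq ?_
    filter_upwards [(chartAt (SCoord n) p).open_target.mem_nhds (mem_chart_target _ p)] with q hq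
    rw [localMap, chartAt_cosphere_symm_base hq]
    exact (chartAt (Coord (n + 1)) p.base).right_inv hq.1
  have h2 : ContDiffWithinAt ℝ ∞ (fun q => chartAt (Coord (n + 1)) p.base
      ((chartAt (SCoord n) p).symm q).base) (range 𝓘(ℝ, SCoord n))
      (chartAt (SCoord n) p p) := h1.contDiffWithinAt
  simpa [Function.comp_def] using h2

/-- A map preserves the orientations given by the signs `o` of the charts. -/
def PreservesOrientation {E X : Type*} [NormedAddCommGroup E] [NormedSpace ℝ E]
    [TopologicalSpace X] [ChartedSpace E X] (o : X → ℤˣ) (f : X → X) : Prop :=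
  ∀ c c' : X, ∀ y ∈ localDomain E E f c c',
    0 < ((o c : ℤ) : ℝ) * ((o c' : ℤ) : ℝ) * (fderiv ℝ (localMap E E f c c') y).det

/-- The covector map is the transpose of the differential of g⁻¹, which inverts the differential of
g in the base. This is exactly the hypothesis under which the Jacobian sign is determined. -/
theorem preservesOrientation_codiff (hg : IsIsometric h g) :
    PreservesOrientation (E := SCoord n) orientation (codiff hg) := by
  intro p p' q hq
  rw [localDomain_codiff hg] at hq
  have h1 : localMap (SCoord n) (SCoord n) (codiff hg) p p' =ᶠ[𝓝 q] codiffLocal g p p' := by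
    filter_upwards [(isOpen_codiffDomain g p p').mem_nhds hq] with r hr
    exact localMap_codiff hg hr
  rw [h1.fderiv_eq]
  exact det_fderiv_projMap_pos
    (differentiableAt_of_contDiffOn (contDiffOn_localMap g.contMDiff _ _)
      (isOpen_localDomain g.continuous _ _) hq.1.1)
    (differentiableAt_of_contDiffOn (contDiffOn_codiffLocal g p p') (isOpen_codiffDomain g p p') hq)
    hq.2 (invDeriv_comp g hq.1.1)

/-- The identity of S*M is the codifferential of the identity isometry. The result says that the
signs of any two charts are compatible, so that they define an orientation. -/
theorem preservesOrientation_id :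
    PreservesOrientation (E := SCoord n) orientation (id : Cosphere h → Cosphere h) := by
  have h1 : (id : Cosphere h → Cosphere h) = codiff isIsometric_refl :=
    funext fun p => (codiff_refl isIsometric_refl p).symm
  rw [h1]
  exact preservesOrientation_codiff _

end Codifferential

/-! ### Top-degree forms and Stokes' theorem in a vector space. -/

section FlatIntegration

open MeasureTheory

variable {E : Type*} [NormedAddCommGroup E] [NormedSpace ℝ E]

/-- Real-valued forms of top degree are multiples of the determinant; the complex case follows by
taking real and imaginary parts. -/
theorem map_comp_basis {N : ℕ} (b : Module.Basis (Fin N) ℝ E) (α : E [⋀^Fin N]→L[ℝ] ℂ)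
    (A : E →L[ℝ] E) : α (A ∘ b) = A.det • α b := by
  have h : ∀ T : ℂ →ₗ[ℝ] ℝ, T (α (A ∘ b)) = A.det * T (α b) := by
    intro T
    have h1 := (T.compAlternatingMap α.toAlternatingMap).eq_smul_basis_det b
    have h2 := congrArg (fun f => f (A ∘ b)) h1
    have h3 : b.det (A ∘ b) = A.det := by
      have := b.det_comp (A : E →ₗ[ℝ] E) b
      rwa [b.det_self, mul_one] at this
    simp only [AlternatingMap.smul_apply, h3, smul_eq_mul] at h2
    rw [mul_comm]
    exact h2
  apply Complex.ext
  · simpa using h Complex.reLm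
  · simpa using h Complex.imLm

theorem gcomp_top {N : ℕ} (b : Module.Basis (Fin N) ℝ E) (α : GForm E) (A : E →L[ℝ] E) :
    gcomp α A N b = (A.det : ℂ) * α N b := by
  rw [← Complex.real_smul, ← map_comp_basis]
  rfl

variable [FiniteDimensional ℝ E] [MeasureSpace E] [BorelSpace E]
  [(volume : Measure E).IsAddHaarMeasure]

/-- Integration by parts against the constant function 1. -/
theorem integral_fderiv_eq_zero {f : E → ℂ} (hf : ContDiff ℝ 1 f) (hc : HasCompactSupport f)
    (v : E) : ∫ y, fderiv ℝ f y v = 0 := by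
  have h1 : Continuous fun y => fderiv ℝ f y v := (hf.continuous_fderiv (by simp)).clm_apply
    continuous_const
  have h2 : Integrable fun y => fderiv ℝ f y v :=
    h1.integrable_of_hasCompactSupport (hc.fderiv_apply ℝ v)
  have h := integral_smul_fderiv_eq_neg_fderiv_smul_of_integrable (μ := (volume : Measure E))
    (f := fun _ : E => (1 : ℝ)) (g := f) (v := v) (by simp) (by simpa using h2)
    (by simpa using hf.continuous.integrable_of_hasCompactSupport hc)
    (fun x _ => differentiableAt_const _) (fun x _ => hf.differentiable (by simp) x)
  simpa using h

/-- Each term of the exterior derivative evaluated on fixed vectors is a directional derivative of a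
compactly supported function. -/
theorem integral_extDeriv_eq_zero {k : ℕ} {a : E → E [⋀^Fin k]→L[ℝ] ℂ} (ha : ContDiff ℝ ∞ a)
    (hc : HasCompactSupport a) (b : Fin (k + 1) → E) : ∫ y, extDeriv a y b = 0 := by
  have hda : ∀ y, DifferentiableAt ℝ a y := fun y => ha.differentiable (by simp) y
  have h1 : ∀ w : Fin k → E, ContDiff ℝ 1 fun y => a y w := fun w =>
    ((ContinuousAlternatingMap.apply ℝ E ℂ w).contDiff.comp ha).of_le (by simp)
  have h2 : ∀ w : Fin k → E, HasCompactSupport fun y => a y w := fun w =>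
    hc.comp_left (g := fun α : E [⋀^Fin k]→L[ℝ] ℂ => α w) rfl
  have h5 : ∀ y, extDeriv a y b = ∑ i : Fin (k + 1), (-1 : ℤ) ^ (i : ℕ) •
      fderiv ℝ (fun y => a y (i.removeNth b)) y (b i) := fun y => extDeriv_apply (hda y) b
  simp only [h5]
  rw [integral_finsetSum]
  · refine Finset.sum_eq_zero fun i _ => ?_
    rw [show (fun y => (-1 : ℤ) ^ (i : ℕ) • fderiv ℝ (fun y => a y (i.removeNth b)) y (b i)) =
      fun y => ((-1 : ℝ) ^ (i : ℕ)) • fderiv ℝ (fun y => a y (i.removeNth b)) y (b i) from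
      funext fun y => by simp, integral_smul, integral_fderiv_eq_zero (h1 _) (h2 _), smul_zero]
  · intro i _
    have h4 : Continuous fun y => fderiv ℝ (fun y => a y (i.removeNth b)) y (b i) :=
      ((h1 _).continuous_fderiv (by simp)).clm_apply continuous_const
    exact (h4.integrable_of_hasCompactSupport ((h2 _).fderiv_apply ℝ (b i))).smul _

/-- Stokes' theorem for forms with compact support in an open set. -/
theorem setIntegral_extDeriv_eq_zero {k : ℕ} {a : E → E [⋀^Fin k]→L[ℝ] ℂ} {U K : Set E}
    (hU : IsOpen U) (hK : IsCompact K) (hKU : K ⊆ U) (ha : ContDiffOn ℝ ∞ a U)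
    (h0 : ∀ y ∈ U, y ∉ K → a y = 0) (b : Fin (k + 1) → E) : ∫ y in U, extDeriv a y b = 0 := by
  have hout : ∀ y ∉ K, U.indicator a =ᶠ[𝓝 y] 0 := by
    intro y hy
    filter_upwards [hK.isClosed.isOpen_compl.mem_nhds hy] with z hz
    by_cases hzU : z ∈ U
    · rw [indicator_of_mem hzU]; exact h0 z hzU hz
    · rw [indicator_of_notMem hzU]; rfl
  have hin : ∀ y ∈ U, U.indicator a =ᶠ[𝓝 y] a := by
    intro y hy
    filter_upwards [hU.mem_nhds hy] with z hz
    exact indicator_of_mem hz a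
  -- Extension by zero is smooth: near points outside K it vanishes identically, and K lies in U.
  have hsm : ContDiff ℝ ∞ (U.indicator a) := by
    rw [contDiff_iff_contDiffAt]
    intro y
    by_cases hy : y ∈ U
    · exact ((ha.contDiffAt (hU.mem_nhds hy))).congr_of_eventuallyEq (hin y hy)
    · exact contDiffAt_const.congr_of_eventuallyEq (hout y fun h => hy (hKU h))
  have hcs : HasCompactSupport (U.indicator a) :=
    HasCompactSupport.intro hK fun y hy => (hout y hy).eq_of_nhds
  refine Eq.trans ?_ ((setIntegral_eq_integral_of_forall_compl_eq_zero (s := U) ?_).trans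
    (integral_extDeriv_eq_zero hsm hcs b))
  · refine setIntegral_congr_fun hU.measurableSet fun y hy => ?_
    exact congrArg (fun α : E [⋀^Fin (k + 1)]→L[ℝ] ℂ => α b)
      (Filter.EventuallyEq.extDeriv_eq (hin y hy)).symm
  · intro y hy
    have h1 : extDeriv (U.indicator a) y = extDeriv (0 : E → E [⋀^Fin k]→L[ℝ] ℂ) y :=
      Filter.EventuallyEq.extDeriv_eq (hout y fun h => hy (hKU h))
    rw [h1]
    have h2 : extDeriv (0 : E → E [⋀^Fin k]→L[ℝ] ℂ) y = 0 := by
      rw [extDeriv, fderiv_zero]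
      exact alternatizeUncurryFin_zero _
    rw [h2]
    rfl

end FlatIntegration

/-! ### Integrals over compact manifolds and their invariance. -/

section Integration

open MeasureTheory

variable {E : Type*} [NormedAddCommGroup E] [NormedSpace ℝ E] [MeasureSpace E]
  {X : Type*} [TopologicalSpace X] [ChartedSpace E X] {N : ℕ}

/-- The integral of `s α` over the domain of the chart at `c`. -/
def localIntegral (o : X → ℤˣ) (b : Fin N → E) (c : X) (s : X → ℝ) (α : X → GForm E) : ℂ :=
  ((o c : ℤ) : ℂ) * ∫ y in (chartAt E c).target,
    (s ((chartAt E c).symm y) : ℂ) * inChart α c y N b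

theorem inChart_eq_zero {α : X → GForm E} {c : X} {y : E}
    (h : α ((chartAt E c).symm y) N = 0) : inChart α c y N = 0 := by
  have h1 : inChart α c y N = (α ((chartAt E c).symm y) N).compContinuousLinearMap
    (mfderiv 𝓘(ℝ, E) 𝓘(ℝ, E) (chartAt E c).symm y : E →L[ℝ] E) := rfl
  rw [h1, h]
  rfl

variable [FiniteDimensional ℝ E] [BorelSpace E]
  [(volume : Measure E).IsAddHaarMeasure] [IsManifold 𝓘(ℝ, E) ∞ X] [CompactSpace X]

/-- The integrand is continuous on the target of the chart and vanishes outside the compact image of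
K. -/
theorem integrableOn_local {s : X → ℝ} (hs : Continuous s) {α : X → GForm E}
    (hα : IsSmoothForm α) {c : X} {K : Set X} (hK : IsClosed K) (hKc : K ⊆ (chartAt E c).source)
    (h0 : ∀ p ∉ K, s p = 0 ∨ α p N = 0) (b : Fin N → E) :
    IntegrableOn (fun y => (s ((chartAt E c).symm y) : ℂ) * inChart α c y N b)
      (chartAt E c).target := by
  have hKK : IsCompact (chartAt E c '' K) :=
    hK.isCompact.image_of_continuousOn ((chartAt E c).continuousOn.mono hKc)
  have hKt : chartAt E c '' K ⊆ (chartAt E c).target := by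
    rintro _ ⟨p, hp, rfl⟩
    exact (chartAt E c).map_source (hKc hp)
  have hcont : ContinuousOn (fun y => (s ((chartAt E c).symm y) : ℂ) * inChart α c y N b)
      (chartAt E c).target := by
    refine ContinuousOn.mul ?_ ?_
    · exact Complex.continuous_ofReal.comp_continuousOn
        (hs.comp_continuousOn (chartAt E c).continuousOn_symm)
    · exact (ContinuousAlternatingMap.apply ℝ E ℂ b).continuous.comp_continuousOn
        (hα c N).continuousOn
  refine IntegrableOn.of_forall_sdiff_eq_zero
    ((hcont.mono hKt).integrableOn_compact hKK) (chartAt E c).open_target.measurableSet ?_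
  rintro y ⟨hy, hyK⟩
  have h1 : (chartAt E c).symm y ∉ K := fun h =>
    hyK ⟨_, h, (chartAt E c).right_inv hy⟩
  rcases h0 _ h1 with h2 | h2
  · rw [h2, Complex.ofReal_zero, zero_mul]
  · rw [inChart_eq_zero h2]
    exact mul_zero _

/-- Change of variables for the local expression of f. By `h0` nothing is lost outside the region
where both charts apply, and the orientation hypothesis removes the absolute value from the
Jacobian. -/
theorem localIntegral_change {o : X → ℤˣ} (b : Module.Basis (Fin N) ℝ E) {f f' : X → X}
    (hf : ContMDiff 𝓘(ℝ, E) 𝓘(ℝ, E) ∞ f) (hl : Function.LeftInverse f' f)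
    (hr : Function.RightInverse f' f) (ho : PreservesOrientation (E := E) o f) {s : X → ℝ}
    {α : X → GForm E} {c c' : X}
    (h0 : ∀ p, s p ≠ 0 → α (f p) N ≠ 0 → p ∈ (chartAt E c).source ∧ f p ∈ (chartAt E c').source) :
    localIntegral o b c s (pullback f α) = localIntegral o b c' (s ∘ f') α := by
  set D := localDomain E E f c c' with hD
  set φ := localMap E E f c c' with hφ
  have hDo : IsOpen D := isOpen_localDomain hf.continuous c c'
  have hpull : ∀ y ∈ D, inChart (pullback f α) c y N b =
      ((fderiv ℝ φ y).det : ℂ) * inChart α c' (φ y) N b := by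
    intro y hy
    rw [inChart_pullback hf hy, pullback_flat, gcomp_top]
  have hval : ∀ y ∈ D, (chartAt E c').symm (φ y) = f ((chartAt E c).symm y) := fun y hy =>
    (chartAt E c').left_inv hy.2
  have hinj : InjOn φ D := by
    intro y hy z hz hyz
    have h1 : f ((chartAt E c).symm y) = f ((chartAt E c).symm z) := by
      rw [← hval y hy, ← hval z hz, hyz]
    have h2 := hl.injective h1
    rw [← (chartAt E c).right_inv hy.1, ← (chartAt E c).right_inv hz.1, h2]
  -- Points sent outside the chart at c' do not contribute: there the cut-off or the form vanishes.
  have e1 : ∫ y in (chartAt E c).target,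
        (s ((chartAt E c).symm y) : ℂ) * inChart (pullback f α) c y N b =
      ∫ y in D, (s ((chartAt E c).symm y) : ℂ) * inChart (pullback f α) c y N b := by
    refine setIntegral_eq_of_subset_of_forall_sdiff_eq_zero (chartAt E c).open_target.measurableSet
      inter_subset_left ?_
    rintro y ⟨hy, hyD⟩
    by_cases hs : s ((chartAt E c).symm y) = 0
    · rw [hs, Complex.ofReal_zero, zero_mul]
    · have h1 : α (f ((chartAt E c).symm y)) N = 0 := by
        by_contra h
        exact hyD ⟨hy, (h0 _ hs h).2⟩
      have h2 : pullback (E := E) f α ((chartAt E c).symm y) N = 0 := by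
        have h3 : pullback (E := E) f α ((chartAt E c).symm y) N =
          (α (f ((chartAt E c).symm y)) N).compContinuousLinearMap
            (mfderiv 𝓘(ℝ, E) 𝓘(ℝ, E) f ((chartAt E c).symm y) : E →L[ℝ] E) := rfl
        rw [h3, h1]
        rfl
      rw [inChart_eq_zero h2]
      exact mul_zero _
  -- Likewise, a point with non-zero integrand is the image of a point of the chart at c.
  have e2 : ∫ z in (chartAt E c').target,
        ((s ∘ f') ((chartAt E c').symm z) : ℂ) * inChart α c' z N b =
      ∫ z in φ '' D, ((s ∘ f') ((chartAt E c').symm z) : ℂ) * inChart α c' z N b := by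
    refine setIntegral_eq_of_subset_of_forall_sdiff_eq_zero
      (chartAt E c').open_target.measurableSet ?_ ?_
    · rintro _ ⟨y, hy, rfl⟩
      exact (chartAt E c').map_source hy.2
    rintro z ⟨hz, hzD⟩
    by_cases hs : (s ∘ f') ((chartAt E c').symm z) = 0
    · rw [hs, Complex.ofReal_zero, zero_mul]
    · have h1 : α ((chartAt E c').symm z) N = 0 := by
        by_contra h
        have h2 := h0 (f' ((chartAt E c').symm z)) hs (by rwa [hr])
        refine hzD ⟨chartAt E c (f' ((chartAt E c').symm z)),
          ⟨(chartAt E c).map_source h2.1, ?_⟩, ?_⟩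
        · change f ((chartAt E c).symm (chartAt E c _)) ∈ (chartAt E c').source
          rw [(chartAt E c).left_inv h2.1]
          exact h2.2
        · change chartAt E c' (f ((chartAt E c).symm (chartAt E c _))) = z
          rw [(chartAt E c).left_inv h2.1, hr]
          exact (chartAt E c').right_inv hz
      rw [inChart_eq_zero h1]
      exact mul_zero _
  rw [localIntegral, localIntegral, e1, e2,
    integral_image_eq_integral_abs_det_fderiv_smul volume hDo.measurableSet (fun y hy =>
      (differentiableAt_of_contDiffOn (contDiffOn_localMap hf c c') hDo
        hy).hasFDerivAt.hasFDerivWithinAt) hinj, ← integral_const_mul, ← integral_const_mul]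
  refine setIntegral_congr_fun hDo.measurableSet fun y hy => ?_
  -- Positivity of the signed Jacobian says that its absolute value is itself times the two chart
  -- signs.
  have h1 := ho c c' y hy
  have h2 : |(fderiv ℝ φ y).det| = ((o c : ℤ) : ℝ) * ((o c' : ℤ) : ℝ) * (fderiv ℝ φ y).det := by
    rcases Int.units_eq_one_or (o c) with h | h <;> rcases Int.units_eq_one_or (o c') with h' | h' <;>
      simp only [h, h', Units.val_one, Units.val_neg, Int.cast_one, Int.cast_neg] at h1 ⊢
    · rw [abs_of_pos (by linarith)]; ring
    · rw [abs_of_neg (by linarith)]; ring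
    · rw [abs_of_neg (by linarith)]; ring
    · rw [abs_of_pos (by linarith)]; ring
  have h3 : ((o c' : ℤ) : ℂ) * ((o c' : ℤ) : ℂ) = 1 := by
    rcases Int.units_eq_one_or (o c') with h' | h' <;> simp [h']
  have h4 : (s ∘ f') ((chartAt E c').symm (φ y)) = s ((chartAt E c).symm y) := by
    rw [hval y hy, Function.comp_apply, hl]
  change ((o c : ℤ) : ℂ) * ((s ((chartAt E c).symm y) : ℂ) * inChart (pullback f α) c y N b) =
    ((o c' : ℤ) : ℂ) * (|(fderiv ℝ φ y).det| • (((s ∘ f') ((chartAt E c').symm (φ y)) : ℂ) *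
      inChart α c' (φ y) N b))
  rw [hpull y hy, h4, h2, Complex.real_smul]
  push_cast
  linear_combination (-((o c : ℤ) : ℂ) * (s ((chartAt E c).symm y) : ℂ) *
    ((fderiv ℝ φ y).det : ℂ) * inChart α c' (φ y) N b) * h3

theorem localIntegral_sum {o : X → ℤˣ} {b : Fin N → E} {c : X} {ι : Type*} (T : Finset ι)
    {s : ι → X → ℝ} {α : X → GForm E} (h : ∀ i ∈ T, IntegrableOn
      (fun y => (s i ((chartAt E c).symm y) : ℂ) * inChart α c y N b) (chartAt E c).target) :
    localIntegral o b c (fun p => ∑ i ∈ T, s i p) α = ∑ i ∈ T, localIntegral o b c (s i) α := by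
  simp only [localIntegral, ← Finset.mul_sum]
  rw [← integral_finsetSum T h]
  congr 2
  funext y
  push_cast
  rw [Finset.sum_mul]

variable [T2Space X]

/-- The finite set of indices of the non-zero functions of the partition of unity. -/
theorem exists_finset_chartPartition (E X : Type*) [NormedAddCommGroup E] [NormedSpace ℝ E]
    [FiniteDimensional ℝ E] [TopologicalSpace X] [ChartedSpace E X] [IsManifold 𝓘(ℝ, E) ∞ X]
    [T2Space X] [CompactSpace X] : ∃ T : Finset X, (∀ c ∉ T, ∀ p, chartPartition E X c p = 0) ∧
      ∀ p, ∑ c ∈ T, chartPartition E X c p = 1 := by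
  have hfin := (chartPartition E X).locallyFinite.finite_nonempty_of_compact
  refine ⟨hfin.toFinset, fun c hc p => ?_, fun p => ?_⟩
  · by_contra h
    exact hc (hfin.mem_toFinset.2 ⟨p, h⟩)
  · rw [← (chartPartition E X).sum_eq_one (mem_univ p)]
    refine (finsum_eq_sum_of_support_subset _ fun c hc => ?_).symm
    exact Finset.mem_coe.2 (hfin.mem_toFinset.2 ⟨p, hc⟩)

theorem tsupport_chartPartition (c : X) :
    tsupport (chartPartition E X c) ⊆ (chartAt E c).source :=
  (SmoothPartitionOfUnity.exists_isSubordinate_chartAt_source 𝓘(ℝ, E) X).choose_spec c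

theorem continuous_chartPartition (c : X) : Continuous (chartPartition E X c) :=
  (chartPartition E X c).contMDiff.continuous

theorem notMem_tsupport_chartPartition {c p : X} (hp : p ∉ tsupport (chartPartition E X c)) :
    chartPartition E X c p = 0 := image_eq_zero_of_notMem_tsupport hp

theorem integrableOn_chartPartition {α : X → GForm E} (hα : IsSmoothForm α) (b : Fin N → E)
    (c : X) : IntegrableOn (fun y => (chartPartition E X c ((chartAt E c).symm y) : ℂ) *
      inChart α c y N b) (chartAt E c).target :=
  integrableOn_local (continuous_chartPartition c) hα (isClosed_tsupport _)
    (tsupport_chartPartition c) (fun _ hp => Or.inl (notMem_tsupport_chartPartition hp)) b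

theorem formIntegral_eq_sum {T : Finset X} (hT : ∀ c ∉ T, ∀ p, chartPartition E X c p = 0)
    (o : X → ℤˣ) (b : Fin N → E) (α : X → GForm E) :
    formIntegral o b α = ∑ c ∈ T, localIntegral o b c (chartPartition E X c) α := by
  refine finsum_eq_sum_of_support_subset _ fun c hc => ?_
  by_contra h
  refine hc ?_
  simp [hT c h]

theorem formIntegral_add (o : X → ℤˣ) (b : Fin N → E) {α β : X → GForm E} (hα : IsSmoothForm α)
    (hβ : IsSmoothForm β) :
    formIntegral o b (α + β) = formIntegral o b α + formIntegral o b β := by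
  obtain ⟨T, hT, -⟩ := exists_finset_chartPartition E X
  rw [formIntegral_eq_sum hT, formIntegral_eq_sum hT, formIntegral_eq_sum hT,
    ← Finset.sum_add_distrib]
  refine Finset.sum_congr rfl fun c _ => ?_
  rw [localIntegral, localIntegral, localIntegral, ← mul_add, ← integral_add
    (integrableOn_chartPartition hα b c) (integrableOn_chartPartition hβ b c)]
  congr 2
  funext y
  rw [← mul_add]
  congr 1

theorem formIntegral_smul (o : X → ℤˣ) (b : Fin N → E) (z : ℂ) (α : X → GForm E) :
    formIntegral o b (z • α) = z * formIntegral o b α := by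
  obtain ⟨T, hT, -⟩ := exists_finset_chartPartition E X
  rw [formIntegral_eq_sum hT, formIntegral_eq_sum hT, Finset.mul_sum]
  refine Finset.sum_congr rfl fun c _ => ?_
  rw [localIntegral, localIntegral, mul_left_comm]
  refine congrArg _ ?_
  rw [← integral_const_mul]
  refine congrArg _ ?_
  funext y
  rw [mul_left_comm]
  rfl

/-- Integrals are invariant under orientation preserving diffeomorphisms. -/
theorem formIntegral_pullback {o : X → ℤˣ} (b : Module.Basis (Fin N) ℝ E) {f f' : X → X}
    (hf : ContMDiff 𝓘(ℝ, E) 𝓘(ℝ, E) ∞ f) (hf' : Continuous f') (hl : Function.LeftInverse f' f)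
    (hr : Function.RightInverse f' f) (ho : PreservesOrientation (E := E) o f)
    {α : X → GForm E} (hα : IsSmoothForm α) :
    formIntegral o b (pullback f α) = formIntegral o b α := by
  obtain ⟨T, hT, h1⟩ := exists_finset_chartPartition E X
  set ρ := chartPartition E X
  rw [formIntegral_eq_sum hT, formIntegral_eq_sum hT]
  -- Inserting 1 = ∑ ρ c' ∘ f localizes each piece in a source chart and in a target chart, where
  -- the change of variables applies. Summing over c afterwards removes the first partition again.
  have e1 : ∀ c ∈ T, localIntegral o b c (ρ c) (pullback f α) =
      ∑ c' ∈ T, localIntegral o b c' (fun p => ρ c (f' p) * ρ c' p) α := by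
    intro c _
    have e2 : (ρ c : X → ℝ) = fun p => ∑ c' ∈ T, ρ c p * ρ c' (f p) := by
      funext p
      rw [← Finset.mul_sum, h1, mul_one]
    refine (congrArg (fun s => localIntegral o b c s (pullback f α)) e2).trans ?_
    rw [localIntegral_sum]
    · refine Finset.sum_congr rfl fun c' _ => ?_
      rw [localIntegral_change b hf hl hr ho (c' := c')]
      · congr 1
        funext p
        rw [Function.comp_apply, hr]
      · intro p hp _
        have h2 := left_ne_zero_of_mul hp
        have h3 := right_ne_zero_of_mul hp
        exact ⟨tsupport_chartPartition c (subset_tsupport _ h2),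
          tsupport_chartPartition c' (subset_tsupport _ h3)⟩
    · intro c' _
      exact integrableOn_local ((continuous_chartPartition c).mul
        ((continuous_chartPartition c').comp hf.continuous)) (hα.pullback hf)
        (isClosed_tsupport (ρ c)) (tsupport_chartPartition c) (fun p hp => Or.inl (by
          change ρ c p * ρ c' (f p) = 0
          rw [notMem_tsupport_chartPartition hp, zero_mul])) b
  rw [Finset.sum_congr rfl e1, Finset.sum_comm]
  refine Finset.sum_congr rfl fun c' _ => ?_
  rw [← localIntegral_sum]
  · congr 1
    funext p
    rw [← Finset.sum_mul, h1, one_mul]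
  · intro c _
    exact integrableOn_local (((continuous_chartPartition c).comp hf').mul
      (continuous_chartPartition c')) hα
      (isClosed_tsupport (ρ c')) (tsupport_chartPartition c') (fun p hp => Or.inl (by
        change ρ c (f' p) * ρ c' p = 0
        rw [notMem_tsupport_chartPartition hp, mul_zero])) b

/-- The integral of a form with support in the domain of a chart. -/
theorem formIntegral_eq_localIntegral {o : X → ℤˣ} (b : Module.Basis (Fin N) ℝ E)
    (ho : PreservesOrientation (E := E) o (id : X → X)) {α : X → GForm E} (hα : IsSmoothForm α)
    {c : X} {K : Set X} (hK : IsClosed K) (hKc : K ⊆ (chartAt E c).source)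
    (h0 : ∀ p ∉ K, α p N = 0) :
    formIntegral o b α = localIntegral o b c (fun _ => 1) α := by
  obtain ⟨T, hT, h1⟩ := exists_finset_chartPartition E X
  rw [formIntegral_eq_sum hT]
  have e1 : ∀ c' ∈ T, localIntegral o b c' (chartPartition E X c') α =
      localIntegral o b c (chartPartition E X c') α := by
    intro c' _
    -- Changing charts is the change of variables for the identity map, so each piece can be
    -- computed in the chart at c.
    have h := localIntegral_change b (f := (id : X → X)) (f' := id) contMDiff_id (fun _ => rfl)
      (fun _ => rfl) ho (s := chartPartition E X c') (α := α) (c := c') (c' := c) (by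
        intro p hp hp'
        refine ⟨tsupport_chartPartition c' (subset_tsupport _ hp), hKc ?_⟩
        by_contra h
        exact hp' (h0 _ h))
    rwa [pullback_id] at h
  rw [Finset.sum_congr rfl e1, ← localIntegral_sum]
  · congr 1
    funext p
    exact h1 p
  · intro c' _
    exact integrableOn_local (continuous_chartPartition c') hα hK hKc (fun p hp => Or.inr (h0 p hp)) b

end Integration

/-! ### Stokes' theorem on closed manifolds. -/

section Stokes

open MeasureTheory

variable {E : Type*} [NormedAddCommGroup E] [NormedSpace ℝ E]
  {X : Type*} [TopologicalSpace X] [ChartedSpace E X]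

theorem isSmoothForm_zero : IsSmoothForm (0 : X → GForm E) := by
  intro c k
  have h : inChart (0 : X → GForm E) c = 0 := pullback_zero _
  rw [h]
  exact contDiffOn_const

theorem IsSmoothForm.add {α β : X → GForm E} (hα : IsSmoothForm α) (hβ : IsSmoothForm β) :
    IsSmoothForm (α + β) := by
  intro c k
  have h : inChart (α + β) c = fun y => inChart α c y + inChart β c y := pullback_add _ α β
  rw [h]
  exact (hα c k).add (hβ c k)

variable [IsManifold 𝓘(ℝ, E) ∞ X]

theorem extD_zero : extD (0 : X → GForm E) = 0 := by
  have h := extD_add (isSmoothForm_zero (E := E) (X := X)) isSmoothForm_zero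
  rw [add_zero] at h
  exact left_eq_add.1 h

/-- The product of a smooth function and a smooth form. -/
theorem IsSmoothForm.smul_fun {s : X → ℝ} (hs : ContMDiff 𝓘(ℝ, E) 𝓘(ℝ, ℝ) ∞ s)
    {α : X → GForm E} (hα : IsSmoothForm α) : IsSmoothForm fun p => s p • α p := by
  intro c k
  have h1 : ContDiffOn ℝ ∞ (fun y => s ((chartAt E c).symm y)) (chartAt E c).target := by
    rw [← contMDiffOn_iff_contDiffOn]
    exact hs.comp_contMDiffOn contMDiffOn_chart_symm
  exact h1.smul (hα c k)

variable [FiniteDimensional ℝ E] [MeasureSpace E] [BorelSpace E]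
  [(volume : Measure E).IsAddHaarMeasure] [CompactSpace X] [T2Space X] {N : ℕ}

/-- Since dα is supported where α is, its integral can be computed in the single chart at c, where
the Euclidean theorem applies. -/
theorem formIntegral_extD_eq_zero_of_support {o : X → ℤˣ} (b : Module.Basis (Fin N) ℝ E)
    (ho : PreservesOrientation (E := E) o (id : X → X)) {α : X → GForm E} (hα : IsSmoothForm α)
    {c : X} {K : Set X} (hK : IsClosed K) (hKc : K ⊆ (chartAt E c).source)
    (h0 : ∀ p ∉ K, α p = 0) : formIntegral o b (extD α) = 0 := by
  have h1 : ∀ p ∉ K, extD α p = 0 := by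
    intro p hp
    have h2 : α =ᶠ[𝓝 p] 0 := by
      filter_upwards [hK.isOpen_compl.mem_nhds hp] with q hq
      exact h0 q hq
    rw [extD_congr h2, extD_zero]
    rfl
  rw [formIntegral_eq_localIntegral b ho hα.extD hK hKc fun p hp => congrFun (h1 p hp) N,
    localIntegral]
  refine mul_eq_zero_of_right _ ?_
  have h2 : ∀ y ∈ (chartAt E c).target, ((1 : ℝ) : ℂ) * inChart (extD α) c y N b =
      flatD (inChart α c) y N b := by
    intro y hy
    rw [inChart_extD hα hy, Complex.ofReal_one, one_mul]
  rw [setIntegral_congr_fun (chartAt E c).open_target.measurableSet h2]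
  cases N with
  -- An exterior derivative has no component of degree 0.
  | zero => exact integral_zero _ _
  | succ k =>
    refine setIntegral_extDeriv_eq_zero (K := chartAt E c '' K) (chartAt E c).open_target
      (hK.isCompact.image_of_continuousOn ((chartAt E c).continuousOn.mono hKc)) ?_ (hα c k) ?_ b
    · rintro _ ⟨p, hp, rfl⟩
      exact (chartAt E c).map_source (hKc hp)
    · intro y hy hyK
      refine inChart_eq_zero (congrFun (h0 _ fun h => hyK ⟨_, h, ?_⟩) k)
      exact (chartAt E c).right_inv hy

/-- Stokes' theorem on a closed manifold. -/
theorem formIntegral_extD {o : X → ℤˣ} (b : Module.Basis (Fin N) ℝ E)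
    (ho : PreservesOrientation (E := E) o (id : X → X)) {α : X → GForm E} (hα : IsSmoothForm α) :
    formIntegral o b (extD α) = 0 := by
  obtain ⟨T, -, h1⟩ := exists_finset_chartPartition E X
  -- Splitting α itself, and not dα, gives forms supported in charts whose differentials are exact.
  have h2 : α = ∑ c ∈ T, fun p => chartPartition E X c p • α p := by
    funext p
    rw [Finset.sum_apply, ← Finset.sum_smul, h1, one_smul]
  have h3 : ∀ T : Finset X, IsSmoothForm (∑ c ∈ T, fun p => chartPartition E X c p • α p) ∧
      formIntegral o b (extD (∑ c ∈ T, fun p => chartPartition E X c p • α p)) = 0 := by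
    classical
    intro T
    induction T using Finset.induction_on with
    | empty =>
      rw [Finset.sum_empty]
      refine ⟨isSmoothForm_zero, ?_⟩
      have h4 := formIntegral_add o b (isSmoothForm_zero (E := E) (X := X)) isSmoothForm_zero
      rw [add_zero] at h4
      rw [extD_zero]
      exact left_eq_add.1 h4
    | insert c T hc ih =>
      have h4 := hα.smul_fun (chartPartition E X c).contMDiff
      rw [Finset.sum_insert hc]
      refine ⟨h4.add ih.1, ?_⟩
      rw [extD_add h4 ih.1, formIntegral_add o b h4.extD ih.1.extD, ih.2, add_zero]
      refine formIntegral_extD_eq_zero_of_support b ho h4 (isClosed_tsupport _)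
        (tsupport_chartPartition c) fun p hp => ?_
      rw [notMem_tsupport_chartPartition hp]
      exact zero_smul ℝ (α p)
  rw [h2]
  exact (h3 T).2

end Stokes

/-! ### Exchange of series and integrals. -/

section SumIntegral

open MeasureTheory

variable {E : Type*} [NormedAddCommGroup E] [NormedSpace ℝ E]

theorem FlatForm.exists_bound {U K : Set E} (hK : IsCompact K) (hKU : K ⊆ U) {a : E → GForm E}
    (ha : FlatForm U a) : ∃ C : ℕ → ℝ, (∀ k, 0 ≤ C k) ∧ ∀ k, ∀ y ∈ K, ‖a y k‖ ≤ C k := by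
  have h : ∀ k, ∃ C, ∀ y ∈ K, ‖a y k‖ ≤ C := fun k =>
    hK.exists_bound_of_continuousOn ((ha k).continuousOn.mono hKU)
  choose C hC using h
  exact ⟨fun k => |C k|, fun k => abs_nonneg _, fun k y hy => (hC k y hy).trans (le_abs_self _)⟩

theorem FlatSmooth.exists_bound {U K : Set E} (hK : IsCompact K) (hKU : K ⊆ U)
    {a : ℤ → ℤ → E → GForm E} (ha : FlatSmooth U a) (N : ℕ) : ∃ C : ℕ → ℝ, (∀ k, 0 ≤ C k) ∧
      ∀ k, ∀ y ∈ K, ∀ i j, ‖a i j y k‖ ≤ (wt (i - j) ^ N)⁻¹ * C k := by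
  choose F hF hF' using fun k => ha k N
  have h : ∀ k, ∃ C, ∀ y ∈ K, ‖F k y‖ ≤ C := fun k =>
    hK.exists_bound_of_continuousOn ((hF k).continuousOn.mono hKU)
  choose C hC using h
  refine ⟨fun k => |C k|, fun k => abs_nonneg _, fun k y hy i j => ?_⟩
  have hw : 0 < wt (i - j) ^ N := pow_pos (wt_pos _) N
  have h1 := (BMat.norm_apply_le (F k y) (i, j)).trans ((hC k y hy).trans (le_abs_self _))
  rw [hF' k y (hKU hy), norm_smul, Real.norm_of_nonneg hw.le] at h1
  rw [inv_mul_eq_div, le_div_iff₀' hw]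
  exact h1

theorem norm_gwedge_le_of_le {α β : GForm E} {A B : ℕ → ℝ} (hA : ∀ k, 0 ≤ A k)
    (hα : ∀ k, ‖α k‖ ≤ A k) (hβ : ∀ k, ‖β k‖ ≤ B k) (m : ℕ) : ‖gwedge α β m‖ ≤
      ∑ p ∈ Finset.HasAntidiagonal.antidiagonal m, m.factorial * A p.1 * B p.2 := by
  refine (norm_gwedge_le α β m).trans (Finset.sum_le_sum fun p _ => ?_)
  have h1 : (m.factorial : ℝ) * ‖α p.1‖ ≤ m.factorial * A p.1 :=
    mul_le_mul_of_nonneg_left (hα _) (by positivity)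
  exact mul_le_mul h1 (hβ _) (norm_nonneg _) (mul_nonneg (by positivity) (hA _))

variable {X : Type*} [TopologicalSpace X] [ChartedSpace E X] [IsManifold 𝓘(ℝ, E) ∞ X]

theorem hasSum_gwedge_mulM {α β : MForm E X} (hα : IsSmoothMForm α) (hβ : IsSmoothMForm β)
    (γ : X → GForm E) (i j : ℤ) (p : X) (m : ℕ) :
    HasSum (fun k => gwedge (gwedge (α i k p) (β k j p)) (γ p) m)
      (gwedge (mulM α β i j p) (γ p) m) :=
  gwedge_tsum_left (fun q => (hα.decay p).summable_gwedge (hβ.decay p) q i j) (γ p) m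

/-- On a compact set, decay of order two of α and boundedness of β and γ dominate the series
uniformly. -/
theorem exists_bound_gwedge_mulM {α β : MForm E X} (hα : IsSmoothMForm α) (hβ : IsSmoothMForm β)
    {γ : X → GForm E} (hγ : IsSmoothForm γ) (i j : ℤ) (m : ℕ) (c : X) {K : Set E}
    (hK : IsCompact K) (hKc : K ⊆ (chartAt E c).target) : ∃ u : ℤ → ℝ, Summable u ∧
      ∀ k, ∀ y ∈ K,
        ‖inChart (fun p => gwedge (gwedge (α i k p) (β k j p)) (γ p)) c y m‖ ≤ u k := by
  obtain ⟨A, hA0, hA⟩ := (isSmoothMForm_iff.1 hα c).exists_bound hK hKc 2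
  obtain ⟨B, hB0, hB⟩ := (isSmoothMForm_iff.1 hβ c).exists_bound hK hKc 0
  obtain ⟨C, hC0, hC⟩ := (hγ.flatForm c).exists_bound hK hKc
  refine ⟨fun k => (wt (i - k) ^ 2)⁻¹ * ∑ p ∈ Finset.HasAntidiagonal.antidiagonal m,
    m.factorial * (∑ q ∈ Finset.HasAntidiagonal.antidiagonal p.1,
      p.1.factorial * A q.1 * B q.2) * C p.2, (summable_wt_sub i).mul_right _, fun k y hy => ?_⟩
  have hw : 0 ≤ (wt (i - k) ^ 2)⁻¹ := by have := wt_pos (i - k); positivity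
  have h1 : inChart (fun p => gwedge (gwedge (α i k p) (β k j p)) (γ p)) c y =
      gwedge (gwedge (inChart (α i k) c y) (inChart (β k j) c y)) (inChart γ c y) :=
    (gwedge_gcomp _ _ _).trans (congrArg (fun x => gwedge x _) (gwedge_gcomp _ _ _))
  rw [h1]
  have h2 := norm_gwedge_le_of_le (A := fun q => (wt (i - k) ^ 2)⁻¹ * A q) (B := B)
    (fun q => mul_nonneg hw (hA0 q)) (fun q => hA q y hy i k)
    (fun q => (hB q y hy k j).trans_eq (by rw [pow_zero, inv_one, one_mul]))
  refine (norm_gwedge_le_of_le (fun q => ?_) h2 (fun q => hC q y hy) m).trans_eq ?_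
  · exact Finset.sum_nonneg fun x _ => mul_nonneg (mul_nonneg (by positivity)
      (mul_nonneg hw (hA0 _))) (hB0 _)
  · simp only [Finset.mul_sum, Finset.sum_mul]
    refine Finset.sum_congr rfl fun p _ => Finset.sum_congr rfl fun q _ => ?_
    ring

variable [FiniteDimensional ℝ E] [MeasureSpace E] [BorelSpace E]
  [(volume : Measure E).IsAddHaarMeasure] [CompactSpace X] [T2Space X] {N : ℕ}

/-- Integration of a locally uniformly convergent series of forms. -/
theorem hasSum_formIntegral (o : X → ℤˣ) (b : Fin N → E) {ι : Type*} [Countable ι]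
    {β : ι → X → GForm E} {B : X → GForm E} (hβ : ∀ k, IsSmoothForm (β k))
    (hsum : ∀ p, HasSum (fun k => β k p N) (B p N))
    (hbound : ∀ c, ∀ K ⊆ (chartAt E c).target, IsCompact K → ∃ u : ι → ℝ, Summable u ∧
      ∀ k, ∀ y ∈ K, ‖inChart (β k) c y N‖ ≤ u k) :
    HasSum (fun k => formIntegral o b (β k)) (formIntegral o b B) := by
  obtain ⟨T, hT, -⟩ := exists_finset_chartPartition E X
  simp only [formIntegral_eq_sum hT]
  refine hasSum_sum fun c _ => HasSum.mul_left _ ?_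
  set ρ := chartPartition E X with hρ
  set K := chartAt E c '' tsupport (ρ c) with hKdef
  have hKt : K ⊆ (chartAt E c).target := by
    rintro _ ⟨p, hp, rfl⟩
    exact (chartAt E c).map_source (tsupport_chartPartition c hp)
  have hK : IsCompact K := (isClosed_tsupport (ρ c)).isCompact.image_of_continuousOn
    ((chartAt E c).continuousOn.mono (tsupport_chartPartition c))
  obtain ⟨u, hu, hu'⟩ := hbound c K hKt hK
  -- The partition function has its support in the chart image K, so constants times the indicator
  -- of K dominate the terms. They are integrable because K has finite measure.
  have hint : Integrable (K.indicator fun _ => (1 : ℝ))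
      (volume.restrict (chartAt E c).target) := by
    refine (integrable_indicator_iff hK.measurableSet).2 ?_
    exact integrableOn_const (ne_of_lt ((Measure.restrict_apply_le _ _).trans_lt hK.measure_lt_top))
  refine hasSum_integral_of_dominated_convergence
    (fun k y => u k * ((∏ i, ‖b i‖) * K.indicator (fun _ => (1 : ℝ)) y))
    (fun k => (integrableOn_chartPartition (hβ k) b c).aestronglyMeasurable) (fun k => ?_)
    (ae_of_all _ fun y => hu.mul_right _) ?_ ?_
  · refine (ae_restrict_iff' (chartAt E c).open_target.measurableSet).2 (ae_of_all _ fun y hy => ?_)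
    by_cases hyK : y ∈ K
    · rw [indicator_of_mem hyK, mul_one, norm_mul, Complex.norm_real,
        Real.norm_of_nonneg (ρ.nonneg c _)]
      have h1 := (inChart (β k) c y N).le_opNorm b
      have h2 := hu' k y hyK
      have h3 : ρ c ((chartAt E c).symm y) ≤ 1 := ρ.le_one c _
      have h4 : 0 ≤ ∏ i, ‖b i‖ := Finset.prod_nonneg fun i _ => norm_nonneg _
      calc _ ≤ 1 * ‖inChart (β k) c y N b‖ := mul_le_mul_of_nonneg_right h3 (norm_nonneg _)
        _ = ‖inChart (β k) c y N b‖ := one_mul _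
        _ ≤ _ := h1.trans (mul_le_mul_of_nonneg_right h2 h4)
    · have h1 : ρ c ((chartAt E c).symm y) = 0 := notMem_tsupport_chartPartition fun h =>
        hyK ⟨_, h, (chartAt E c).right_inv hy⟩
      rw [h1, indicator_of_notMem hyK]
      simp
  · simp only [tsum_mul_right]
    exact (hint.const_mul _).const_mul _
  · refine ae_of_all _ fun y => HasSum.mul_left _ ?_
    have h1 := ((hsum ((chartAt E c).symm y)).mapL
      (ContinuousAlternatingMap.compContinuousLinearMapCLM
        (mfderiv 𝓘(ℝ, E) 𝓘(ℝ, E) (chartAt E c).symm y : E →L[ℝ] E))).mapL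
      (ContinuousAlternatingMap.apply ℝ E ℂ b)
    exact h1

theorem hasSum_formIntegral_mulM (o : X → ℤˣ) (b : Fin N → E) {α β : MForm E X}
    (hα : IsSmoothMForm α) (hβ : IsSmoothMForm β) {γ : X → GForm E} (hγ : IsSmoothForm γ)
    (i j : ℤ) :
    HasSum (fun k => formIntegral o b fun p => gwedge (gwedge (α i k p) (β k j p)) (γ p))
      (formIntegral o b fun p => gwedge (mulM α β i j p) (γ p)) :=
  hasSum_formIntegral o b
    (fun k => ((hα.isSmoothForm i k).gwedge (hβ.isSmoothForm k j)).gwedge hγ)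
    (fun p => hasSum_gwedge_mulM hα hβ γ i j p N)
    (fun c _ hK hKc => exists_bound_gwedge_mulM hα hβ hγ i j N c hKc hK)

end SumIntegral

/-! ### Closedness and trace property of τ. -/

section Trace

open MeasureTheory

instance isAddHaarMeasure_sCoord (n : ℕ) :
    (volume : Measure (SCoord n)).IsAddHaarMeasure :=
  Measure.prod.instIsAddHaarMeasure (volume : Measure (Coord (n + 1)))
    (volume : Measure (Fin n → ℝ))

theorem exists_basis_sBasis (n : ℕ) :
    ∃ b : Module.Basis (Fin ((n + 1) + n)) ℝ (SCoord n), ⇑b = sBasis n := by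
  refine ⟨((EuclideanSpace.basisFun (Fin (n + 1)) ℝ).toBasis.prod
    (Pi.basisFun ℝ (Fin n))).reindex finSumFinEquiv, ?_⟩
  funext i
  rw [Module.Basis.reindex_apply]
  refine Fin.addCases (fun j => ?_) (fun j => ?_) i
  · rw [finSumFinEquiv_symm_apply_castAdd, sBasis, Fin.addCases_left]
    simp
  · rw [finSumFinEquiv_symm_apply_natAdd, sBasis, Fin.addCases_right]
    simp

variable {n : ℕ} {M : Type*} [TopologicalSpace M] [ChartedSpace (Coord (n + 1)) M]
  [IsManifold (𝓡 (n + 1)) ∞ M] {h : Metric (n + 1) M}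
  {g : M ≃ₘ^∞⟮𝓡 (n + 1), 𝓡 (n + 1)⟯ M}

theorem isSmoothForm_pullback_base {Td : M → GForm (Coord (n + 1))} (hTd : IsSmoothForm Td) :
    IsSmoothForm (pullback (E := SCoord n) (Cosphere.base (h := h)) Td) :=
  hTd.pullback contMDiff_base

/-- The projection to M intertwines ∂g with g, so invariance of Td passes to its pullback. -/
theorem pullback_codiff_base (hg : IsIsometric h g) {Td : M → GForm (Coord (n + 1))}
    (hTdg : pullback g Td = Td) : pullback (E := SCoord n) (codiff hg)
      (pullback (E := SCoord n) (Cosphere.base (h := h)) Td) = pullback Cosphere.base Td := by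
  funext p
  have h1 : pullback (E := SCoord n) ((Cosphere.base (h := h)) ∘ codiff hg) Td p =
      pullback (E := SCoord n) (g ∘ (Cosphere.base (h := h))) Td p := rfl
  rw [pullback_comp (E' := SCoord n)
      (contMDiff_base.mdifferentiableAt (by simp))
      ((contMDiff_codiff hg).mdifferentiableAt (by simp)),
    pullback_comp (E' := Coord (n + 1)) (g.contMDiff.mdifferentiableAt (by simp))
      (contMDiff_base.mdifferentiableAt (by simp)), hTdg] at h1
  exact h1

variable [T2Space M] [CompactSpace M]

theorem cosphereIntegral_extD {α : Cosphere h → GForm (SCoord n)} (hα : IsSmoothForm α) :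
    cosphereIntegral (extD α) = 0 := by
  obtain ⟨b, hb⟩ := exists_basis_sBasis n
  rw [cosphereIntegral, ← hb]
  exact formIntegral_extD b preservesOrientation_id hα

theorem cosphereIntegral_pullback (hg : IsIsometric h g) {α : Cosphere h → GForm (SCoord n)}
    (hα : IsSmoothForm α) : cosphereIntegral (pullback (codiff hg) α) = cosphereIntegral α := by
  obtain ⟨b, hb⟩ := exists_basis_sBasis n
  rw [cosphereIntegral, cosphereIntegral, ← hb]
  exact formIntegral_pullback b (contMDiff_codiff hg) (contMDiff_codiff hg.symm).continuous
    (codiff_symm_codiff hg) (symm_symm_codiff hg) (preservesOrientation_codiff hg) hα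

theorem cosphereIntegral_add {α β : Cosphere h → GForm (SCoord n)} (hα : IsSmoothForm α)
    (hβ : IsSmoothForm β) :
    cosphereIntegral (α + β) = cosphereIntegral α + cosphereIntegral β :=
  formIntegral_add _ _ hα hβ

theorem cosphereIntegral_smul (z : ℂ) (α : Cosphere h → GForm (SCoord n)) :
    cosphereIntegral (z • α) = z * cosphereIntegral α :=
  formIntegral_smul _ _ z α

theorem tau_add {Td : M → GForm (Coord (n + 1))} (hTd : IsSmoothForm Td)
    {α β : MForm (SCoord n) (Cosphere h)} (hα : IsSmoothMForm α) (hβ : IsSmoothMForm β) :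
    tau Td (α + β) = tau Td α + tau Td β := by
  have hT := isSmoothForm_pullback_base (h := h) hTd
  have h1 := cosphereIntegral_add ((hα.isSmoothForm 0 0).gwedge hT)
    ((hβ.isSmoothForm 0 0).gwedge hT)
  refine Eq.trans (congrArg cosphereIntegral (funext fun p => ?_)) h1
  exact gwedge_add_left _ _ _

theorem tau_smul (Td : M → GForm (Coord (n + 1))) (z : ℂ) (α : MForm (SCoord n) (Cosphere h)) :
    tau Td (z • α) = z * tau Td α := by
  have h1 := cosphereIntegral_smul z
    fun p => gwedge (α 0 0 p) (pullback (E := SCoord n) Cosphere.base Td p)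
  refine Eq.trans (congrArg cosphereIntegral (funext fun p => ?_)) h1
  exact gwedge_smul_left _ _ _

/-- Since the pullback of Td is closed, the Leibniz rule exhibits dα₀₀ ∧ Td as the differential of
α₀₀ ∧ Td, and Stokes' theorem applies. -/
theorem tau_dM {Td : M → GForm (Coord (n + 1))} (hTd : IsSmoothForm Td) (hd : extD Td = 0)
    {α : MForm (SCoord n) (Cosphere h)} (hα : IsSmoothMForm α) : tau Td (dM α) = 0 := by
  have hT := isSmoothForm_pullback_base (h := h) hTd
  have h0 := hα.isSmoothForm 0 0
  rw [← cosphereIntegral_extD (h0.gwedge hT), extD_gwedge h0 hT,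
    extD_pullback contMDiff_base hTd, hd, pullback_zero]
  refine congrArg cosphereIntegral (funext fun p => ?_)
  have h1 : gwedge (signDeg (α 0 0 p)) ((0 : Cosphere h → GForm (SCoord n)) p) = 0 :=
    gwedge_zero_right _
  rw [h1, add_zero]
  rfl

/-- The terms of the trace of a product. -/
def traceTerm (Td : M → GForm (Coord (n + 1))) (α β : MForm (SCoord n) (Cosphere h)) (i k : ℤ) :
    ℂ :=
  cosphereIntegral fun p => gwedge (gwedge (α i k p) (β k i p)) (pullback Cosphere.base Td p)

theorem hasSum_traceTerm {Td : M → GForm (Coord (n + 1))} (hTd : IsSmoothForm Td)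
    {α β : MForm (SCoord n) (Cosphere h)} (hα : IsSmoothMForm α) (hβ : IsSmoothMForm β) :
    HasSum (fun k => traceTerm Td α β 0 k) (tau Td (mulM α β)) :=
  hasSum_formIntegral_mulM _ _ hα hβ (isSmoothForm_pullback_base hTd) 0 0

theorem traceTerm_comm (Td : M → GForm (Coord (n + 1))) {α β : MForm (SCoord n) (Cosphere h)}
    {k l : ℕ} (hα : ∀ i j p, IsHomogeneous k (α i j p)) (hβ : ∀ i j p, IsHomogeneous l (β i j p))
    (i j : ℤ) : traceTerm Td α β i j = (-1 : ℂ) ^ (k * l) * traceTerm Td β α j i := by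
  have h1 := cosphereIntegral_smul ((-1 : ℂ) ^ (k * l)) fun p =>
    gwedge (gwedge (β j i p) (α i j p)) (pullback (E := SCoord n) Cosphere.base Td p)
  refine Eq.trans (congrArg cosphereIntegral (funext fun p => ?_)) h1
  refine Eq.trans ?_ (gwedge_smul_left _ _ _)
  rw [gwedge_comm (hα i j p) (hβ j i p)]

/-- By invariance of α, β and Td, the shifted integrand is the pullback of the original one under
∂g, which does not change the integral. -/
theorem traceTerm_succ (hg : IsIsometric h g) {Td : M → GForm (Coord (n + 1))}
    (hTd : IsSmoothForm Td) (hTdg : pullback g Td = Td)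
    {α β : MForm (SCoord n) (Cosphere h)} (hα : α ∈ Omega hg) (hβ : β ∈ Omega hg) (i j : ℤ) :
    traceTerm Td α β (i + 1) (j + 1) = traceTerm Td α β i j := by
  rw [traceTerm, traceTerm, ← cosphereIntegral_pullback hg
    (((hα.1.isSmoothForm i j).gwedge (hβ.1.isSmoothForm j i)).gwedge
      (isSmoothForm_pullback_base hTd))]
  refine congrArg cosphereIntegral (funext fun p => ?_)
  rw [← hα.2, ← hβ.2]
  refine Eq.symm ((gwedge_gcomp _ _ _).trans ?_)
  refine Eq.trans (congrArg (fun x => gwedge x _) (gwedge_gcomp _ _ _)) ?_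
  exact congrArg _ (congrFun (pullback_codiff_base hg hTdg) p)

theorem traceTerm_add (hg : IsIsometric h g) {Td : M → GForm (Coord (n + 1))}
    (hTd : IsSmoothForm Td) (hTdg : pullback g Td = Td)
    {α β : MForm (SCoord n) (Cosphere h)} (hα : α ∈ Omega hg) (hβ : β ∈ Omega hg) (i j m : ℤ) :
    traceTerm Td α β (i + m) (j + m) = traceTerm Td α β i j := by
  induction m using Int.induction_on with
  | zero => rw [add_zero, add_zero]
  | succ m ih => rw [← add_assoc, ← add_assoc, traceTerm_succ hg hTd hTdg hα hβ, ih]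
  | pred m ih =>
    rw [← ih, ← traceTerm_succ hg hTd hTdg hα hβ (i + (-m - 1))]
    congr 1 <;> ring

/-- The trace property. -/
theorem tau_mulM_comm (hg : IsIsometric h g) {Td : M → GForm (Coord (n + 1))}
    (hTd : IsSmoothForm Td) (hTdg : pullback g Td = Td) {k l : ℕ}
    {α β : MForm (SCoord n) (Cosphere h)} (hα : α ∈ OmegaDeg hg k) (hβ : β ∈ OmegaDeg hg l) :
    tau Td (mulM α β) = (-1 : ℂ) ^ (k * l) * tau Td (mulM β α) := by
  have h1 := (hasSum_traceTerm hTd hβ.1.1 hα.1.1).mul_left ((-1 : ℂ) ^ (k * l))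
  have h2 := (Equiv.neg ℤ).hasSum_iff.2 (hasSum_traceTerm hTd hα.1.1 hβ.1.1)
  refine h2.unique ?_
  -- Shifting both indices by m moves (0, -m) to (m, 0). Exchanging the two forms then gives the
  -- summand with index m of the other product.
  have h3 : ∀ m : ℤ, traceTerm Td α β 0 (-m) = (-1 : ℂ) ^ (k * l) * traceTerm Td β α 0 m := by
    intro m
    rw [← traceTerm_add hg hTd hTdg hα.1 hβ.1 0 (-m) m, zero_add, neg_add_cancel]
    exact traceTerm_comm Td (fun i j p => hα.2 i j p) (fun i j p => hβ.2 i j p) m 0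
  exact (funext h3 : (fun k => traceTerm Td α β 0 k) ∘ Equiv.neg ℤ = _) ▸ h1

end Trace

/-! ### Homogeneous components. -/

section Grading

variable {E : Type*} [NormedAddCommGroup E] [NormedSpace ℝ E]

theorem form_eq_zero_of_finrank_lt [FiniteDimensional ℝ E] {k : ℕ} (hk : Module.finrank ℝ E < k)
    (α : E [⋀^Fin k]→L[ℝ] ℂ) : α = 0 := by
  ext v
  refine α.toAlternatingMap.map_linearDependent v fun hv => ?_
  have h1 := hv.fintype_card_le_finrank
  rw [Fintype.card_fin] at h1
  exact absurd hk (not_lt.2 h1)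

theorem flatD_homogeneous {k : ℕ} {a : E → GForm E} (ha : ∀ y, IsHomogeneous k (a y)) (y : E) :
    IsHomogeneous (k + 1) (flatD a y) := by
  intro m hm
  cases m with
  | zero => rfl
  | succ m =>
    have h1 : (fun z => a z m) = 0 := funext fun z => ha z m fun h => hm (h ▸ rfl)
    change extDeriv (fun z => a z m) y = 0
    rw [h1, extDeriv, fderiv_zero]
    exact alternatizeUncurryFin_zero _

variable {X : Type*} [TopologicalSpace X] [ChartedSpace E X]

theorem extD_homogeneous {k : ℕ} {α : X → GForm E} (hα : ∀ p, IsHomogeneous k (α p)) (p : X) :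
    IsHomogeneous (k + 1) (extD α p) :=
  flatD_homogeneous (fun y m hm => by
    have h1 : inChart α p y m = (α ((chartAt E p).symm y) m).compContinuousLinearMap
      (mfderiv 𝓘(ℝ, E) 𝓘(ℝ, E) (chartAt E p).symm y : E →L[ℝ] E) := rfl
    rw [h1, hα _ m hm]
    rfl) _

/-- The component of degree `k`. -/
def degM (k : ℕ) (α : MForm E X) : MForm E X := fun i j p m => if m = k then α i j p m else 0

theorem sum_degM (α : MForm E X) (s : Finset ℕ) (hs : ∀ k ∉ s, ∀ i j p, α i j p k = 0) :
    ∑ k ∈ s, degM k α = α := by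
  funext i j p m
  simp only [Finset.sum_apply, degM, Finset.sum_ite_eq]
  split_ifs with h
  · rfl
  · exact (hs m h i j p).symm

theorem pullback_degM {E' : Type*} [NormedAddCommGroup E'] [NormedSpace ℝ E'] {Y : Type*}
    [TopologicalSpace Y] [ChartedSpace E' Y] (f : X → Y) (k : ℕ) (α : MForm E' Y) (i j : ℤ) :
    pullback (E := E) f (degM k α i j) = degM k (fun i j => pullback f (α i j)) i j := by
  funext p m
  simp only [pullback, degM]
  split_ifs <;> rfl

theorem IsSmoothMForm.degM {α : MForm E X} (hα : IsSmoothMForm α) (k : ℕ) :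
    IsSmoothMForm (degM k α) := by
  intro c m N
  have h1 : ∀ i j, inChart (ClosedTrace.degM k α i j) c =
      ClosedTrace.degM k (fun i j => inChart (α i j) c) i j := pullback_degM _ k α
  simp only [h1, ClosedTrace.degM]
  by_cases hm : m = k
  · simp only [if_pos hm]
    exact hα c m N
  · simp only [if_neg hm]
    refine ⟨0, contDiffOn_const, fun y _ i j => ?_⟩
    ext v
    exact (mul_zero _).symm

/-- The component of degree `k`, as a linear map. -/
def degComponent (E X : Type*) [NormedAddCommGroup E] [NormedSpace ℝ E] (k : ℕ) :
    MForm E X →ₗ[ℂ] ℤ → ℤ → X → E [⋀^Fin k]→L[ℝ] ℂ where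
  toFun α i j p := α i j p k
  map_add' _ _ := rfl
  map_smul' _ _ := rfl

theorem signM_homogeneous {k : ℕ} {α : MForm E X} (hα : ∀ i j p, IsHomogeneous k (α i j p)) :
    signM α = (-1 : ℂ) ^ k • α :=
  funext fun i => funext fun j => funext fun p => signDeg_homogeneous (hα i j p)

/-- The summation index is shifted by one. With this, products of invariant matrices are invariant.
-/
theorem mulM_shift (α β : MForm E X) (i j : ℤ) :
    mulM (fun i j => α (i + 1) (j + 1)) (fun i j => β (i + 1) (j + 1)) i j =
      mulM α β (i + 1) (j + 1) := by
  funext p m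
  exact (Equiv.addRight (1 : ℤ)).tsum_eq fun k => gwedge (α (i + 1) k p) (β k (j + 1) p) m

end Grading

/-! ### Ω as a graded space closed under product and differential. -/

section OmegaStructure

variable {n : ℕ} {M : Type*} [TopologicalSpace M] [ChartedSpace (Coord (n + 1)) M]
  [IsManifold (𝓡 (n + 1)) ∞ M] {h : Metric (n + 1) M}
  {g : M ≃ₘ^∞⟮𝓡 (n + 1), 𝓡 (n + 1)⟯ M}

theorem mulM_mem_Omega {hg : IsIsometric h g} {α β : MForm (SCoord n) (Cosphere h)}
    (hα : α ∈ Omega hg) (hβ : β ∈ Omega hg) : mulM α β ∈ Omega hg := by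
  refine ⟨hα.1.mulM hβ.1, fun i j => ?_⟩
  rw [pullback_mulM hα.1 hβ.1]
  simp only [hα.2, hβ.2]
  exact mulM_shift α β i j

/-- Invariance is preserved because the exterior derivative commutes with pullback by ∂g. -/
theorem dM_mem_Omega {hg : IsIsometric h g} {α : MForm (SCoord n) (Cosphere h)}
    (hα : α ∈ Omega hg) : dM α ∈ Omega hg := by
  refine ⟨hα.1.dM, fun i j => ?_⟩
  rw [dM, ← extD_pullback (contMDiff_codiff hg) (hα.1.isSmoothForm i j), hα.2]
  rfl

theorem mulM_mem_OmegaDeg {hg : IsIsometric h g} {k l : ℕ} {α β : MForm (SCoord n) (Cosphere h)}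
    (hα : α ∈ OmegaDeg hg k) (hβ : β ∈ OmegaDeg hg l) : mulM α β ∈ OmegaDeg hg (k + l) :=
  ⟨mulM_mem_Omega hα.1 hβ.1, fun i j p =>
    mulP_homogeneous (fun i j => hα.2 i j p) (fun i j => hβ.2 i j p) i j⟩

theorem dM_mem_OmegaDeg {hg : IsIsometric h g} {k : ℕ} {α : MForm (SCoord n) (Cosphere h)}
    (hα : α ∈ OmegaDeg hg k) : dM α ∈ OmegaDeg hg (k + 1) :=
  ⟨dM_mem_Omega hα.1, fun i j p => extD_homogeneous (fun p => hα.2 i j p) p⟩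

theorem degM_mem_OmegaDeg {hg : IsIsometric h g} {α : MForm (SCoord n) (Cosphere h)}
    (hα : α ∈ Omega hg) (k : ℕ) : degM k α ∈ OmegaDeg hg k := by
  refine ⟨⟨hα.1.degM k, fun i j => ?_⟩, fun i j p m hm => if_neg hm⟩
  rw [pullback_degM]
  simp only [hα.2]
  rfl

theorem sCoord_form_eq_zero {k : ℕ} (hk : (n + 1) + n < k) (α : SCoord n [⋀^Fin k]→L[ℝ] ℂ) :
    α = 0 := by
  refine form_eq_zero_of_finrank_lt ?_ α
  obtain ⟨b, -⟩ := exists_basis_sBasis n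
  rwa [Module.finrank_eq_card_basis b, Fintype.card_fin]

/-- A form is the finite sum of its components of degree at most 2n + 1, the dimension of S*M, and
each component is again smooth and invariant. -/
theorem iSup_OmegaDeg (hg : IsIsometric h g) : ⨆ k, OmegaDeg hg k = Omega hg := by
  refine le_antisymm (iSup_le fun k => inf_le_left) fun α hα => ?_
  rw [← sum_degM α (Finset.range ((n + 1) + n + 1)) fun k hk i j p =>
    sCoord_form_eq_zero (by simpa using hk) _]
  exact Submodule.sum_mem _ fun k _ => Submodule.mem_iSup_of_mem k (degM_mem_OmegaDeg hα k)

/-- The linear map taking the component of degree k annihilates all other homogeneous parts and is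
injective on this one. -/
theorem iSupIndep_OmegaDeg (hg : IsIsometric h g) : iSupIndep (OmegaDeg hg) := by
  intro k
  rw [Submodule.disjoint_def]
  intro α hα hα'
  have h1 : ⨆ j, ⨆ (_ : j ≠ k), OmegaDeg hg j ≤
      LinearMap.ker (degComponent (SCoord n) (Cosphere h) k) := by
    refine iSup_le fun j => iSup_le fun hj β hβ => LinearMap.mem_ker.2 ?_
    funext i l p
    exact hβ.2 i l p k hj.symm
  have h2 := LinearMap.mem_ker.1 (h1 hα')
  funext i j p m
  by_cases hm : m = k
  · subst hm
    exact congrFun (congrFun (congrFun h2 i) j) p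
  · exact hα.2 i j p m hm

theorem OmegaDeg_eq_bot (hg : IsIsometric h g) {k : ℕ} (hk : (n + 1) + n < k) :
    OmegaDeg hg k = ⊥ := by
  refine (Submodule.eq_bot_iff _).2 fun α hα => ?_
  funext i j p m
  by_cases hm : m = k
  · subst hm
    exact sCoord_form_eq_zero hk _
  · exact hα.2 i j p m hm

end OmegaStructure

/-! ### Matrix-valued functions as forms of degree 0. -/

section ZeroForms

variable {A B : Type*} [NormedAddCommGroup A] [NormedSpace ℝ A] [NormedAddCommGroup B]
  [NormedSpace ℝ B] {E : Type*} [NormedAddCommGroup E] [NormedSpace ℝ E]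

/-- Entrywise application of a continuous linear map. -/
theorem BMat.exists_map (Φ : A →L[ℝ] B) :
    ∃ T : BMat A →L[ℝ] BMat B, ∀ a i j, T a (i, j) = Φ (a (i, j)) := by
  have hb : ∀ (a : BMat A) (p : ℤ × ℤ), ‖Φ (a p)‖ ≤ ‖Φ‖ * ‖a‖ := fun a p =>
    (Φ.le_opNorm _).trans (mul_le_mul_of_nonneg_left (BMat.norm_apply_le a p) (norm_nonneg _))
  let T : BMat A →ₗ[ℝ] BMat B :=
    { toFun := fun a => BMat.mk (fun p => Φ (a p)) _ (hb a)
      map_add' := fun a a' => BMat.ext fun i j => Φ.map_add _ _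
      map_smul' := fun c a => BMat.ext fun i j => Φ.map_smul c _ }
  exact ⟨T.mkContinuous ‖Φ‖ fun a => BMat.norm_mk_le _ _ (hb a), fun a i j => rfl⟩

/-- Scalars as `0`-forms. -/
def constForm (E : Type*) [NormedAddCommGroup E] [NormedSpace ℝ E] :
    ℂ →L[ℝ] E [⋀^Fin 0]→L[ℝ] ℂ :=
  LinearMap.mkContinuous
    { toFun := ContinuousAlternatingMap.constOfIsEmpty ℝ E (Fin 0)
      map_add' := fun _ _ => rfl
      map_smul' := fun _ _ => rfl } 1
    fun z => ContinuousAlternatingMap.opNorm_le_bound _ (by positivity) fun v => by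
      rw [one_mul, Finset.univ_eq_empty, Finset.prod_empty, mul_one]
      rfl

/-- The value of a `0`-form. -/
def formValue (E : Type*) [NormedAddCommGroup E] [NormedSpace ℝ E] :
    (E [⋀^Fin 0]→L[ℝ] ℂ) →L[ℝ] ℂ := ContinuousAlternatingMap.apply ℝ E ℂ 0

theorem constForm_formValue (α : E [⋀^Fin 0]→L[ℝ] ℂ) : constForm E (formValue E α) = α := by
  ext v
  exact congrArg α (Subsingleton.elim _ _)

theorem gscalar_formValue {α : GForm E} (hα : IsHomogeneous 0 α) :
    gscalar (formValue E (α 0)) = α := by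
  funext k
  cases k with
  | zero => exact constForm_formValue (α 0)
  | succ k => exact (hα (k + 1) k.succ_ne_zero).symm

theorem gscalar_homogeneous (z : ℂ) : IsHomogeneous 0 (gscalar z : GForm E) := fun m hm => by
  cases m with
  | zero => exact absurd rfl hm
  | succ m => rfl

theorem gcomp_gscalar {E' : Type*} [NormedAddCommGroup E'] [NormedSpace ℝ E'] (z : ℂ)
    (L : E →L[ℝ] E') : gcomp (gscalar z) L = gscalar z := by
  funext k
  cases k <;> rfl

theorem gscalar_gwedge_gscalar (z w : ℂ) :
    gwedge (gscalar z) (gscalar w) = (gscalar (z * w) : GForm E) := by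
  rw [gscalar_gwedge]
  funext k
  cases k with
  | zero => rfl
  | succ k => exact form_smul_zero z

variable {X : Type*} [TopologicalSpace X] [ChartedSpace E X]

theorem ofFun_injective : Function.Injective (ofFun : (X → ℤ → ℤ → ℂ) → MForm E X) := by
  intro f f' hf
  funext p i j
  exact congrArg (formValue E) (congrFun (congrFun (congrFun (congrFun hf i) j) p) 0)

theorem pullback_ofFun {E' : Type*} [NormedAddCommGroup E'] [NormedSpace ℝ E'] {Y : Type*}
    [TopologicalSpace Y] [ChartedSpace E' Y] (φ : X → Y) (f : Y → ℤ → ℤ → ℂ) (i j : ℤ) :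
    pullback (E := E) φ (ofFun (E := E') f i j) = fun p => gscalar (f (φ p) i j) :=
  funext fun _ => gcomp_gscalar _ _

/-- Scalars and 0-forms are identified by continuous linear maps in both directions, which act
entrywise on bounded matrices. The components of positive degree are zero. -/
theorem isSmoothMForm_ofFun_iff {f : X → ℤ → ℤ → ℂ} :
    IsSmoothMForm (ofFun f : MForm E X) ↔ IsSmoothMFun (E := E) f := by
  have h1 : ∀ c i j, inChart (ofFun f i j : X → GForm E) c =
      fun y => gscalar (f ((chartAt E c).symm y) i j) := fun c => pullback_ofFun _ f
  constructor
  · intro hf c N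
    obtain ⟨F, hF, hF'⟩ := hf c 0 N
    obtain ⟨T, hT⟩ := BMat.exists_map (formValue E)
    refine ⟨fun y => T (F y), contDiffOn_clm T hF, fun y hy i j => ?_⟩
    rw [hT, hF' y hy, map_smul, h1]
    rfl
  · intro hf c k N
    cases k with
    | zero =>
      obtain ⟨F, hF, hF'⟩ := hf c N
      obtain ⟨T, hT⟩ := BMat.exists_map (constForm E)
      refine ⟨fun y => T (F y), contDiffOn_clm T hF, fun y hy i j => ?_⟩
      rw [hT, hF' y hy, map_smul, h1]
      rfl
    | succ k =>
      refine ⟨0, contDiffOn_const, fun y _ i j => ?_⟩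
      rw [h1]
      ext v
      exact (mul_zero _).symm

variable [IsManifold 𝓘(ℝ, E) ∞ X]

/-- Both sides have degree 0, so it is enough to compare values. Evaluation of 0-forms is continuous
and thus passes through the series of the product. -/
theorem ofFun_mulF {f f' : X → ℤ → ℤ → ℂ} (hf : IsSmoothMForm (ofFun f : MForm E X))
    (hf' : IsSmoothMForm (ofFun f' : MForm E X)) :
    (ofFun (mulF f f') : MForm E X) = mulM (ofFun f) (ofFun f') := by
  funext i j p
  have h1 : IsHomogeneous 0 (mulM (ofFun f : MForm E X) (ofFun f') i j p) :=
    mulP_homogeneous (k := 0) (l := 0) (fun i j => gscalar_homogeneous _)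
      (fun i j => gscalar_homogeneous _) i j
  rw [← gscalar_formValue h1]
  refine congrArg gscalar ?_
  have h2 := (((hf.decay p).summable_gwedge (hf'.decay p) 0 i j).hasSum.mapL
    (formValue E)).tsum_eq
  refine Eq.trans (tsum_congr fun k => ?_) h2
  change _ = formValue E (gwedge (gscalar (f p i k)) (gscalar (f' p k j)) 0)
  rw [gscalar_gwedge_gscalar]
  rfl

end ZeroForms

/-! ### The algebra of symbols and the cycle over it. -/

section SymbolAlgebra

variable {n : ℕ} {M : Type*} [TopologicalSpace M] [ChartedSpace (Coord (n + 1)) M]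
  [IsManifold (𝓡 (n + 1)) ∞ M] {h : Metric (n + 1) M}
  {g : M ≃ₘ^∞⟮𝓡 (n + 1), 𝓡 (n + 1)⟯ M}

theorem ofFun_mem_OmegaDeg_iff {hg : IsIsometric h g} {f : Cosphere h → ℤ → ℤ → ℂ} :
    (ofFun f : MForm (SCoord n) (Cosphere h)) ∈ OmegaDeg hg 0 ↔ f ∈ Symbols hg := by
  constructor
  · intro hf
    refine ⟨isSmoothMForm_ofFun_iff.1 hf.1.1, fun p i j => ?_⟩
    have h1 := hf.1.2 i j
    rw [pullback_ofFun] at h1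
    exact congrArg (formValue (SCoord n)) (congrFun (congrFun h1 p) 0)
  · intro hf
    refine ⟨⟨isSmoothMForm_ofFun_iff.2 hf.1, fun i j => ?_⟩,
      fun i j p => gscalar_homogeneous _⟩
    rw [pullback_ofFun]
    exact funext fun p => congrArg gscalar (hf.2 p i j)

theorem bijOn_ofFun (hg : IsIsometric h g) :
    Set.BijOn ofFun (Symbols hg : Set (Cosphere h → ℤ → ℤ → ℂ))
      (OmegaDeg hg 0 : Set (MForm (SCoord n) (Cosphere h))) := by
  refine ⟨fun f hf => ofFun_mem_OmegaDeg_iff.2 hf, ofFun_injective.injOn, fun α hα => ?_⟩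
  have h1 : ofFun (fun p i j => formValue (SCoord n) (α i j p 0)) = α :=
    funext fun i => funext fun j => funext fun p => gscalar_formValue (hα.2 i j p)
  exact ⟨_, ofFun_mem_OmegaDeg_iff.1 (h1.symm ▸ hα), h1⟩

theorem oneF_mem_Symbols (hg : IsIsometric h g) : oneF ∈ Symbols hg := by
  refine ⟨fun c N => ?_, fun p i j => by simp [oneF]⟩
  let F : BMat ℂ := BMat.mk (fun p => if p.1 = p.2 then 1 else 0) 1 fun p => by
    split_ifs <;> simp
  refine ⟨fun _ => F, contDiffOn_const, fun y _ i j => ?_⟩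
  change (if i = j then (1 : ℂ) else 0) = _ • (if i = j then (1 : ℂ) else 0)
  by_cases hij : i = j
  · subst hij
    simp
  · rw [if_neg hij, smul_zero]

theorem ofFun_mul {hg : IsIsometric h g} {f f' : Cosphere h → ℤ → ℤ → ℂ} (hf : f ∈ Symbols hg)
    (hf' : f' ∈ Symbols hg) :
    (ofFun (mulF f f') : MForm (SCoord n) (Cosphere h)) = mulM (ofFun f) (ofFun f') :=
  ofFun_mulF (ofFun_mem_OmegaDeg_iff.2 hf).1.1 (ofFun_mem_OmegaDeg_iff.2 hf').1.1

theorem ofFun_add (f f' : Cosphere h → ℤ → ℤ → ℂ) :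
    (ofFun (f + f') : MForm (SCoord n) (Cosphere h)) = ofFun f + ofFun f' := by
  funext i j p k
  cases k with
  | zero => rfl
  | succ k => exact (add_zero _).symm

theorem ofFun_smul (z : ℂ) (f : Cosphere h → ℤ → ℤ → ℂ) :
    (ofFun (z • f) : MForm (SCoord n) (Cosphere h)) = z • ofFun f := by
  funext i j p k
  cases k with
  | zero => rfl
  | succ k => exact (form_smul_zero z).symm

theorem isAlgebraOn_Omega (hg : IsIsometric h g) :
    IsAlgebraOn (Omega hg) mulM (ofFun oneF) where
  mul_mem _ hα _ hβ := mulM_mem_Omega hα hβ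
  one_mem := (ofFun_mem_OmegaDeg_iff.2 (oneF_mem_Symbols hg)).1
  one_mul α _ := ofFun_oneF_mulM α
  mul_one α _ := mulM_ofFun_oneF α
  assoc _ hα _ hβ _ hγ := mulM_assoc hα.1 hβ.1 hγ.1
  add_mul _ hα _ hβ _ hγ := mulM_add_left hα.1 hβ.1 hγ.1
  mul_add _ hα _ hβ _ hγ := mulM_add_right hα.1 hβ.1 hγ.1
  smul_mul z _ hα _ hβ := mulM_smul_left z hα.1 hβ.1
  mul_smul z _ hα _ hβ := mulM_smul_right z hα.1 hβ.1

theorem mulF_mem_Symbols {hg : IsIsometric h g} {f f' : Cosphere h → ℤ → ℤ → ℂ}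
    (hf : f ∈ Symbols hg) (hf' : f' ∈ Symbols hg) : mulF f f' ∈ Symbols hg := by
  rw [← ofFun_mem_OmegaDeg_iff, ofFun_mul hf hf']
  exact mulM_mem_OmegaDeg (ofFun_mem_OmegaDeg_iff.2 hf) (ofFun_mem_OmegaDeg_iff.2 hf')

/-- The axioms are inherited from Ω along the injective map `ofFun`, which respects sums, scalars,
products and the unit. -/
theorem isAlgebraOn_Symbols (hg : IsIsometric h g) : IsAlgebraOn (Symbols hg) mulF oneF := by
  have hinj := ofFun_injective (E := SCoord n) (X := Cosphere h)
  have hO := isAlgebraOn_Omega hg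
  have hm : ∀ {f}, f ∈ Symbols hg → (ofFun f : MForm (SCoord n) (Cosphere h)) ∈ Omega hg :=
    fun hf => (ofFun_mem_OmegaDeg_iff.2 hf).1
  have h1 := oneF_mem_Symbols hg
  refine ⟨fun _ hf _ hf' => mulF_mem_Symbols hf hf', h1, ?_, ?_, ?_, ?_, ?_, ?_, ?_⟩
  · intro f hf
    apply hinj
    rw [ofFun_mul h1 hf, hO.one_mul _ (hm hf)]
  · intro f hf
    apply hinj
    rw [ofFun_mul hf h1, hO.mul_one _ (hm hf)]
  · intro a ha b hb c hc
    apply hinj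
    rw [ofFun_mul (mulF_mem_Symbols ha hb) hc, ofFun_mul ha hb,
      ofFun_mul ha (mulF_mem_Symbols hb hc), ofFun_mul hb hc, hO.assoc _ (hm ha) _ (hm hb) _ (hm hc)]
  · intro a ha b hb c hc
    apply hinj
    rw [ofFun_mul (add_mem ha hb) hc, ofFun_add, ofFun_add, ofFun_mul ha hc, ofFun_mul hb hc,
      hO.add_mul _ (hm ha) _ (hm hb) _ (hm hc)]
  · intro a ha b hb c hc
    apply hinj
    rw [ofFun_mul ha (add_mem hb hc), ofFun_add, ofFun_add, ofFun_mul ha hb, ofFun_mul ha hc,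
      hO.mul_add _ (hm ha) _ (hm hb) _ (hm hc)]
  · intro z a ha b hb
    apply hinj
    rw [ofFun_mul (Submodule.smul_mem _ z ha) hb, ofFun_smul, ofFun_smul, ofFun_mul ha hb,
      hO.smul_mul z _ (hm ha) _ (hm hb)]
  · intro z a ha b hb
    apply hinj
    rw [ofFun_mul ha (Submodule.smul_mem _ z hb), ofFun_smul, ofFun_smul, ofFun_mul ha hb,
      hO.mul_smul z _ (hm ha) _ (hm hb)]

variable [T2Space M] [CompactSpace M]

theorem isCycleOver_Omega (hg : IsIsometric h g) {Td : M → GForm (Coord (n + 1))}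
    (hTd : IsSmoothForm Td) (hd : extD Td = 0) (hTdg : pullback g Td = Td) :
    IsCycleOver ((n + 1) + n) (Symbols hg) mulF oneF (OmegaDeg hg) mulM dM (tau Td) ofFun := by
  have hS := iSup_OmegaDeg hg
  -- Conditions over the sum of the homogeneous parts become conditions over Ω itself.
  constructor <;> try rw [hS]
  · exact isAlgebraOn_Symbols hg
  · exact iSupIndep_OmegaDeg hg
  · exact fun k hk => OmegaDeg_eq_bot hg hk
  · exact isAlgebraOn_Omega hg
  · exact fun k l α hα β hβ => mulM_mem_OmegaDeg hα hβ
  · exact fun k α hα => dM_mem_OmegaDeg hα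
  · exact fun α hα β hβ => funext fun i => funext fun j =>
      extD_add (hα.1.isSmoothForm i j) (hβ.1.isSmoothForm i j)
  · exact fun z α hα => funext fun i => funext fun j => extD_smul z (hα.1.isSmoothForm i j)
  · exact fun α hα => dM_dM hα.1
  · intro k α hα β hβ
    rw [dM_mulM hα.1.1 hβ.1, signM_homogeneous hα.2, mulM_smul_left _ hα.1.1 hβ.1.dM]
  · exact fun α hα β hβ => tau_add hTd hα.1 hβ.1
  · exact fun z α _ => tau_smul Td z α
  · exact fun α hα => tau_dM hTd hd hα.1
  · exact fun k l α hα β hβ => tau_mulM_comm hg hTd hTdg hα hβ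
  · exact fun f hf => ofFun_mem_OmegaDeg_iff.2 hf
  · exact fun f _ f' _ => ofFun_add f f'
  · exact fun z f _ => ofFun_smul z f
  · exact fun f hf f' hf' => ofFun_mul hf hf'

end SymbolAlgebra

end ClosedTrace
end

theorem mainTheorem6 {n : ℕ} {M : Type*} [TopologicalSpace M] [T2Space M] [CompactSpace M]
    [ChartedSpace (Coord (n + 1)) M] [IsManifold (𝓡 (n + 1)) ∞ M]
    (h : Metric (n + 1) M) (g : M ≃ₘ^∞⟮𝓡 (n + 1), 𝓡 (n + 1)⟯ M) (hg : IsIsometric h g)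
    (Td : M → GForm (Coord (n + 1))) (hTd : RepresentsTodd h Td) (hTdg : pullback g Td = Td) :
    (∀ α ∈ Omega hg, tau Td (dM α) = 0) ∧
    (∀ k l : ℕ, ∀ α ∈ OmegaDeg hg k, ∀ β ∈ OmegaDeg hg l,
      tau Td (mulM α β) = (-1 : ℂ) ^ (k * l) * tau Td (mulM β α)) ∧
    (⨆ k, OmegaDeg hg k) = Omega hg ∧
    Set.BijOn ofFun (Symbols hg : Set (Cosphere h → ℤ → ℤ → ℂ))
      (OmegaDeg hg 0 : Set (MForm (SCoord n) (Cosphere h))) ∧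
    IsCycleOver ((n + 1) + n) (Symbols hg) mulF oneF (OmegaDeg hg) mulM dM (tau Td) ofFun := by
  obtain ⟨h1, h2, -⟩ := hTd
  have hC := isCycleOver_Omega hg h1 h2 hTdg
  exact ⟨fun _ hα => tau_dM h1 h2 hα.1, hC.graded_trace, iSup_OmegaDeg hg, bijOn_ofFun hg, hC⟩
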